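/- Let $r>1$ be an odd integer and $k$ an odd integer coprime to $r$. Put $q^x=e^{xk\pi i/r}$ for $x\in\mathbb C$, $q=q^1$ and $\{x\}=q^x-q^{-x}$. Let $\bar U_q(\mathfrak{sl}_2)$ be the Hopf algebra over $\mathbb C$ generated by $E,F,K,K^{-1}$ with relations $KK^{-1}=K^{-1}K=1$, $KEK^{-1}=q^2E$, $KFK^{-1}=q^{-2}F$, $EF-FE=\frac{K-K^{-1}}{q-q^{-1}}$, $E^r=F^r=0$, coproduct $\Delta E=1\otimes E+E\otimes K$, $\Delta F=K^{-1}\otimes F+F\otimes 1$, $\Delta K^{\pm1}=K^{\pm1}\otimes K^{\pm1}$, counit $\varepsilon(E)=\varepsilon(F)=0$, $\varepsilon(K^{\pm1})=1$ and antipode $S(E)=-EK^{-1}$, $S(F)=-KF$, $S(K)=K^{-1}$. Let $\mathcal C$ be the category of finite-dimensional $\bar U_q(\mathfrak{sl}_2)$-modules on which $K$ acts diagonally. It is a pivotal tensor Ab-category with ground ring $\mathbb C$, with $V^*=\mathrm{Hom}_{\mathbb C}(V,\mathbb C)$ and duality morphisms $$b_V:1\mapsto\sum_j v_j\otimes v_j^*,\quad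 d_V:f\otimes v\mapsto f(v),\quad b'_V:1\mapsto\sum_j v_j^*\otimes K^{r-1}v_j,\quad d'_V:v\otimes f\mapsto f(K^{1-r}v).$$ The function $x\mapsto q^x$ is well defined and injective on $\mathbb C/\tfrac{2r}{k}\mathbb Z$. Let $$I=\bigl(\mathbb C\setminus\tfrac1k\mathbb Z\bigr)\big/\tfrac{2r}{k}\mathbb Z,\qquad i^*=-i ,$$ so that $I=(\mathbb C\setminus\mathbb Z)/2r\mathbb Z$ when $k=\pm1$. For $i\in I$ let $V_i$ be a highest weight module of highest weight $i+r-1$, that is, a module of $\mathcal C$ generated by a vector $v\neq0$ with $Ev=0$ and $Kv=q^{i+r-1}v$; such modules exist. Then, for every choice of such modules $V_i$: (1) The family $\{V_i\}_{i\in I}$ is part of basic data: $i\mapsto i^*$ is an involution of $I$, $\mathrm{End}(V_i)=\mathbb C\,\mathrm{Id}_{V_i}$, $\mathrm{Hom}(V_i,V_j)=0$ for $i\ne j$, and there are isomorphisms $w_i:V_i\to (V_{i^*})^*$ with $d_{V_i}(w_{i^*}\otimes\mathrm{Id}_{V_i})=d'_{V_{i^*}}(\mathrm{Id}_{V_{i^*}}\otimes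 w_i)$ for all $i\in I$. (2) Let $$\mathsf d:I\to\mathbb C,\qquad \mathsf d(i)=\frac1{\prod_{j=0}^{r-2}\{i-1-j\}} .$$ The pair $(I_0=I,\mathsf d)$ is trivalent-ambidextrous in $\mathcal C$ for all such basic data: $I_0$ is stable under $*$, $\mathsf d(i)=\mathsf d(i^*)$ for all $i\in I_0$, and for every connected $\mathcal C$-colored ribbon graph $T$ in $S^2$ all of whose coupons are adjacent to exactly three half-edges, all of whose edges are colored by objects of $\{V_i\}_{i\in I}$, and at least one of whose edges is colored by an object of $\{V_i\}_{i\in I_0}$, and for any two cutting presentations $T_{V_i}$, $T_{V_j}$ of $T$ with $i,j\in I_0$, $$\mathsf d(i)\,\langle T_{V_i}\rangle=\mathsf d(j)\,\langle T_{V_j}\rangle .$$ Here a cutting presentation $T_V$ is a ribbon graph in $\mathbb R\times[0,1]$ with one input and one output, both directed downward and colored with $V$, whose closure is isotopic to $T$ in $S^2$ (it is obtained by cutting $T$ at an edge colored with $V$), and $\langle T_V\rangle\in\mathbb C$ is the scalar with $G(T_V)=\langle T_V\rangle\,\mathrm{Id}_V$, where $G$ is the functor from $\mathcal C$-colored ribbon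 graphs in $\mathbb R\times[0,1]$ to $\mathcal C$ that evaluates cups and caps by $b,d,b',d'$ and coupons by their colors. -/

import Mathlib

open CategoryTheory MonoidalCategory

noncomputable section

universe v u

/-! ### Pivotal tensor Ab-categories -/

/-- A pivotal structure on a (not necessarily strict) tensor category: a left duality
`b_V : 𝟙 ⟶ V ⊗ V*`, `d_V : V* ⊗ V ⟶ 𝟙` and a right duality `b'_V : 𝟙 ⟶ V* ⊗ V`,
`d'_V : V ⊗ V* ⟶ 𝟙` with the same dual objects, such that both dualities induce the same
transpose of every morphism and the same isomorphisms `W* ⊗ V* ⟶ (V ⊗ W)*`. -/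
class Pivotal (C : Type u) [Category.{v} C] [MonoidalCategory C] where
  dual : C → C
  b (V : C) : 𝟙_ C ⟶ V ⊗ dual V
  d (V : C) : dual V ⊗ V ⟶ 𝟙_ C
  b' (V : C) : 𝟙_ C ⟶ dual V ⊗ V
  d' (V : C) : V ⊗ dual V ⟶ 𝟙_ C
  zigzag (V : C) :
    (λ_ V).inv ≫ b V ▷ V ≫ (α_ _ _ _).hom ≫ V ◁ d V ≫ (ρ_ V).hom = 𝟙 V
  zigzag_dual (V : C) :
    (ρ_ (dual V)).inv ≫ dual V ◁ b V ≫ (α_ _ _ _).inv ≫ d V ▷ dual V ≫ (λ_ (dual V)).hom =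
      𝟙 (dual V)
  zigzag' (V : C) :
    (ρ_ V).inv ≫ V ◁ b' V ≫ (α_ _ _ _).inv ≫ d' V ▷ V ≫ (λ_ V).hom = 𝟙 V
  zigzag_dual' (V : C) :
    (λ_ (dual V)).inv ≫ b' V ▷ dual V ≫ (α_ _ _ _).hom ≫ dual V ◁ d' V ≫ (ρ_ (dual V)).hom =
      𝟙 (dual V)
  transpose_eq {V W : C} (f : V ⟶ W) :
    (ρ_ (dual W)).inv ≫ dual W ◁ b V ≫ dual W ◁ (f ▷ dual V) ≫ (α_ _ _ _).inv ≫
        d W ▷ dual V ≫ (λ_ (dual V)).hom =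
      (λ_ (dual W)).inv ≫ b' V ▷ dual W ≫ (dual V ◁ f) ▷ dual W ≫ (α_ _ _ _).hom ≫
        dual V ◁ d' W ≫ (ρ_ (dual V)).hom
  tensor_dual_eq (V W : C) :
    (ρ_ (dual W ⊗ dual V)).inv ≫ (dual W ⊗ dual V) ◁ b (V ⊗ W) ≫ (α_ _ _ _).inv ≫
        ((α_ (dual W) (dual V) (V ⊗ W)).hom ≫
          dual W ◁ ((α_ (dual V) V W).inv ≫ d V ▷ W ≫ (λ_ W).hom) ≫ d W) ▷ dual (V ⊗ W) ≫
        (λ_ (dual (V ⊗ W))).hom =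
      (λ_ (dual W ⊗ dual V)).inv ≫ b' (V ⊗ W) ▷ (dual W ⊗ dual V) ≫ (α_ _ _ _).hom ≫
        dual (V ⊗ W) ◁ ((α_ V W (dual W ⊗ dual V)).hom ≫
          V ◁ ((α_ W (dual W) (dual V)).inv ≫ d' W ▷ dual V ≫ (λ_ (dual V)).hom) ≫ d' V) ≫
        (ρ_ (dual (V ⊗ W))).hom

namespace Pivotal

variable {C : Type u} [Category.{v} C] [MonoidalCategory C]

/-- The action `k f = k ⊗ f` of the ground ring `End 𝟙` on morphisms. -/
def groundSMul (k : End (𝟙_ C)) {V W : C} (f : V ⟶ W) : V ⟶ W :=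
  (λ_ V).inv ≫ ((show 𝟙_ C ⟶ 𝟙_ C from k) ⊗ₘ f) ≫ (λ_ W).hom

/-- An object is simple when `k ↦ k Id_V` is a bijection from the ground ring onto `End V`. -/
def IsSimple (V : C) : Prop :=
  ∀ f : V ⟶ V, ∃! k : End (𝟙_ C), f = groundSMul k (𝟙 V)

/-- For an endomorphism `f` of a simple object, `⟨f⟩` is the scalar with `f = ⟨f⟩ Id_V`. -/
def bracket {V : C} (h : IsSimple V) (f : V ⟶ V) : End (𝟙_ C) :=
  (h f).choose

/-! ### Colored ribbon graphs in the strip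

The category of `C`-colored ribbon graphs in `ℝ × [0,1]` up to isotopy. A sequence of signed
objects is kept together with a bracketing, so that evaluation in a non-strict tensor category
needs no coherence isomorphisms; rebracketing is the (invisible) identity graph. Morphisms go from
the bottom to the top of the strip; `(V, true)` is a downward and `(V, false)` an upward strand. -/

/-- Bracketed sequences of signed objects. -/
inductive Word (C : Type u) : Type u
  | unit : Word C
  | strand (V : C) (ε : Bool) : Word C
  | tensor (X Y : Word C) : Word C

namespace Word

/-- The dual sequence: order and signs are reversed. -/
def dual : Word C → Word C
  | unit => unit
  | strand V ε => strand V (!ε)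
  | tensor X Y => tensor (dual Y) (dual X)

/-- A list of signed objects as a (right bracketed) word. -/
def ofList : List (C × Bool) → Word C
  | [] => unit
  | [a] => strand a.1 a.2
  | a :: a' :: l => tensor (strand a.1 a.2) (ofList (a' :: l))

/-- The set of colors of a word. -/
def colors : Word C → Set C
  | unit => ∅
  | strand V _ => {V}
  | tensor X Y => colors X ∪ colors Y

/-- The set of strands of a word. -/
def Pos : Word C → Type
  | unit => Empty
  | strand _ _ => Unit
  | tensor X Y => Pos X ⊕ Pos Y

/-- The object of `C` represented by a word: `V` for `(V, +)` and `V*` for `(V, -)`. -/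
def obj [Pivotal C] : Word C → C
  | unit => 𝟙_ C
  | strand V true => V
  | strand V false => Pivotal.dual V
  | tensor X Y => obj X ⊗ obj Y

end Word

open Word

variable [Pivotal C]

/-- Plane diagrams of `C`-colored ribbon graphs, cut into elementary pieces: trivial strands,
rebracketings, right oriented cups and caps (`cup`, `cap`), left oriented cups and caps
(`cup'`, `cap'`), and coupons with arbitrary arrows on their bottom and top sides. -/
inductive Diagram : Word C → Word C → Type (max u v)
  | id (X : Word C) : Diagram X X
  | comp {X Y Z : Word C} (S : Diagram X Y) (T : Diagram Y Z) : Diagram X Z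
  | tensor {X Y X' Y' : Word C} (S : Diagram X Y) (T : Diagram X' Y') :
      Diagram (X.tensor X') (Y.tensor Y')
  | assoc (X Y Z : Word C) : Diagram ((X.tensor Y).tensor Z) (X.tensor (Y.tensor Z))
  | assocInv (X Y Z : Word C) : Diagram (X.tensor (Y.tensor Z)) ((X.tensor Y).tensor Z)
  | lunit (X : Word C) : Diagram (unit.tensor X) X
  | lunitInv (X : Word C) : Diagram X (unit.tensor X)
  | runit (X : Word C) : Diagram (X.tensor unit) X
  | runitInv (X : Word C) : Diagram X (X.tensor unit)
  | cup (V : C) : Diagram unit ((strand V true).tensor (strand V false))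
  | cap (V : C) : Diagram ((strand V false).tensor (strand V true)) unit
  | cup' (V : C) : Diagram unit ((strand V false).tensor (strand V true))
  | cap' (V : C) : Diagram ((strand V true).tensor (strand V false)) unit
  | coupon (a c : List (C × Bool)) (f : (ofList a).obj ⟶ (ofList c).obj) :
      Diagram (ofList a) (ofList c)

namespace Diagram

/-- The functor `G` from colored ribbon graphs to `C`. -/
def eval : {X Y : Word C} → Diagram X Y → (X.obj ⟶ Y.obj)
  | _, _, id X => 𝟙 X.obj
  | _, _, comp S T => eval S ≫ eval T
  | _, _, tensor S T => eval S ⊗ₘ eval T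
  | _, _, assoc X Y Z => (α_ X.obj Y.obj Z.obj).hom
  | _, _, assocInv X Y Z => (α_ X.obj Y.obj Z.obj).inv
  | _, _, lunit X => (λ_ X.obj).hom
  | _, _, lunitInv X => (λ_ X.obj).inv
  | _, _, runit X => (ρ_ X.obj).hom
  | _, _, runitInv X => (ρ_ X.obj).inv
  | _, _, cup V => Pivotal.b V
  | _, _, cap V => Pivotal.d V
  | _, _, cup' V => Pivotal.b' V
  | _, _, cap' V => Pivotal.d' V
  | _, _, coupon _ _ f => f

/-- The set of colors of the edges of a ribbon graph. -/
def colors : {X Y : Word C} → Diagram X Y → Set C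
  | _, _, id X => X.colors
  | _, _, comp S T => colors S ∪ colors T
  | _, _, tensor S T => colors S ∪ colors T
  | _, _, assoc X Y Z => X.colors ∪ Y.colors ∪ Z.colors
  | _, _, assocInv X Y Z => X.colors ∪ Y.colors ∪ Z.colors
  | _, _, lunit X => X.colors
  | _, _, lunitInv X => X.colors
  | _, _, runit X => X.colors
  | _, _, runitInv X => X.colors
  | _, _, cup V => {V}
  | _, _, cap V => {V}
  | _, _, cup' V => {V}
  | _, _, cap' V => {V}
  | _, _, coupon a c _ => (ofList a).colors ∪ (ofList c).colors

/-- Every coupon is adjacent to exactly three half-edges. -/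
def Trivalent : {X Y : Word C} → Diagram X Y → Prop
  | _, _, comp S T => Trivalent S ∧ Trivalent T
  | _, _, tensor S T => Trivalent S ∧ Trivalent T
  | _, _, coupon a c _ => a.length + c.length = 3
  | _, _, _ => True

/-- The elementary connected pieces of a diagram: trivial strands, cups, caps and coupons. -/
def Piece : {X Y : Word C} → Diagram X Y → Type
  | _, _, id X => X.Pos
  | _, _, comp S T => Piece S ⊕ Piece T
  | _, _, tensor S T => Piece S ⊕ Piece T
  | _, _, assoc X Y Z => ((X.tensor Y).tensor Z).Pos
  | _, _, assocInv X Y Z => (X.tensor (Y.tensor Z)).Pos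
  | _, _, lunit X => X.Pos
  | _, _, lunitInv X => X.Pos
  | _, _, runit X => X.Pos
  | _, _, runitInv X => X.Pos
  | _, _, cup _ => Unit
  | _, _, cap _ => Unit
  | _, _, cup' _ => Unit
  | _, _, cap' _ => Unit
  | _, _, coupon _ _ _ => Unit

/-- The piece containing a given input. -/
def bottom : {X Y : Word C} → (D : Diagram X Y) → X.Pos → D.Piece
  | _, _, id _ => fun p => p
  | _, _, comp S _ => fun p => Sum.inl (bottom S p)
  | _, _, tensor S T => Sum.map (bottom S) (bottom T)
  | _, _, assoc _ _ _ => fun p => p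
  | _, _, assocInv _ _ _ => fun p => p
  | _, _, lunit _ => Sum.elim Empty.elim (fun p => p)
  | _, _, lunitInv _ => fun p => p
  | _, _, runit _ => Sum.elim (fun p => p) Empty.elim
  | _, _, runitInv _ => fun p => p
  | _, _, cup _ => fun _ => ()
  | _, _, cap _ => fun _ => ()
  | _, _, cup' _ => fun _ => ()
  | _, _, cap' _ => fun _ => ()
  | _, _, coupon _ _ _ => fun _ => ()

/-- The piece containing a given output. -/
def top : {X Y : Word C} → (D : Diagram X Y) → Y.Pos → D.Piece
  | _, _, id _ => fun p => p
  | _, _, comp _ T => fun p => Sum.inr (top T p)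
  | _, _, tensor S T => Sum.map (top S) (top T)
  | _, _, assoc X Y Z => (Equiv.sumAssoc X.Pos Y.Pos Z.Pos).symm
  | _, _, assocInv X Y Z => Equiv.sumAssoc X.Pos Y.Pos Z.Pos
  | _, _, lunit _ => fun p => p
  | _, _, lunitInv _ => Sum.elim Empty.elim (fun p => p)
  | _, _, runit _ => fun p => p
  | _, _, runitInv _ => Sum.elim (fun p => p) Empty.elim
  | _, _, cup _ => fun _ => ()
  | _, _, cap _ => fun _ => ()
  | _, _, cup' _ => fun _ => ()
  | _, _, cap' _ => fun _ => ()
  | _, _, coupon _ _ _ => fun _ => ()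

/-- Two pieces are glued when they share a point at an interface of the diagram. -/
def Glued : {X Y : Word C} → (D : Diagram X Y) → D.Piece → D.Piece → Prop
  | _, _, comp (Y := Y) S T => fun p p' =>
      Sum.LiftRel (Glued S) (Glued T) p p' ∨
        ∃ y : Y.Pos, p = Sum.inl (S.top y) ∧ p' = Sum.inr (T.bottom y)
  | _, _, tensor S T => fun p p' => Sum.LiftRel (Glued S) (Glued T) p p'
  | _, _, _ => fun _ _ => False

/-- The underlying space of the ribbon graph is connected (and non-empty). -/
def Connected {X Y : Word C} (D : Diagram X Y) : Prop :=
  Nonempty D.Piece ∧ ∀ p p' : D.Piece, Relation.EqvGen D.Glued p p'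

/-- Nested right oriented cups `∅ ⟶ X X*`. -/
def coevL : (X : Word C) → Diagram unit (X.tensor X.dual)
  | .unit => lunitInv unit
  | .strand V true => cup V
  | .strand V false => cup' V
  | .tensor X Y =>
      (coevL X).comp <| (tensor (id X) ((lunitInv X.dual).comp
        ((tensor (coevL Y) (id X.dual)).comp (assoc Y Y.dual X.dual)))).comp
        (assocInv X Y (Y.dual.tensor X.dual))

/-- Nested caps `X* X ⟶ ∅`. -/
def evL : (X : Word C) → Diagram (X.dual.tensor X) unit
  | .unit => lunit unit
  | .strand V true => cap V
  | .strand V false => cap' V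
  | .tensor X Y =>
      (assoc Y.dual X.dual (X.tensor Y)).comp <| (tensor (id Y.dual)
        ((assocInv X.dual X Y).comp ((tensor (evL X) (id Y)).comp (lunit Y)))).comp (evL Y)

/-- Nested cups `∅ ⟶ X* X`. -/
def coevR : (X : Word C) → Diagram unit (X.dual.tensor X)
  | .unit => lunitInv unit
  | .strand V true => cup' V
  | .strand V false => cup V
  | .tensor X Y =>
      (coevR Y).comp <| (tensor (id Y.dual) ((lunitInv Y).comp
        ((tensor (coevR X) (id Y)).comp (assoc X.dual X Y)))).comp
        (assocInv Y.dual X.dual (X.tensor Y))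

/-- Nested caps `X X* ⟶ ∅`. -/
def evR : (X : Word C) → Diagram (X.tensor X.dual) unit
  | .unit => lunit unit
  | .strand V true => cap' V
  | .strand V false => cap V
  | .tensor X Y =>
      (assoc X Y (Y.dual.tensor X.dual)).comp <| (tensor (id X)
        ((assocInv Y Y.dual X.dual).comp ((tensor (evR Y) (id X.dual)).comp
          (lunit X.dual)))).comp (evR X)

/-- The diagram rotated by a half-turn, in one direction. -/
def rotL {X Y : Word C} (D : Diagram X Y) : Diagram Y.dual X.dual :=
  (runitInv Y.dual).comp <| (tensor (id Y.dual) (coevL X)).comp <|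
    (tensor (id Y.dual) (tensor D (id X.dual))).comp <| (assocInv Y.dual Y X.dual).comp <|
      (tensor (evL Y) (id X.dual)).comp (lunit X.dual)

/-- The diagram rotated by a half-turn, in the other direction. -/
def rotR {X Y : Word C} (D : Diagram X Y) : Diagram Y.dual X.dual :=
  (lunitInv Y.dual).comp <| (tensor (coevR X) (id Y.dual)).comp <|
    (tensor (tensor (id X.dual) D) (id Y.dual)).comp <| (assoc X.dual Y Y.dual).comp <|
      (tensor (id X.dual) (evR Y)).comp (runit X.dual)

/-- Closing the strands of a diagram by parallel arcs on its right. -/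
def closeR {X : Word C} (D : Diagram X X) : Diagram (unit : Word C) unit :=
  (coevL X).comp ((tensor D (id X.dual)).comp (evR X))

/-- Closing the strands of a diagram by parallel arcs on its left. -/
def closeL {X : Word C} (D : Diagram X X) : Diagram (unit : Word C) unit :=
  (coevR X).comp ((tensor (id X.dual) D).comp (evL X))

/-- Isotopy in the strip of the ribbon graphs represented by two diagrams, as generated by
elementary moves: moving distant pieces past each other (the laws of a tensor category),
straightening of strands, and rotation by a full turn. -/
inductive Isotopic : {X Y : Word C} → Diagram X Y → Diagram X Y → Prop
  | refl {X Y : Word C} (S : Diagram X Y) : Isotopic S S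
  | symm {X Y : Word C} {S T : Diagram X Y} : Isotopic S T → Isotopic T S
  | trans {X Y : Word C} {S T U : Diagram X Y} : Isotopic S T → Isotopic T U → Isotopic S U
  | comp {X Y Z : Word C} {S S' : Diagram X Y} {T T' : Diagram Y Z} :
      Isotopic S S' → Isotopic T T' → Isotopic (S.comp T) (S'.comp T')
  | tensor {X Y X' Y' : Word C} {S S' : Diagram X Y} {T T' : Diagram X' Y'} :
      Isotopic S S' → Isotopic T T' → Isotopic (S.tensor T) (S'.tensor T')
  | id_comp {X Y : Word C} (S : Diagram X Y) : Isotopic ((id X).comp S) S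
  | comp_id {X Y : Word C} (S : Diagram X Y) : Isotopic (S.comp (id Y)) S
  | comp_assoc {X Y Z W : Word C} (S : Diagram X Y) (T : Diagram Y Z) (U : Diagram Z W) :
      Isotopic ((S.comp T).comp U) (S.comp (T.comp U))
  | tensor_id (X Y : Word C) :
      Isotopic ((id X).tensor (id Y)) (id (X.tensor Y))
  | tensor_comp {X Y Z X' Y' Z' : Word C} (S : Diagram X Y) (T : Diagram Y Z)
      (S' : Diagram X' Y') (T' : Diagram Y' Z') :
      Isotopic ((S.comp T).tensor (S'.comp T')) ((S.tensor S').comp (T.tensor T'))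
  | assoc_assocInv (X Y Z : Word C) :
      Isotopic ((assoc X Y Z).comp (assocInv X Y Z)) (id _)
  | assocInv_assoc (X Y Z : Word C) :
      Isotopic ((assocInv X Y Z).comp (assoc X Y Z)) (id _)
  | lunit_lunitInv (X : Word C) : Isotopic ((lunit X).comp (lunitInv X)) (id _)
  | lunitInv_lunit (X : Word C) : Isotopic ((lunitInv X).comp (lunit X)) (id _)
  | runit_runitInv (X : Word C) : Isotopic ((runit X).comp (runitInv X)) (id _)
  | runitInv_runit (X : Word C) : Isotopic ((runitInv X).comp (runit X)) (id _)
  | assoc_natural {X Y X' Y' X'' Y'' : Word C} (S : Diagram X Y) (S' : Diagram X' Y')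
      (S'' : Diagram X'' Y'') :
      Isotopic (((S.tensor S').tensor S'').comp (assoc Y Y' Y''))
        ((assoc X X' X'').comp (S.tensor (S'.tensor S'')))
  | lunit_natural {X Y : Word C} (S : Diagram X Y) :
      Isotopic (((id unit).tensor S).comp (lunit Y)) ((lunit X).comp S)
  | runit_natural {X Y : Word C} (S : Diagram X Y) :
      Isotopic ((S.tensor (id unit)).comp (runit Y)) ((runit X).comp S)
  | pentagon (X Y Z W : Word C) :
      Isotopic (((assoc X Y Z).tensor (id W)).comp
          ((assoc X (Y.tensor Z) W).comp ((id X).tensor (assoc Y Z W))))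
        ((assoc (X.tensor Y) Z W).comp (assoc X Y (Z.tensor W)))
  | triangle (X Y : Word C) :
      Isotopic ((assoc X unit Y).comp ((id X).tensor (lunit Y))) ((runit X).tensor (id Y))
  | straighten (V : C) : Isotopic
      ((lunitInv _).comp (((cup V).tensor (id _)).comp ((assoc _ _ _).comp
        (((id _).tensor (cap V)).comp (runit _))))) (id (strand V true))
  | straighten_dual (V : C) : Isotopic
      ((runitInv _).comp (((id _).tensor (cup V)).comp ((assocInv _ _ _).comp
        (((cap V).tensor (id _)).comp (lunit _))))) (id (strand V false))
  | straighten' (V : C) : Isotopic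
      ((runitInv _).comp (((id _).tensor (cup' V)).comp ((assocInv _ _ _).comp
        (((cap' V).tensor (id _)).comp (lunit _))))) (id (strand V true))
  | straighten_dual' (V : C) : Isotopic
      ((lunitInv _).comp (((cup' V).tensor (id _)).comp ((assoc _ _ _).comp
        (((id _).tensor (cap' V)).comp (runit _))))) (id (strand V false))
  | full_turn {X Y : Word C} (S : Diagram X Y) : Isotopic S.rotL S.rotR

/-- Isotopy in `S² = ℝ² ∪ {∞}` of graphs without inputs and outputs: isotopy in the plane together
with moving arcs across the point `∞`. -/
inductive SphereIsotopic : Diagram (unit : Word C) unit → Diagram (unit : Word C) unit → Prop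
  | plane {S T : Diagram (unit : Word C) unit} : Isotopic S T → SphereIsotopic S T
  | across {X : Word C} (S : Diagram X X) : SphereIsotopic S.closeR S.closeL
  | symm {S T : Diagram (unit : Word C) unit} : SphereIsotopic S T → SphereIsotopic T S
  | trans {S T U : Diagram (unit : Word C) unit} :
      SphereIsotopic S T → SphereIsotopic T U → SphereIsotopic S U

/-- `A` is a cutting presentation of the ribbon graph `T ⊂ S²` at an edge colored with `V`: the
input and the output of `A` are directed downward and colored with `V`, and the closure of `A` is
isotopic to `T` in `S²`. -/
def IsCuttingPresentation (T : Diagram (unit : Word C) unit) {V : C}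
    (A : Diagram (strand V true) (strand V true)) : Prop :=
  SphereIsotopic A.closeR T

end Diagram

/-! ### Basic data and trivalent-ambidextrous pairs -/

variable [Preadditive C] [MonoidalPreadditive C]

/-- Basic data with underlying family `V` and involution `star`. -/
structure BasicData {I : Type*} (V : I → C) (star : I → I) where
  star_star : ∀ i, star (star i) = i
  simple : ∀ i, IsSimple (V i)
  hom_eq_zero : ∀ {i j}, i ≠ j → ∀ f : V i ⟶ V j, f = 0
  w : ∀ i, V i ≅ Pivotal.dual (V (star i))
  w_compat : ∀ i,
    ((w (star i)).hom ≫ eqToHom (by rw [star_star i])) ▷ V i ≫ Pivotal.d (V i) =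
      V (star i) ◁ (w i).hom ≫ Pivotal.d' (V (star i))

/-- The class of connected trivalent ribbon graphs in `S²` whose edges are colored by the objects
`V i`, at least one of them with `i ∈ I₀`. -/
structure IsTrivalentGraph {I : Type*} (V : I → C) (I₀ : Set I)
    (T : Diagram (unit : Word C) unit) : Prop where
  connected : T.Connected
  trivalent : T.Trivalent
  colors_subset : T.colors ⊆ Set.range V
  color_mem : ∃ i ∈ I₀, V i ∈ T.colors

/-- Trivalent-ambidextrous pairs `(I₀, d)`. -/
def BasicData.IsTrivalentAmbidextrous {I : Type*} {V : I → C} {star : I → I}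
    (B : BasicData V star) (I₀ : Set I) (d : I₀ → End (𝟙_ C)) : Prop :=
  ∃ h : ∀ i ∈ I₀, star i ∈ I₀,
    (∀ i : I₀, d i = d ⟨star i, h i i.2⟩) ∧
    ∀ T : Diagram (unit : Word C) unit, IsTrivalentGraph V I₀ T →
      ∀ (i j : I₀) (A : Diagram (strand (V i) true) (strand (V i) true))
        (A' : Diagram (strand (V j) true) (strand (V j) true)),
        T.IsCuttingPresentation A → T.IsCuttingPresentation A' →
          d i * bracket (B.simple i) A.eval = d j * bracket (B.simple j) A'.eval

end Pivotal

/-! ### The Hopf algebra `Ū_q(sl₂)` -/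

open scoped TensorProduct

namespace UqSl2

/-- The parameters: an odd integer `r > 1` and an odd integer `k` coprime to `r`. (For `r = 1` one
would have `q - q⁻¹ = 0`.) -/
structure RootData where
  r : ℕ
  k : ℤ
  one_lt : 1 < r
  odd_r : Odd r
  odd_k : Odd k
  coprime : IsCoprime k (r : ℤ)

namespace RootData

variable (R : RootData)

/-- `q^x = exp (x k i π / r)`. -/
def qpow (x : ℂ) : ℂ := Complex.exp (x * R.k * Complex.I * Real.pi / R.r)

/-- `q = exp (k i π / r)`. -/
def q : ℂ := R.qpow 1

lemma r_ne : (R.r : ℂ) ≠ 0 := Nat.cast_ne_zero.2 (by have := R.one_lt; omega)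

lemma k_ne : (R.k : ℂ) ≠ 0 := by
  have := R.odd_k
  refine Int.cast_ne_zero.2 (fun h => ?_)
  rw [h] at this
  exact absurd this (by decide)

lemma q_ne : R.q ≠ 0 := Complex.exp_ne_zero _

lemma q_sq : R.q ^ 2 = Complex.exp (2 * Real.pi * Complex.I * ((R.k : ℂ) / R.r)) := by
  rw [q, qpow, ← Complex.exp_nat_mul]
  congr 1
  push_cast
  ring

lemma q_sq_pow_eq_one_iff (n : ℕ) : (R.q ^ 2) ^ n = 1 ↔ R.r ∣ n := by
  have hr := R.r_ne
  rw [q_sq, ← Complex.exp_nat_mul, Complex.exp_eq_one_iff]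
  have hpi : (2 * Real.pi * Complex.I : ℂ) ≠ 0 := Complex.two_pi_I_ne_zero
  constructor
  · rintro ⟨m, hm⟩
    have h1 : ((n * R.k : ℤ) : ℂ) = ((m * R.r : ℤ) : ℂ) := by
      have : (n : ℂ) * ((R.k : ℂ) / R.r) = m := by
        apply mul_left_cancel₀ hpi
        linear_combination hm
      push_cast
      field_simp at this
      linear_combination this
    have h2 : (R.r : ℤ) ∣ n * R.k := ⟨m, by rw [Int.cast_inj.1 h1]; ring⟩
    exact Int.natCast_dvd_natCast.1 (R.coprime.symm.dvd_of_dvd_mul_right h2)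
  · rintro ⟨m, rfl⟩
    refine ⟨m * R.k, ?_⟩
    push_cast
    field_simp

lemma q_sq_ne_one : R.q ^ 2 ≠ 1 := by
  intro h
  have := (R.q_sq_pow_eq_one_iff 1).1 (by simpa using h)
  have := Nat.dvd_one.1 this
  have := R.one_lt
  omega

end RootData

/-- The generators `E, F, K, K⁻¹`. -/
inductive Gen
  | E | F | K | Kinv

open FreeAlgebra in
/-- The defining relations of `Ū_q(sl₂)`. -/
inductive Rel (R : RootData) : FreeAlgebra ℂ Gen → FreeAlgebra ℂ Gen → Prop
  | K_Kinv : Rel R (ι ℂ Gen.K * ι ℂ Gen.Kinv) 1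
  | Kinv_K : Rel R (ι ℂ Gen.Kinv * ι ℂ Gen.K) 1
  | K_E : Rel R (ι ℂ Gen.K * ι ℂ Gen.E * ι ℂ Gen.Kinv) (R.q ^ 2 • ι ℂ Gen.E)
  | K_F : Rel R (ι ℂ Gen.K * ι ℂ Gen.F * ι ℂ Gen.Kinv) ((R.q⁻¹) ^ 2 • ι ℂ Gen.F)
  | E_F : Rel R (ι ℂ Gen.E * ι ℂ Gen.F - ι ℂ Gen.F * ι ℂ Gen.E)
      ((R.q - R.q⁻¹)⁻¹ • (ι ℂ Gen.K - ι ℂ Gen.Kinv))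
  | E_pow : Rel R (ι ℂ Gen.E ^ R.r) 0
  | F_pow : Rel R (ι ℂ Gen.F ^ R.r) 0

/-- The algebra `Ū_q(sl₂)`. -/
def Ubar (R : RootData) : Type := RingQuot (Rel R)

namespace Ubar

variable (R : RootData)

instance : Ring (Ubar R) := inferInstanceAs (Ring (RingQuot (Rel R)))
instance : Algebra ℂ (Ubar R) := inferInstanceAs (Algebra ℂ (RingQuot (Rel R)))

/-- The quotient map from the free algebra. -/
def mk : FreeAlgebra ℂ Gen →ₐ[ℂ] Ubar R := RingQuot.mkAlgHom ℂ (Rel R)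

/-- The class of a generator. -/
def gen (g : Gen) : Ubar R := mk R (FreeAlgebra.ι ℂ g)

variable {R}

/-- Elements of an algebra satisfying the defining relations. -/
structure Satisfies (R : RootData) {A : Type*} [Ring A] [Algebra ℂ A] (x : Gen → A) : Prop where
  K_Kinv : x .K * x .Kinv = 1
  Kinv_K : x .Kinv * x .K = 1
  K_E : x .K * x .E * x .Kinv = R.q ^ 2 • x .E
  K_F : x .K * x .F * x .Kinv = (R.q⁻¹) ^ 2 • x .F
  E_F : x .E * x .F - x .F * x .E = (R.q - R.q⁻¹)⁻¹ • (x .K - x .Kinv)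
  E_pow : x .E ^ R.r = 0
  F_pow : x .F ^ R.r = 0

lemma mk_rel {a b : FreeAlgebra ℂ Gen} (h : Rel R a b) :
    mk R a = mk R b :=
  RingQuot.mkAlgHom_rel ℂ h

lemma satisfies_gen : Satisfies R (gen R) where
  K_Kinv := by simpa [gen] using mk_rel (R := R) .K_Kinv
  Kinv_K := by simpa [gen] using mk_rel (R := R) .Kinv_K
  K_E := by simpa [gen] using mk_rel (R := R) .K_E
  K_F := by simpa [gen] using mk_rel (R := R) .K_F
  E_F := by simpa [gen] using mk_rel (R := R) .E_F
  E_pow := by simpa [gen] using mk_rel (R := R) .E_pow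
  F_pow := by simpa [gen] using mk_rel (R := R) .F_pow

/-- The universal property of the presentation. -/
def lift {A : Type*} [Ring A] [Algebra ℂ A] (x : Gen → A) (h : Satisfies R x) :
    Ubar R →ₐ[ℂ] A :=
  RingQuot.liftAlgHom ℂ ⟨FreeAlgebra.lift ℂ x, by
    intro a b hab
    cases hab
    · simpa using h.K_Kinv
    · simpa using h.Kinv_K
    · simpa using h.K_E
    · simpa using h.K_F
    · simpa using h.E_F
    · simpa using h.E_pow
    · simpa using h.F_pow⟩

@[simp] lemma lift_gen {A : Type*} [Ring A] [Algebra ℂ A] (x : Gen → A) (h : Satisfies R x)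
    (g : Gen) : lift x h (gen R g) = x g := by
  have := RingQuot.liftAlgHom_mkAlgHom_apply ℂ (FreeAlgebra.lift ℂ x) (s := Rel R)
    (by
      intro a b hab
      cases hab
      · simpa using h.K_Kinv
      · simpa using h.Kinv_K
      · simpa using h.K_E
      · simpa using h.K_F
      · simpa using h.E_F
      · simpa using h.E_pow
      · simpa using h.F_pow) (FreeAlgebra.ι ℂ g)
  exact this.trans (by simp)

/-- Induction on the generators. -/
lemma induction {P : Ubar R → Prop} (hs : ∀ c : ℂ, P (algebraMap ℂ _ c)) (hg : ∀ g, P (gen R g))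
    (hadd : ∀ x y, P x → P y → P (x + y)) (hmul : ∀ x y, P x → P y → P (x * y))
    (x : Ubar R) : P x := by
  obtain ⟨a, rfl⟩ : ∃ a, mk R a = x := RingQuot.mkAlgHom_surjective ℂ (Rel R) x
  induction a using FreeAlgebra.induction with
  | grade0 c => rw [AlgHom.commutes]; exact hs c
  | grade1 g => exact hg g
  | mul a b ha hb => rw [map_mul]; exact hmul _ _ ha hb
  | add a b ha hb => rw [map_add]; exact hadd _ _ ha hb

section qbinomial

variable {A : Type*} [Ring A] [Algebra ℂ A]

/-- Gaussian binomial coefficients. -/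
def gauss (ω : ℂ) : ℕ → ℕ → ℂ
  | 0, 0 => 1
  | 0, _ + 1 => 0
  | n + 1, 0 => gauss ω n 0
  | n + 1, j + 1 => gauss ω n j + ω ^ (j + 1) * gauss ω n (j + 1)

lemma gauss_zero (ω : ℂ) (n : ℕ) : gauss ω n 0 = 1 := by
  induction n with
  | zero => rfl
  | succ n ih => rw [gauss, ih]

lemma gauss_of_lt (ω : ℂ) (n j : ℕ) (h : n < j) : gauss ω n j = 0 := by
  induction n generalizing j with
  | zero => cases j with
    | zero => omega
    | succ j => rfl
  | succ n ih => cases j with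
    | zero => omega
    | succ j => rw [gauss, ih _ (by omega), ih _ (by omega)]; ring

lemma gauss_step (ω : ℂ) (n j : ℕ) :
    gauss ω n (j + 1) * (ω ^ (j + 1) - 1) * ω ^ j = gauss ω n j * (ω ^ n - ω ^ j) := by
  induction n generalizing j with
  | zero => cases j <;> simp [gauss]
  | succ n ih =>
    cases j with
    | zero =>
      have := ih 0
      simp only [gauss, gauss_zero] at this ⊢
      linear_combination ω * this
    | succ j =>
      have h1 := ih j
      have h2 := ih (j + 1)
      simp only [gauss]
      linear_combination ω ^ (j + 2) * h2 + ω * h1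

lemma gauss_eq_zero (j : ℕ) (hj : 0 < j) (hjr : j < R.r) : gauss (R.q ^ 2) R.r j = 0 := by
  have hr : (R.q ^ 2) ^ R.r = 1 := (R.q_sq_pow_eq_one_iff _).2 dvd_rfl
  have hne : ∀ m, 0 < m → m < R.r → (R.q ^ 2) ^ m - 1 ≠ 0 := fun m h0 h1 h =>
    absurd (Nat.le_of_dvd h0 ((R.q_sq_pow_eq_one_iff m).1 (sub_eq_zero.1 h))) (by omega)
  induction j with
  | zero => omega
  | succ j ih =>
    have h := gauss_step (R.q ^ 2) R.r j
    have h0 : gauss (R.q ^ 2) R.r j * ((R.q ^ 2) ^ R.r - (R.q ^ 2) ^ j) = 0 := by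
      rcases Nat.eq_zero_or_pos j with rfl | hj'
      · rw [hr]; simp
      · rw [ih hj' (by omega)]; simp
    rw [h0] at h
    have h2 : (R.q ^ 2) ^ j ≠ 0 := pow_ne_zero _ (pow_ne_zero _ R.q_ne)
    rcases mul_eq_zero.1 h with h | h
    · rcases mul_eq_zero.1 h with h | h
      · exact h
      · exact absurd h (hne _ (by omega) hjr)
    · exact absurd h h2

lemma mul_pow_skew {x y : A} {ω : ℂ} (h : y * x = ω • (x * y)) (n : ℕ) :
    y * x ^ n = ω ^ n • (x ^ n * y) := by
  induction n with
  | zero => simp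
  | succ n ih =>
    rw [pow_succ, ← mul_assoc, ih, smul_mul_assoc, mul_assoc, h, mul_smul_comm, smul_smul,
      ← mul_assoc, pow_succ]

lemma add_pow_skew {x y : A} {ω : ℂ} (h : y * x = ω • (x * y)) (n : ℕ) :
    (x + y) ^ n = ∑ j ∈ Finset.range (n + 1), gauss ω n j • (x ^ j * y ^ (n - j)) := by
  induction n with
  | zero => simp [gauss]
  | succ n ih =>
    rw [pow_succ', ih, add_mul]
    conv_rhs => rw [Finset.sum_range_succ']
    have e1 : x * ∑ j ∈ Finset.range (n + 1), gauss ω n j • (x ^ j * y ^ (n - j)) =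
        ∑ j ∈ Finset.range (n + 1), gauss ω n j • (x ^ (j + 1) * y ^ (n + 1 - (j + 1))) := by
      rw [Finset.mul_sum]
      refine Finset.sum_congr rfl fun j _ => ?_
      rw [mul_smul_comm, ← mul_assoc, ← pow_succ', Nat.add_sub_add_right]
    have e2 : y * ∑ j ∈ Finset.range (n + 1), gauss ω n j • (x ^ j * y ^ (n - j)) =
        ∑ j ∈ Finset.range (n + 2), (ω ^ j * gauss ω n j) • (x ^ j * y ^ (n + 1 - j)) := by
      rw [Finset.sum_range_succ _ (n + 1), gauss_of_lt _ _ _ (Nat.lt_succ_self n), Finset.mul_sum]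
      simp only [mul_zero, zero_smul, add_zero]
      refine Finset.sum_congr rfl fun j hj => ?_
      have hj' : j ≤ n := Nat.lt_succ_iff.1 (Finset.mem_range.1 hj)
      rw [mul_smul_comm, ← mul_assoc, mul_pow_skew h, smul_mul_assoc, mul_assoc, ← pow_succ',
        smul_smul, mul_comm (gauss ω n j), Nat.sub_add_comm hj']
    rw [e1, e2, Finset.sum_range_succ' _ (n + 1), ← add_assoc, ← Finset.sum_add_distrib]
    simp only [gauss, gauss_zero, add_smul, pow_zero, one_mul]

lemma add_pow_eq_zero {x y : A} (h : y * x = R.q ^ 2 • (x * y)) (hx : x ^ R.r = 0)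
    (hy : y ^ R.r = 0) : (x + y) ^ R.r = 0 := by
  rw [add_pow_skew h]
  refine Finset.sum_eq_zero fun j hj => ?_
  have hj' : j < R.r + 1 := Finset.mem_range.1 hj
  rcases Nat.eq_zero_or_pos j with rfl | h0
  · simp [hy]
  · rcases Nat.lt_or_ge j R.r with h1 | h1
    · rw [gauss_eq_zero j h0 h1, zero_smul]
    · obtain rfl : j = R.r := by omega
      simp [hx]

lemma mul_pow_eq_zero {x y : A} {ω : ℂ} (h : y * x = ω • (x * y)) {n : ℕ}
    (hxy : x ^ n = 0 ∨ y ^ n = 0) : (x * y) ^ n = 0 := by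
  have key : ∀ n : ℕ, ∃ c : ℂ, (x * y) ^ n = c • (x ^ n * y ^ n) := by
    intro n
    induction n with
    | zero => exact ⟨1, by simp⟩
    | succ n ih =>
      obtain ⟨c, hc⟩ := ih
      refine ⟨c * ω ^ n, ?_⟩
      have h' : ∀ m : ℕ, y ^ m * x = ω ^ m • (x * y ^ m) := by
        intro m
        induction m with
        | zero => simp
        | succ m ihm =>
          rw [pow_succ, mul_assoc, h, mul_smul_comm, ← mul_assoc, ihm, smul_mul_assoc, smul_smul,
            mul_assoc, pow_succ, mul_comm]
      rw [pow_succ, hc, smul_mul_assoc, mul_assoc, ← mul_assoc (y ^ n) x y, h' n, smul_mul_assoc,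
        mul_smul_comm, smul_smul, pow_succ x, pow_succ y]
      simp only [mul_assoc]
  obtain ⟨c, hc⟩ := key n
  rcases hxy with h | h <;> simp [hc, h]

end qbinomial

namespace Satisfies

variable {A : Type*} [Ring A] [Algebra ℂ A] {x : Gen → A}

lemma KE (h : Satisfies R x) : x .K * x .E = R.q ^ 2 • (x .E * x .K) := by
  have := congrArg (· * x .K) h.K_E
  simpa [mul_assoc, h.Kinv_K] using this

lemma KF (h : Satisfies R x) : x .K * x .F = (R.q⁻¹) ^ 2 • (x .F * x .K) := by
  have := congrArg (· * x .K) h.K_F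
  simpa [mul_assoc, h.Kinv_K] using this

lemma EKinv (h : Satisfies R x) : x .E * x .Kinv = R.q ^ 2 • (x .Kinv * x .E) := by
  have := congrArg (x .Kinv * ·) h.K_E
  simpa [← mul_assoc, h.Kinv_K] using this

lemma FKinv (h : Satisfies R x) : x .F * x .Kinv = (R.q⁻¹) ^ 2 • (x .Kinv * x .F) := by
  have := congrArg (x .Kinv * ·) h.K_F
  simpa [← mul_assoc, h.Kinv_K] using this

lemma KinvE (h : Satisfies R x) :
    x .Kinv * x .E = (R.q⁻¹) ^ 2 • (x .E * x .Kinv) := by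
  rw [h.EKinv, smul_smul, ← mul_pow, inv_mul_cancel₀ R.q_ne, one_pow, one_smul]

lemma KinvF (h : Satisfies R x) : x .Kinv * x .F = R.q ^ 2 • (x .F * x .Kinv) := by
  rw [h.FKinv, smul_smul, ← mul_pow, mul_inv_cancel₀ R.q_ne, one_pow, one_smul]

end Satisfies

/-- The coproduct on generators. -/
def comulGen (R : RootData) : Gen → Ubar R ⊗[ℂ] Ubar R
  | .E => 1 ⊗ₜ gen R .E + gen R .E ⊗ₜ gen R .K
  | .F => gen R .Kinv ⊗ₜ gen R .F + gen R .F ⊗ₜ 1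
  | .K => gen R .K ⊗ₜ gen R .K
  | .Kinv => gen R .Kinv ⊗ₜ gen R .Kinv

/-- The counit on generators. -/
def counitGen : Gen → ℂ
  | .E => 0
  | .F => 0
  | .K => 1
  | .Kinv => 1

/-- The antipode on generators. -/
def antipodeGen (R : RootData) : Gen → Ubar R
  | .E => -(gen R .E * gen R .Kinv)
  | .F => -(gen R .K * gen R .F)
  | .K => gen R .Kinv
  | .Kinv => gen R .K

lemma satisfies_comul : Satisfies R (comulGen R) := by
  have h := satisfies_gen (R := R)
  have hq := R.q_ne
  refine ⟨?_, ?_, ?_, ?_, ?_, ?_, ?_⟩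
  · simp [comulGen, h.K_Kinv, Algebra.TensorProduct.one_def]
  · simp [comulGen, h.Kinv_K, Algebra.TensorProduct.one_def]
  · simp [comulGen, mul_add, add_mul, h.K_E, h.K_Kinv, TensorProduct.smul_tmul']
    rw [mul_assoc, h.K_Kinv, mul_one]
  · simp [comulGen, mul_add, add_mul, h.K_F, h.K_Kinv, TensorProduct.smul_tmul']
  · have e : gen R .E * gen R .F = (R.q - R.q⁻¹)⁻¹ • (gen R .K - gen R .Kinv) +
        gen R .F * gen R .E := by rw [← h.E_F]; abel
    simp only [comulGen, mul_add, add_mul, Algebra.TensorProduct.tmul_mul_tmul, one_mul, mul_one,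
      e, h.KF, h.EKinv, TensorProduct.tmul_add, TensorProduct.add_tmul, TensorProduct.tmul_sub,
      TensorProduct.sub_tmul, TensorProduct.tmul_smul, ← TensorProduct.smul_tmul', smul_smul,
      smul_sub]
    rw [← mul_pow, inv_mul_cancel₀ hq, one_pow, one_smul]
    abel
  · refine add_pow_eq_zero ?_ ?_ ?_
    · simp [h.KE]
    · simp [Algebra.TensorProduct.tmul_pow, h.E_pow]
    · simp [Algebra.TensorProduct.tmul_pow, h.E_pow]
  · rw [comulGen, add_comm]
    refine add_pow_eq_zero ?_ ?_ ?_
    · simp [h.KinvF, TensorProduct.smul_tmul']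
    · simp [Algebra.TensorProduct.tmul_pow, h.F_pow]
    · simp [Algebra.TensorProduct.tmul_pow, h.F_pow]

lemma satisfies_counit : Satisfies R counitGen := by
  have hr : R.r ≠ 0 := by have := R.one_lt; omega
  refine ⟨?_, ?_, ?_, ?_, ?_, ?_, ?_⟩ <;> simp [counitGen, hr]

lemma satisfies_antipode : Satisfies R (fun g => MulOpposite.op (antipodeGen R g)) := by
  have h := satisfies_gen (R := R)
  have hq := R.q_ne
  have hc : (R.q⁻¹) ^ 2 * R.q ^ 2 = 1 := by rw [← mul_pow, inv_mul_cancel₀ hq, one_pow]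
  refine ⟨?_, ?_, ?_, ?_, ?_, ?_, ?_⟩ <;>
    simp only [antipodeGen, ← MulOpposite.op_mul, ← MulOpposite.op_sub, ← MulOpposite.op_smul,
      ← MulOpposite.op_pow, ← MulOpposite.op_one, ← MulOpposite.op_zero] <;> congr 1
  · exact h.K_Kinv
  · exact h.Kinv_K
  · rw [neg_mul, mul_neg, ← mul_assoc, ← mul_assoc, h.K_E, smul_neg, smul_mul_assoc]
  · rw [neg_mul, mul_neg, mul_assoc (gen R .K), h.FKinv, smul_neg, mul_smul_comm, mul_smul_comm,
      ← mul_assoc (gen R .K) (gen R .Kinv), h.K_Kinv, one_mul]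
  · have e : gen R .K * gen R .F * (gen R .E * gen R .Kinv) = gen R .F * gen R .E := by
      rw [h.KF, smul_mul_assoc, mul_assoc, ← mul_assoc (gen R .K), h.K_E, mul_smul_comm,
        smul_smul, hc, one_smul]
    rw [neg_mul_neg, neg_mul_neg, e, mul_assoc, ← mul_assoc (gen R .Kinv), h.Kinv_K, one_mul,
      ← neg_sub, h.E_F, ← smul_neg, neg_sub]
  · rw [neg_pow, mul_pow_eq_zero h.KinvE (Or.inl h.E_pow), mul_zero]
  · rw [neg_pow, mul_pow_eq_zero (x := gen R .K) (y := gen R .F) (ω := R.q ^ 2) ?_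
      (Or.inr h.F_pow), mul_zero]
    rw [h.KF, smul_smul, mul_comm, hc, one_smul]

/-- The coproduct. -/
def comul (R : RootData) : Ubar R →ₐ[ℂ] Ubar R ⊗[ℂ] Ubar R := lift _ satisfies_comul

/-- The counit. -/
def counit (R : RootData) : Ubar R →ₐ[ℂ] ℂ := lift _ satisfies_counit

/-- The antipode, as an algebra morphism to the opposite algebra. -/
def antipode (R : RootData) : Ubar R →ₐ[ℂ] (Ubar R)ᵐᵒᵖ := lift _ satisfies_antipode

end Ubar

end UqSl2

/-! ### Representations of `Ū_q(sl₂)` -/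

namespace UqSl2

open Ubar

section Rep

variable {R : RootData}

variable {U V W : Type*} [AddCommGroup U] [Module ℂ U] [AddCommGroup V] [Module ℂ V]
  [AddCommGroup W] [Module ℂ W]

/-- The trivial representation. -/
def trivRep (R : RootData) : Ubar R →ₐ[ℂ] Module.End ℂ ℂ :=
  (Algebra.ofId ℂ (Module.End ℂ ℂ)).comp (counit R)

/-- The tensor product of representations, through the coproduct. -/
def tensorRep (ρ : Ubar R →ₐ[ℂ] Module.End ℂ V) (σ : Ubar R →ₐ[ℂ] Module.End ℂ W) :
    Ubar R →ₐ[ℂ] Module.End ℂ (V ⊗[ℂ] W) :=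
  (Module.endTensorEndAlgHom (R := ℂ) (S := ℂ) (A := ℂ)).comp
    ((Algebra.TensorProduct.map ρ σ).comp (comul R))

/-- The dual representation `(x f)(v) = f (S(x) v)`. -/
def dualRep (ρ : Ubar R →ₐ[ℂ] Module.End ℂ V) :
    Ubar R →ₐ[ℂ] Module.End ℂ (Module.Dual ℂ V) where
  toFun x := (ρ (antipode R x).unop).dualMap
  map_one' := by ext; simp
  map_mul' x y := by ext; simp
  map_zero' := by ext; simp
  map_add' x y := by ext; simp
  commutes' c := by ext; simp [Module.algebraMap_end_apply]

variable (τ : Ubar R →ₐ[ℂ] Module.End ℂ U) (ρ : Ubar R →ₐ[ℂ] Module.End ℂ V)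
  (σ : Ubar R →ₐ[ℂ] Module.End ℂ W)

/-- Commutation with the action of the generators. -/
def Equivariant (f : V →ₗ[ℂ] W) : Prop :=
  ∀ (g : Gen) (v : V), f (ρ (gen R g) v) = σ (gen R g) (f v)

variable {ρ σ} in
lemma Equivariant.comm {f : V →ₗ[ℂ] W} (h : Equivariant ρ σ f) (x : Ubar R) (v : V) :
    f (ρ x v) = σ x (f v) := by
  induction x using Ubar.induction generalizing v with
  | hs c => simp [Module.algebraMap_end_apply]
  | hg g => exact h g v
  | hadd x y hx hy => simp [hx, hy]
  | hmul x y hx hy => simp [hx, hy]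

lemma trivRep_gen (g : Gen) (c : ℂ) : trivRep R (gen R g) c = counitGen g * c := by
  simp [trivRep, counit, Algebra.ofId_apply, Module.algebraMap_end_apply]

lemma tensorRep_E (v : V) (w : W) : tensorRep ρ σ (gen R .E) (v ⊗ₜ w) =
    v ⊗ₜ σ (gen R .E) w + ρ (gen R .E) v ⊗ₜ σ (gen R .K) w := by
  simp [tensorRep, comul, comulGen, Module.endTensorEndAlgHom_apply]

lemma tensorRep_F (v : V) (w : W) : tensorRep ρ σ (gen R .F) (v ⊗ₜ w) =
    ρ (gen R .Kinv) v ⊗ₜ σ (gen R .F) w + ρ (gen R .F) v ⊗ₜ w := by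
  simp [tensorRep, comul, comulGen, Module.endTensorEndAlgHom_apply]

lemma tensorRep_K (v : V) (w : W) : tensorRep ρ σ (gen R .K) (v ⊗ₜ w) =
    ρ (gen R .K) v ⊗ₜ σ (gen R .K) w := by
  simp [tensorRep, comul, comulGen, Module.endTensorEndAlgHom_apply]

lemma tensorRep_Kinv (v : V) (w : W) : tensorRep ρ σ (gen R .Kinv) (v ⊗ₜ w) =
    ρ (gen R .Kinv) v ⊗ₜ σ (gen R .Kinv) w := by
  simp [tensorRep, comul, comulGen, Module.endTensorEndAlgHom_apply]

lemma dualRep_gen (g : Gen) : dualRep ρ (gen R g) = (ρ (antipodeGen R g)).dualMap := by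
  show (ρ (antipode R (gen R g)).unop).dualMap = _
  simp [antipode]

lemma tensorRep_map {V' W' : Type*} [AddCommGroup V'] [Module ℂ V'] [AddCommGroup W']
    [Module ℂ W'] {ρ' : Ubar R →ₐ[ℂ] Module.End ℂ V'} {σ' : Ubar R →ₐ[ℂ] Module.End ℂ W'}
    {f : V →ₗ[ℂ] V'} {g : W →ₗ[ℂ] W'} (hf : ∀ x v, f (ρ x v) = ρ' x (f v))
    (hg : ∀ x v, g (σ x v) = σ' x (g v)) (x : Ubar R) (t : V ⊗[ℂ] W) :
    TensorProduct.map f g (tensorRep ρ σ x t) = tensorRep ρ' σ' x (TensorProduct.map f g t) := by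
  induction t using TensorProduct.induction_on with
  | zero => simp
  | add a b ha hb => simp [ha, hb]
  | tmul v w =>
    simp only [tensorRep, AlgHom.comp_apply, TensorProduct.map_tmul]
    induction comul R x using TensorProduct.induction_on with
    | zero => simp
    | add a b ha hb => simp only [map_add, LinearMap.add_apply, ha, hb]
    | tmul a b => simp [Module.endTensorEndAlgHom_apply, hf, hg]

lemma assoc_equivariant :
    Equivariant (tensorRep (tensorRep τ ρ) σ) (tensorRep τ (tensorRep ρ σ))
      (TensorProduct.assoc ℂ U V W).toLinearMap := by
  intro g t
  induction t using TensorProduct.induction_on with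
  | zero => simp
  | add a b ha hb => simp only [map_add, ha, hb]
  | tmul t w =>
    induction t using TensorProduct.induction_on with
    | zero => simp
    | add a b ha hb => simp only [map_add, TensorProduct.add_tmul, ha, hb]
    | tmul u v =>
      cases g <;> simp [tensorRep_E, tensorRep_F, tensorRep_K, tensorRep_Kinv,
        TensorProduct.tmul_add, TensorProduct.add_tmul, add_assoc]

lemma lid_equivariant :
    Equivariant (tensorRep (trivRep R) ρ) ρ (TensorProduct.lid ℂ V).toLinearMap := by
  intro g t
  induction t using TensorProduct.induction_on with
  | zero => simp
  | add a b ha hb => simp only [map_add, ha, hb]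
  | tmul c v =>
    cases g <;> simp [tensorRep_E, tensorRep_F, tensorRep_K, tensorRep_Kinv, trivRep_gen,
      counitGen]

lemma rid_equivariant :
    Equivariant (tensorRep ρ (trivRep R)) ρ (TensorProduct.rid ℂ V).toLinearMap := by
  intro g t
  induction t using TensorProduct.induction_on with
  | zero => simp
  | add a b ha hb => simp only [map_add, ha, hb]
  | tmul v c =>
    cases g <;> simp [tensorRep_E, tensorRep_F, tensorRep_K, tensorRep_Kinv, trivRep_gen,
      counitGen]

/-! The duality morphisms. -/

/-- The action of `K^{r-1}`. -/
def piv : V →ₗ[ℂ] V := ρ (gen R .K ^ (R.r - 1))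

/-- The action of `K^{1-r}`. -/
def pivInv : V →ₗ[ℂ] V := ρ (gen R .Kinv ^ (R.r - 1))

lemma K_pow_Kinv_pow (n : ℕ) : gen R .K ^ n * gen R .Kinv ^ n = 1 := by
  have h := satisfies_gen (R := R)
  have hc : Commute (gen R .K) (gen R .Kinv) := h.K_Kinv.trans h.Kinv_K.symm
  rw [← hc.mul_pow, h.K_Kinv, one_pow]

lemma Kinv_pow_K_pow (n : ℕ) : gen R .Kinv ^ n * gen R .K ^ n = 1 := by
  have h := satisfies_gen (R := R)
  have hc : Commute (gen R .Kinv) (gen R .K) := h.Kinv_K.trans h.K_Kinv.symm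
  rw [← hc.mul_pow, h.Kinv_K, one_pow]

@[simp] lemma piv_pivInv (v : V) : piv ρ (pivInv ρ v) = v := by
  rw [piv, pivInv, ← Module.End.mul_apply, ← map_mul, K_pow_Kinv_pow, map_one,
    Module.End.one_apply]

@[simp] lemma pivInv_piv (v : V) : pivInv ρ (piv ρ v) = v := by
  rw [piv, pivInv, ← Module.End.mul_apply, ← map_mul, Kinv_pow_K_pow, map_one,
    Module.End.one_apply]

lemma K_pow_skew {x : Ubar R} {ω : ℂ} (h : gen R .K * x = ω • (x * gen R .K))
    (hω : ω ^ R.r = 1) : Commute (gen R .K ^ R.r) x := by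
  have : ∀ n : ℕ, gen R .K ^ n * x = ω ^ n • (x * gen R .K ^ n) := by
    intro n
    induction n with
    | zero => simp
    | succ n ih =>
      rw [pow_succ, mul_assoc, h, mul_smul_comm, ← mul_assoc, ih, smul_mul_assoc, smul_smul,
        mul_assoc, pow_succ, mul_comm]
  rw [Commute, SemiconjBy, this, hω, one_smul]

lemma K_pow_central (g : Gen) : Commute (gen R .K ^ R.r) (gen R g) := by
  have h := satisfies_gen (R := R)
  have hr : (R.q ^ 2) ^ R.r = 1 := (R.q_sq_pow_eq_one_iff _).2 dvd_rfl
  cases g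
  · exact K_pow_skew h.KE hr
  · refine K_pow_skew h.KF ?_
    rw [inv_pow, inv_pow, hr, inv_one]
  · exact (Commute.refl _).pow_left _
  · exact Commute.pow_left (h.K_Kinv.trans h.Kinv_K.symm) _

lemma Kinv_pow_central (g : Gen) : Commute (gen R .Kinv ^ R.r) (gen R g) := by
  have h := K_pow_central (R := R) g
  show gen R .Kinv ^ R.r * gen R g = gen R g * gen R .Kinv ^ R.r
  calc gen R .Kinv ^ R.r * gen R g
      = gen R .Kinv ^ R.r * (gen R g * gen R .K ^ R.r) * gen R .Kinv ^ R.r := by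
        rw [mul_assoc, mul_assoc (gen R g), K_pow_Kinv_pow, mul_one]
    _ = gen R g * gen R .Kinv ^ R.r := by
        rw [← h.eq, ← mul_assoc, Kinv_pow_K_pow, one_mul]

lemma K_mul_pow : gen R .K * gen R .K ^ (R.r - 1) = gen R .K ^ R.r := by
  rw [← pow_succ', Nat.sub_add_cancel R.one_lt.le]

lemma Kinv_mul_pow : gen R .Kinv * gen R .Kinv ^ (R.r - 1) = gen R .Kinv ^ R.r := by
  rw [← pow_succ', Nat.sub_add_cancel R.one_lt.le]

lemma K_pow_mul_Kinv : gen R .K ^ R.r * gen R .Kinv = gen R .K ^ (R.r - 1) := by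
  rw [← Nat.sub_add_cancel R.one_lt.le, pow_succ, mul_assoc, satisfies_gen.K_Kinv, mul_one,
    Nat.add_sub_cancel]

lemma Kinv_pow_mul_K : gen R .Kinv ^ R.r * gen R .K = gen R .Kinv ^ (R.r - 1) := by
  rw [← Nat.sub_add_cancel R.one_lt.le, pow_succ, mul_assoc, satisfies_gen.Kinv_K, mul_one,
    Nat.add_sub_cancel]

/-- `d_V`. -/
def evL : Module.Dual ℂ V ⊗[ℂ] V →ₗ[ℂ] ℂ := contractLeft ℂ V

/-- `d'_V : v ⊗ f ↦ f (K^{1-r} v)`. -/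
def evR : V ⊗[ℂ] Module.Dual ℂ V →ₗ[ℂ] ℂ :=
  contractRight ℂ V ∘ₗ (pivInv ρ).rTensor _

@[simp] lemma evL_tmul (f : Module.Dual ℂ V) (v : V) : evL (f ⊗ₜ[ℂ] v) = f v := rfl

@[simp] lemma evR_tmul (f : Module.Dual ℂ V) (v : V) :
    evR ρ (v ⊗ₜ[ℂ] f) = f (pivInv ρ v) := rfl

lemma evL_equivariant : Equivariant (tensorRep (dualRep ρ) ρ) (trivRep R) evL := by
  intro g t
  have h := satisfies_gen (R := R)
  induction t using TensorProduct.induction_on with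
  | zero => simp
  | add a b ha hb => simp only [map_add, ha, hb]
  | tmul f v =>
    cases g
    · simp only [tensorRep_E, map_add, evL_tmul, dualRep_gen, antipodeGen, trivRep_gen, counitGen,
        zero_mul, LinearMap.dualMap_apply, ← Module.End.mul_apply, ← map_mul, map_neg,
        LinearMap.neg_apply, mul_assoc, h.Kinv_K, mul_one, add_neg_cancel]
    · simp only [tensorRep_F, map_add, evL_tmul, dualRep_gen, antipodeGen, trivRep_gen, counitGen,
        zero_mul, LinearMap.dualMap_apply, ← Module.End.mul_apply, ← map_mul, map_neg,
        LinearMap.neg_apply, add_neg_cancel]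
    · simp only [tensorRep_K, evL_tmul, dualRep_gen, antipodeGen, trivRep_gen, counitGen,
        LinearMap.dualMap_apply, ← Module.End.mul_apply, ← map_mul, h.Kinv_K, map_one,
        Module.End.one_apply, one_mul]
    · simp only [tensorRep_Kinv, evL_tmul, dualRep_gen, antipodeGen, trivRep_gen, counitGen,
        LinearMap.dualMap_apply, ← Module.End.mul_apply, ← map_mul, h.K_Kinv, map_one,
        Module.End.one_apply, one_mul]

lemma evR_equivariant : Equivariant (tensorRep ρ (dualRep ρ)) (trivRep R) (evR ρ) := by
  intro g t
  have h := satisfies_gen (R := R)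
  have e1 : gen R .E * gen R .Kinv * gen R .Kinv ^ (R.r - 1) =
      gen R .Kinv * (gen R .Kinv ^ (R.r - 1) * gen R .E) := by
    rw [mul_assoc, ← mul_assoc (gen R .Kinv), Kinv_mul_pow, (Kinv_pow_central .E).eq]
  have e2 : gen R .K * gen R .F * (gen R .Kinv ^ (R.r - 1) * gen R .Kinv) =
      gen R .Kinv ^ (R.r - 1) * gen R .F := by
    rw [← pow_succ, Nat.sub_add_cancel R.one_lt.le, mul_assoc,
      ← (Kinv_pow_central .F).eq, ← mul_assoc, ← (Kinv_pow_central .K).eq, Kinv_pow_mul_K]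
  have e3 : gen R .Kinv * (gen R .Kinv ^ (R.r - 1) * gen R .K) = gen R .Kinv ^ (R.r - 1) := by
    rw [← mul_assoc, Kinv_mul_pow, Kinv_pow_mul_K]
  have e4 : gen R .K * (gen R .Kinv ^ (R.r - 1) * gen R .Kinv) = gen R .Kinv ^ (R.r - 1) := by
    rw [← pow_succ, Nat.sub_add_cancel R.one_lt.le, ← (Kinv_pow_central .K).eq,
      Kinv_pow_mul_K]
  induction t using TensorProduct.induction_on with
  | zero => simp
  | add a b ha hb => simp only [map_add, ha, hb]
  | tmul v f =>
    cases g
    · simp only [tensorRep_E, map_add, evR_tmul, dualRep_gen, antipodeGen, trivRep_gen, counitGen,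
        zero_mul, LinearMap.dualMap_apply, pivInv, ← Module.End.mul_apply, ← map_mul, map_neg,
        LinearMap.neg_apply, e1, neg_add_cancel]
    · simp only [tensorRep_F, map_add, evR_tmul, dualRep_gen, antipodeGen, trivRep_gen, counitGen,
        zero_mul, LinearMap.dualMap_apply, pivInv, ← Module.End.mul_apply, ← map_mul, map_neg,
        LinearMap.neg_apply, e2, neg_add_cancel]
    · simp only [tensorRep_K, evR_tmul, dualRep_gen, antipodeGen, trivRep_gen, counitGen,
        LinearMap.dualMap_apply, pivInv, ← Module.End.mul_apply, ← map_mul, e3, one_mul]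
    · simp only [tensorRep_Kinv, evR_tmul, dualRep_gen, antipodeGen, trivRep_gen, counitGen,
        LinearMap.dualMap_apply, pivInv, ← Module.End.mul_apply, ← map_mul, e4, one_mul]

variable [Module.Finite ℂ V] [Module.Finite ℂ W]

/-- `b_V`. -/
def coevL : ℂ →ₗ[ℂ] V ⊗[ℂ] Module.Dual ℂ V := coevaluation ℂ V

/-- `b'_V : 1 ↦ ∑ v_j* ⊗ K^{r-1} v_j`. -/
def coevR : ℂ →ₗ[ℂ] Module.Dual ℂ V ⊗[ℂ] V :=
  (piv ρ).lTensor _ ∘ₗ (TensorProduct.comm ℂ V (Module.Dual ℂ V)).toLinearMap ∘ₗ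
    coevaluation ℂ V

lemma coevL_one : (coevL 1 : V ⊗[ℂ] Module.Dual ℂ V) =
    ∑ i, Module.Basis.ofVectorSpace ℂ V i ⊗ₜ (Module.Basis.ofVectorSpace ℂ V).coord i :=
  coevaluation_apply_one ℂ V

lemma coevR_one : coevR ρ 1 = ∑ i, (Module.Basis.ofVectorSpace ℂ V).coord i ⊗ₜ
    piv ρ (Module.Basis.ofVectorSpace ℂ V i) := by
  simp [coevR, coevaluation_apply_one]

/-- The tensor in `V* ⊗ V` of an endomorphism. -/
def tensorOf (A : Module.End ℂ V) : Module.Dual ℂ V ⊗[ℂ] V :=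
  A.lTensor _ ((TensorProduct.comm ℂ V (Module.Dual ℂ V)) (coevaluation ℂ V 1))

lemma dualTensorHom_tensorOf (A : Module.End ℂ V) : dualTensorHom ℂ V V (tensorOf A) = A := by
  ext v
  have : ∑ i, (Module.Basis.ofVectorSpace ℂ V).repr v i • Module.Basis.ofVectorSpace ℂ V i = v :=
    (Module.Basis.ofVectorSpace ℂ V).sum_repr v
  conv_rhs => rw [← this]
  simp [tensorOf, coevaluation_apply_one, LinearMap.sum_apply, dualTensorHom_apply]

lemma dualTensorHom_inj {s t : Module.Dual ℂ V ⊗[ℂ] V}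
    (h : dualTensorHom ℂ V V s = dualTensorHom ℂ V V t) : s = t := by
  apply (dualTensorHomEquiv ℂ V V).injective
  simpa using h

lemma map_tensorOf (A B D : Module.End ℂ V) :
    TensorProduct.map B.dualMap D (tensorOf A) = tensorOf (D * A * B) := by
  have key : ∀ t : Module.Dual ℂ V ⊗[ℂ] V,
      dualTensorHom ℂ V V (TensorProduct.map B.dualMap D t) = D * dualTensorHom ℂ V V t * B := by
    intro t
    induction t using TensorProduct.induction_on with
    | zero => simp
    | add a b ha hb => simp only [map_add, ha, hb, mul_add, add_mul]
    | tmul f v => ext w; simp [dualTensorHom_apply]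
  apply dualTensorHom_inj
  rw [key, dualTensorHom_tensorOf, dualTensorHom_tensorOf]

lemma tensorOf_coev :
    coevR ρ 1 = tensorOf (piv ρ) ∧
      (coevL 1 : V ⊗[ℂ] Module.Dual ℂ V) =
        TensorProduct.comm ℂ (Module.Dual ℂ V) V (tensorOf (1 : Module.End ℂ V)) := by
  constructor
  · rfl
  · simp [tensorOf, coevL, coevaluation_apply_one]

lemma coevR_equivariant :
    Equivariant (trivRep R) (tensorRep (dualRep ρ) ρ) (coevR ρ) := by
  intro g c
  have h := satisfies_gen (R := R)
  have hE : ∀ t : Module.Dual ℂ V ⊗[ℂ] V, tensorRep (dualRep ρ) ρ (gen R .E) t =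
      TensorProduct.map (LinearMap.dualMap (1 : Module.End ℂ V)) (ρ (gen R .E)) t +
      TensorProduct.map (ρ (antipodeGen R .E)).dualMap (ρ (gen R .K)) t := by
    intro t
    induction t using TensorProduct.induction_on with
    | zero => simp
    | add a b ha hb => simp only [map_add, ha, hb]; abel
    | tmul f v => simp only [tensorRep_E, dualRep_gen, TensorProduct.map_tmul]; rfl
  have hF : ∀ t : Module.Dual ℂ V ⊗[ℂ] V, tensorRep (dualRep ρ) ρ (gen R .F) t =
      TensorProduct.map (ρ (antipodeGen R .Kinv)).dualMap (ρ (gen R .F)) t +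
      TensorProduct.map (ρ (antipodeGen R .F)).dualMap (1 : Module.End ℂ V) t := by
    intro t
    induction t using TensorProduct.induction_on with
    | zero => simp
    | add a b ha hb => simp only [map_add, ha, hb]; abel
    | tmul f v => simp only [tensorRep_F, dualRep_gen, TensorProduct.map_tmul]; rfl
  have hK : ∀ t : Module.Dual ℂ V ⊗[ℂ] V, tensorRep (dualRep ρ) ρ (gen R .K) t =
      TensorProduct.map (ρ (antipodeGen R .K)).dualMap (ρ (gen R .K)) t := by
    intro t
    induction t using TensorProduct.induction_on with
    | zero => simp
    | add a b ha hb => simp only [map_add, ha, hb]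
    | tmul f v => simp only [tensorRep_K, dualRep_gen, TensorProduct.map_tmul]
  have hKi : ∀ t : Module.Dual ℂ V ⊗[ℂ] V, tensorRep (dualRep ρ) ρ (gen R .Kinv) t =
      TensorProduct.map (ρ (antipodeGen R .Kinv)).dualMap (ρ (gen R .Kinv)) t := by
    intro t
    induction t using TensorProduct.induction_on with
    | zero => simp
    | add a b ha hb => simp only [map_add, ha, hb]
    | tmul f v => simp only [tensorRep_Kinv, dualRep_gen, TensorProduct.map_tmul]
  have hlin : ∀ x : ℂ, coevR ρ x = x • tensorOf (piv ρ) := by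
    intro x
    rw [← (tensorOf_coev ρ).1, ← map_smul, smul_eq_mul, mul_one]
  rw [trivRep_gen, hlin, hlin, map_smul, mul_comm, mul_smul]
  congr 1
  cases g <;> simp only [hE, hF, hK, hKi, map_tensorOf, counitGen, zero_smul, one_smul, piv]
  · apply dualTensorHom_inj
    rw [map_zero, map_add, dualTensorHom_tensorOf, dualTensorHom_tensorOf, mul_one, ← map_mul,
      ← map_mul, ← map_mul, ← map_add]
    rw [antipodeGen, K_mul_pow, mul_neg, ← mul_assoc, (K_pow_central .E).eq, mul_assoc,
      K_pow_mul_Kinv, add_neg_cancel, map_zero]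
  · apply dualTensorHom_inj
    rw [map_zero, map_add, dualTensorHom_tensorOf, dualTensorHom_tensorOf, one_mul, ← map_mul,
      ← map_mul, ← map_mul, ← map_add]
    rw [antipodeGen, antipodeGen, mul_neg, mul_assoc, ← pow_succ, ← mul_assoc,
      ← pow_succ, Nat.sub_add_cancel R.one_lt.le, (K_pow_central .F).eq, add_neg_cancel, map_zero]
  · rw [← map_mul, ← map_mul, antipodeGen, K_mul_pow, K_pow_mul_Kinv]
  · rw [← map_mul, ← map_mul, antipodeGen, mul_assoc, ← pow_succ, Nat.sub_add_cancel R.one_lt.le,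
      ← (K_pow_central .Kinv).eq, K_pow_mul_Kinv]

lemma coevL_equivariant :
    Equivariant (trivRep R) (tensorRep ρ (dualRep ρ)) (coevL : ℂ →ₗ[ℂ] _) := by
  intro g c
  have h := satisfies_gen (R := R)
  set cm := TensorProduct.comm ℂ (Module.Dual ℂ V) V with hcm
  have hE : ∀ t : Module.Dual ℂ V ⊗[ℂ] V, tensorRep ρ (dualRep ρ) (gen R .E) (cm t) =
      cm (TensorProduct.map (ρ (antipodeGen R .E)).dualMap (1 : Module.End ℂ V) t) +
      cm (TensorProduct.map (ρ (antipodeGen R .K)).dualMap (ρ (gen R .E)) t) := by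
    intro t
    induction t using TensorProduct.induction_on with
    | zero => simp
    | add a b ha hb => simp only [map_add, ha, hb]; abel
    | tmul f v =>
      simp only [hcm, TensorProduct.comm_tmul, tensorRep_E, dualRep_gen, TensorProduct.map_tmul]
      rfl
  have hF : ∀ t : Module.Dual ℂ V ⊗[ℂ] V, tensorRep ρ (dualRep ρ) (gen R .F) (cm t) =
      cm (TensorProduct.map (ρ (antipodeGen R .F)).dualMap (ρ (gen R .Kinv)) t) +
      cm (TensorProduct.map (LinearMap.dualMap (1 : Module.End ℂ V)) (ρ (gen R .F)) t) := by
    intro t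
    induction t using TensorProduct.induction_on with
    | zero => simp
    | add a b ha hb => simp only [map_add, ha, hb]; abel
    | tmul f v =>
      simp only [hcm, TensorProduct.comm_tmul, tensorRep_F, dualRep_gen, TensorProduct.map_tmul]
      rfl
  have hK : ∀ t : Module.Dual ℂ V ⊗[ℂ] V, tensorRep ρ (dualRep ρ) (gen R .K) (cm t) =
      cm (TensorProduct.map (ρ (antipodeGen R .K)).dualMap (ρ (gen R .K)) t) := by
    intro t
    induction t using TensorProduct.induction_on with
    | zero => simp
    | add a b ha hb => simp only [map_add, ha, hb]
    | tmul f v =>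
      simp only [hcm, TensorProduct.comm_tmul, tensorRep_K, dualRep_gen, TensorProduct.map_tmul]
  have hKi : ∀ t : Module.Dual ℂ V ⊗[ℂ] V, tensorRep ρ (dualRep ρ) (gen R .Kinv) (cm t) =
      cm (TensorProduct.map (ρ (antipodeGen R .Kinv)).dualMap (ρ (gen R .Kinv)) t) := by
    intro t
    induction t using TensorProduct.induction_on with
    | zero => simp
    | add a b ha hb => simp only [map_add, ha, hb]
    | tmul f v =>
      simp only [hcm, TensorProduct.comm_tmul, tensorRep_Kinv, dualRep_gen,
        TensorProduct.map_tmul]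
  have hlin : ∀ x : ℂ, (coevL x : V ⊗[ℂ] Module.Dual ℂ V) = x • cm (tensorOf 1) := by
    intro x
    rw [← (tensorOf_coev ρ).2, ← map_smul, smul_eq_mul, mul_one]
  rw [trivRep_gen, hlin, hlin, map_smul, mul_comm, mul_smul]
  congr 1
  cases g <;> simp only [hE, hF, hK, hKi, map_tensorOf, counitGen, zero_smul, one_smul]
  · rw [← map_add, ← map_zero cm]
    congr 1
    apply dualTensorHom_inj
    rw [map_zero, map_add, dualTensorHom_tensorOf, dualTensorHom_tensorOf, one_mul, one_mul,
      mul_one, ← map_mul, ← map_add, antipodeGen, antipodeGen, neg_add_cancel, map_zero]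
  · rw [← map_add, ← map_zero cm]
    congr 1
    apply dualTensorHom_inj
    rw [map_zero, map_add, dualTensorHom_tensorOf, dualTensorHom_tensorOf, mul_one, mul_one,
      mul_one, ← map_mul, ← map_add, antipodeGen, mul_neg, ← mul_assoc, h.Kinv_K, one_mul,
      neg_add_cancel, map_zero]
  · rw [mul_one, ← map_mul, antipodeGen, h.K_Kinv, map_one]
  · rw [mul_one, ← map_mul, antipodeGen, h.Kinv_K, map_one]

end Rep

end UqSl2

/-! ### The category of weight modules -/

namespace UqSl2

open Ubar

/-- Weight modules over `Ū_q(sl₂)`: finite-dimensional modules on which `K` acts diagonally. -/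
structure WeightModule (R : RootData) : Type 1 where
  carrier : Type
  [addCommGroup : AddCommGroup carrier]
  [module : Module ℂ carrier]
  [finite : Module.Finite ℂ carrier]
  ρ : Ubar R →ₐ[ℂ] Module.End ℂ carrier
  diagonal : ∃ (ι : Type) (e : Module.Basis ι ℂ carrier),
    ∀ j, ∃ c : ℂ, ρ (gen R .K) (e j) = c • e j

namespace WeightModule

attribute [instance] addCommGroup module finite

variable {R : RootData}

/-- Morphisms of weight modules: linear maps commuting with the action. -/
@[ext]
structure Hom (V W : WeightModule R) : Type where
  toLin : V.carrier →ₗ[ℂ] W.carrier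
  comm : ∀ (x : Ubar R) (v : V.carrier), toLin (V.ρ x v) = W.ρ x (toLin v)

instance : Category (WeightModule R) where
  Hom := Hom
  id V := ⟨LinearMap.id, fun _ _ => rfl⟩
  comp f g := ⟨g.toLin ∘ₗ f.toLin, fun x v => by simp [f.comm, g.comm]⟩

@[ext] lemma hom_ext {V W : WeightModule R} {f g : V ⟶ W} (h : f.toLin = g.toLin) : f = g :=
  Hom.ext h

@[simp] lemma id_toLin (V : WeightModule R) : Hom.toLin (𝟙 V) = LinearMap.id := rfl

@[simp] lemma comp_toLin {U V W : WeightModule R} (f : U ⟶ V) (g : V ⟶ W) :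
    Hom.toLin (f ≫ g) = g.toLin ∘ₗ f.toLin := rfl

section Preadditive

variable {V W : WeightModule R}

instance : Zero (V ⟶ W) := ⟨⟨0, fun _ _ => by simp⟩⟩
instance : Add (V ⟶ W) := ⟨fun f g => ⟨f.toLin + g.toLin, fun _ _ => by simp [f.comm, g.comm]⟩⟩
instance : Neg (V ⟶ W) := ⟨fun f => ⟨-f.toLin, fun _ _ => by simp [f.comm]⟩⟩
instance : Sub (V ⟶ W) := ⟨fun f g => ⟨f.toLin - g.toLin, fun _ _ => by simp [f.comm, g.comm]⟩⟩
instance : SMul ℕ (V ⟶ W) := ⟨fun n f => ⟨n • f.toLin, fun _ _ => by simp [f.comm]⟩⟩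
instance : SMul ℤ (V ⟶ W) := ⟨fun n f => ⟨n • f.toLin, fun _ _ => by simp [f.comm]⟩⟩

@[simp] lemma zero_toLin : Hom.toLin (0 : V ⟶ W) = 0 := rfl
@[simp] lemma add_toLin (f g : V ⟶ W) : Hom.toLin (f + g) = f.toLin + g.toLin := rfl

instance : AddCommGroup (V ⟶ W) :=
  Function.Injective.addCommGroup Hom.toLin (fun _ _ => Hom.ext) rfl (fun _ _ => rfl)
    (fun _ => rfl) (fun _ _ => rfl) (fun _ _ => rfl) (fun _ _ => rfl)

instance : Preadditive (WeightModule R) where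
  add_comp _ _ _ f f' g := by ext v; simp
  comp_add _ _ _ f g g' := by ext v; simp

end Preadditive

/-- An isomorphism from an equivariant linear equivalence. -/
def mkIso {V W : WeightModule R} (f : V.carrier ≃ₗ[ℂ] W.carrier)
    (h : Equivariant V.ρ W.ρ f.toLinearMap) : V ≅ W where
  hom := ⟨f.toLinearMap, h.comm⟩
  inv := ⟨f.symm.toLinearMap, fun x w => f.injective <| by
    have := h.comm x (f.symm w)
    simp only [LinearEquiv.coe_coe, LinearEquiv.apply_symm_apply] at this ⊢
    exact this.symm⟩
  hom_inv_id := Hom.ext (LinearMap.ext fun v => f.symm_apply_apply v)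
  inv_hom_id := Hom.ext (LinearMap.ext fun v => f.apply_symm_apply v)

/-- The tensor product of weight modules. -/
def tensor (V W : WeightModule R) : WeightModule R where
  carrier := V.carrier ⊗[ℂ] W.carrier
  ρ := tensorRep V.ρ W.ρ
  diagonal := by
    obtain ⟨ι, e, he⟩ := V.diagonal
    obtain ⟨κ, e', he'⟩ := W.diagonal
    refine ⟨ι × κ, e.tensorProduct e', fun ⟨i, j⟩ => ?_⟩
    obtain ⟨c, hc⟩ := he i
    obtain ⟨c', hc'⟩ := he' j
    refine ⟨c * c', ?_⟩
    rw [Module.Basis.tensorProduct_apply, tensorRep_K, hc, hc', TensorProduct.smul_tmul_smul]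

/-- The trivial module. -/
def triv (R : RootData) : WeightModule R where
  carrier := ℂ
  ρ := trivRep R
  diagonal := ⟨Unit, Module.Basis.singleton Unit ℂ, fun _ =>
    ⟨1, by simp [trivRep_gen, counitGen]⟩⟩

/-- The dual `V* = Hom(V, ℂ)`. -/
def dual (V : WeightModule R) : WeightModule R where
  carrier := Module.Dual ℂ V.carrier
  ρ := dualRep V.ρ
  diagonal := by
    obtain ⟨ι, e, he⟩ := V.diagonal
    choose c hc using he
    have : Finite ι := Module.Finite.finite_basis e
    have := Fintype.ofFinite ι
    have := Classical.decEq ι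
    have hs := satisfies_gen (R := R)
    refine ⟨ι, e.dualBasis, fun j => ⟨(c j)⁻¹, ?_⟩⟩
    have hKi : ∀ i, V.ρ (gen R .Kinv) (e i) = (c i)⁻¹ • e i := by
      intro i
      have h1 : V.ρ (gen R .Kinv) (V.ρ (gen R .K) (e i)) = e i := by
        rw [← Module.End.mul_apply, ← map_mul, hs.Kinv_K, map_one, Module.End.one_apply]
      rw [hc, map_smul] at h1
      have h0 : c i ≠ 0 := by
        intro h
        rw [h, zero_smul] at h1
        exact e.ne_zero i h1.symm
      rw [eq_inv_smul_iff₀ h0, h1]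
    refine e.ext fun i => ?_
    rw [dualRep_gen, antipodeGen]
    by_cases hij : i = j
    · subst hij
      simp [hKi]
    · simp [hKi, hij]

/-- Tensor product of morphisms. -/
def tensorMap {V V' W W' : WeightModule R} (f : V ⟶ V') (g : W ⟶ W') :
    tensor V W ⟶ tensor V' W' :=
  ⟨TensorProduct.map f.toLin g.toLin, tensorRep_map _ _ f.comm g.comm⟩

instance : MonoidalCategoryStruct (WeightModule R) where
  tensorObj := tensor
  tensorHom := tensorMap
  whiskerLeft V _ _ f := tensorMap (𝟙 V) f
  whiskerRight f W := tensorMap f (𝟙 W)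
  tensorUnit := triv R
  associator U V W := mkIso (TensorProduct.assoc ℂ U.carrier V.carrier W.carrier)
    (assoc_equivariant U.ρ V.ρ W.ρ)
  leftUnitor V := mkIso (TensorProduct.lid ℂ V.carrier) (lid_equivariant V.ρ)
  rightUnitor V := mkIso (TensorProduct.rid ℂ V.carrier) (rid_equivariant V.ρ)

instance : MonoidalCategory (WeightModule R) where
  tensorHom_def _ _ := Hom.ext (TensorProduct.ext' fun _ _ => rfl)
  id_tensorHom_id _ _ := Hom.ext (TensorProduct.ext' fun _ _ => rfl)
  tensorHom_comp_tensorHom _ _ _ _ := Hom.ext (TensorProduct.ext' fun _ _ => rfl)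
  whiskerLeft_id _ _ := Hom.ext (TensorProduct.ext' fun _ _ => rfl)
  id_whiskerRight _ _ := Hom.ext (TensorProduct.ext' fun _ _ => rfl)
  associator_naturality _ _ _ := Hom.ext (TensorProduct.ext_threefold fun _ _ _ => rfl)
  leftUnitor_naturality f := Hom.ext (TensorProduct.ext' fun c v =>
    (f.toLin.map_smul c v).symm)
  rightUnitor_naturality f := Hom.ext (TensorProduct.ext' fun v c =>
    (f.toLin.map_smul c v).symm)
  pentagon _ _ _ _ := Hom.ext (TensorProduct.ext_fourfold fun _ _ _ _ => rfl)
  triangle V W := Hom.ext (TensorProduct.ext_threefold fun v c w =>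
    (TensorProduct.smul_tmul (R := ℂ) (R' := ℂ) (show ℂ from c) (show V.carrier from v)
      (show W.carrier from w)).symm)

instance : MonoidalPreadditive (WeightModule R) where
  whiskerLeft_zero {U _ W} := Hom.ext (TensorProduct.ext' fun u _ =>
    TensorProduct.tmul_zero W.carrier (show U.carrier from u))
  zero_whiskerRight {U _ W} := Hom.ext (TensorProduct.ext' fun _ u =>
    TensorProduct.zero_tmul W.carrier (show U.carrier from u))
  whiskerLeft_add {U _ _} f g := Hom.ext (TensorProduct.ext' fun u v =>
    TensorProduct.tmul_add (show U.carrier from u) (f.toLin v) (g.toLin v))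
  add_whiskerRight {U _ _} f g := Hom.ext (TensorProduct.ext' fun v u =>
    TensorProduct.add_tmul (f.toLin v) (g.toLin v) (show U.carrier from u))

lemma piv_comm {V W : WeightModule R} (f : V ⟶ W) (v : V.carrier) :
    f.toLin (piv V.ρ v) = piv W.ρ (f.toLin v) := f.comm _ v

lemma pivInv_comm {V W : WeightModule R} (f : V ⟶ W) (v : V.carrier) :
    f.toLin (pivInv V.ρ v) = pivInv W.ρ (f.toLin v) := f.comm _ v

lemma pivInv_tensor (V W : WeightModule R) (v : V.carrier) (w : W.carrier) :
    pivInv (tensorRep V.ρ W.ρ) (v ⊗ₜ w) = pivInv V.ρ v ⊗ₜ pivInv W.ρ w := by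
  have : ∀ n : ℕ, tensorRep V.ρ W.ρ (gen R .Kinv ^ n) (v ⊗ₜ w) =
      V.ρ (gen R .Kinv ^ n) v ⊗ₜ W.ρ (gen R .Kinv ^ n) w := by
    intro n
    induction n with
    | zero => simp
    | succ n ih =>
      rw [pow_succ', map_mul, Module.End.mul_apply, ih, tensorRep_Kinv, map_mul, map_mul,
        Module.End.mul_apply, Module.End.mul_apply]
  exact this _

section duality

variable (V W : WeightModule R)

/-- `b_V : 1 ↦ ∑ v_j ⊗ v_j*`. -/
def bMap : triv R ⟶ tensor V (dual V) := ⟨coevL, (coevL_equivariant V.ρ).comm⟩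

/-- `d_V : f ⊗ v ↦ f v`. -/
def dMap : tensor (dual V) V ⟶ triv R := ⟨evL, (evL_equivariant V.ρ).comm⟩

/-- `b'_V : 1 ↦ ∑ v_j* ⊗ K^{r-1} v_j`. -/
def bMap' : triv R ⟶ tensor (dual V) V := ⟨coevR V.ρ, (coevR_equivariant V.ρ).comm⟩

/-- `d'_V : v ⊗ f ↦ f (K^{1-r} v)`. -/
def dMap' : tensor V (dual V) ⟶ triv R := ⟨evR V.ρ, (evR_equivariant V.ρ).comm⟩

end duality

end WeightModule

/-! Linear algebra for the compatibility of the dualities. -/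

section Linear

variable {V W X : Type*} [AddCommGroup V] [Module ℂ V] [Module.Finite ℂ V]
  [AddCommGroup W] [Module ℂ W] [AddCommGroup X] [Module ℂ X]

lemma sum_coord (φ : V →ₗ[ℂ] ℂ) :
    ∑ i, φ (Module.Basis.ofVectorSpace ℂ V i) • (Module.Basis.ofVectorSpace ℂ V).coord i = φ :=
  (Module.Basis.ofVectorSpace ℂ V).sum_dual_apply_smul_coord φ

lemma sum_basis (v : V) :
    ∑ i, (Module.Basis.ofVectorSpace ℂ V).coord i v • Module.Basis.ofVectorSpace ℂ V i = v :=
  (Module.Basis.ofVectorSpace ℂ V).sum_repr v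

/-- Contracting the first factor of `∑ v_j ⊗ v_j*` with a functional gives the functional. -/
lemma contract_coevL (φ : V →ₗ[ℂ] ℂ) (F : X ⊗[ℂ] V →ₗ[ℂ] ℂ) (x : X)
    (h : ∀ v, F (x ⊗ₜ v) = φ v) :
    TensorProduct.lid ℂ _ (TensorProduct.map F LinearMap.id
      ((TensorProduct.assoc ℂ X V (Module.Dual ℂ V)).symm (x ⊗ₜ coevL 1))) = φ := by
  rw [coevL_one, TensorProduct.tmul_sum, map_sum, map_sum, map_sum]
  simp only [TensorProduct.assoc_symm_tmul, TensorProduct.map_tmul, h, TensorProduct.lid_tmul,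
    LinearMap.id_apply]
  exact sum_coord φ

lemma contract_coevR {R : RootData} (ρ : Ubar R →ₐ[ℂ] Module.End ℂ V) (φ : V →ₗ[ℂ] ℂ)
    (F : V ⊗[ℂ] X →ₗ[ℂ] ℂ) (x : X) (h : ∀ v, F (piv ρ v ⊗ₜ x) = φ v) :
    TensorProduct.rid ℂ _ (TensorProduct.map LinearMap.id F
      (TensorProduct.assoc ℂ (Module.Dual ℂ V) V X (coevR ρ 1 ⊗ₜ x))) = φ := by
  rw [coevR_one, TensorProduct.sum_tmul, map_sum, map_sum, map_sum]
  simp only [TensorProduct.assoc_tmul, TensorProduct.map_tmul, h, TensorProduct.rid_tmul,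
    LinearMap.id_apply]
  exact sum_coord φ

lemma contract_coevL' (v : V) :
    TensorProduct.rid ℂ _ (TensorProduct.map LinearMap.id evL
      (TensorProduct.assoc ℂ V (Module.Dual ℂ V) V (coevL 1 ⊗ₜ v))) = v := by
  rw [coevL_one, TensorProduct.sum_tmul, map_sum, map_sum, map_sum]
  simp only [TensorProduct.assoc_tmul, TensorProduct.map_tmul, TensorProduct.rid_tmul,
    LinearMap.id_apply, evL_tmul]
  exact sum_basis v

lemma contract_coevR' {R : RootData} (ρ : Ubar R →ₐ[ℂ] Module.End ℂ V) (v : V) :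
    TensorProduct.lid ℂ _ (TensorProduct.map (evR ρ) LinearMap.id
      ((TensorProduct.assoc ℂ V (Module.Dual ℂ V) V).symm (v ⊗ₜ coevR ρ 1))) = v := by
  rw [coevR_one, TensorProduct.tmul_sum, map_sum, map_sum, map_sum]
  simp only [TensorProduct.assoc_symm_tmul, TensorProduct.map_tmul, TensorProduct.lid_tmul,
    LinearMap.id_apply, evR_tmul]
  rw [← piv_pivInv ρ v]
  conv_rhs => rw [← sum_basis (pivInv ρ v), map_sum]
  simp

lemma move_left {Y Z : Type*} [AddCommGroup Y] [Module ℂ Y] [AddCommGroup Z] [Module ℂ Z]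
    (f : W →ₗ[ℂ] Y) (F : X ⊗[ℂ] Y →ₗ[ℂ] ℂ) (x : X) (t : W ⊗[ℂ] Z) :
    TensorProduct.map F LinearMap.id ((TensorProduct.assoc ℂ X Y Z).symm
      (x ⊗ₜ TensorProduct.map f LinearMap.id t)) =
    TensorProduct.map (F ∘ₗ TensorProduct.map LinearMap.id f) LinearMap.id
      ((TensorProduct.assoc ℂ X W Z).symm (x ⊗ₜ t)) := by
  induction t using TensorProduct.induction_on with
  | zero => simp
  | add a b ha hb => simp only [map_add, TensorProduct.tmul_add, ha, hb]
  | tmul w z => simp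

lemma move_right {Y Z : Type*} [AddCommGroup Y] [Module ℂ Y] [AddCommGroup Z] [Module ℂ Z]
    (f : W →ₗ[ℂ] Y) (F : Y ⊗[ℂ] X →ₗ[ℂ] ℂ) (x : X) (t : Z ⊗[ℂ] W) :
    TensorProduct.map LinearMap.id F (TensorProduct.assoc ℂ Z Y X
      (TensorProduct.map LinearMap.id f t ⊗ₜ x)) =
    TensorProduct.map LinearMap.id (F ∘ₗ TensorProduct.map f LinearMap.id)
      (TensorProduct.assoc ℂ Z W X (t ⊗ₜ x)) := by
  induction t using TensorProduct.induction_on with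
  | zero => simp
  | add a b ha hb => simp only [map_add, TensorProduct.add_tmul, ha, hb]
  | tmul w z => simp

end Linear

section Linear'

variable {V W X : Type*} [AddCommGroup V] [Module ℂ V] [AddCommGroup W] [Module ℂ W]
  [AddCommGroup X] [Module ℂ X]

lemma apply_left (F : X ⊗[ℂ] (V ⊗[ℂ] W) →ₗ[ℂ] ℂ) (x : X) (φ : V ⊗[ℂ] W →ₗ[ℂ] ℂ)
    (h : ∀ v w, F (x ⊗ₜ (v ⊗ₜ w)) = φ (v ⊗ₜ w)) (t : V ⊗[ℂ] W) : F (x ⊗ₜ t) = φ t := by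
  induction t using TensorProduct.induction_on with
  | zero => simp
  | add a b ha hb => simp only [map_add, TensorProduct.tmul_add, ha, hb]
  | tmul v w => exact h v w

lemma apply_right (F : (V ⊗[ℂ] W) ⊗[ℂ] X →ₗ[ℂ] ℂ) (x : X) (φ : V ⊗[ℂ] W →ₗ[ℂ] ℂ)
    (h : ∀ v w, F ((v ⊗ₜ w) ⊗ₜ x) = φ (v ⊗ₜ w)) (t : V ⊗[ℂ] W) : F (t ⊗ₜ x) = φ t := by
  induction t using TensorProduct.induction_on with
  | zero => simp
  | add a b ha hb => simp only [map_add, TensorProduct.add_tmul, ha, hb]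
  | tmul v w => exact h v w

end Linear'

namespace WeightModule

variable {R : RootData}

instance : Pivotal (WeightModule R) where
  dual := dual
  b := bMap
  d := dMap
  b' := bMap'
  d' := dMap'
  zigzag V := Hom.ext (LinearMap.ext fun v => contract_coevL' (V := V.carrier) v)
  zigzag_dual V := Hom.ext (LinearMap.ext fun φ =>
    contract_coevL (V := V.carrier) φ evL φ fun _ => rfl)
  zigzag' V := Hom.ext (LinearMap.ext fun v => contract_coevR' V.ρ v)
  zigzag_dual' V := Hom.ext (LinearMap.ext fun φ =>
    contract_coevR V.ρ φ (evR V.ρ) φ fun v =>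
      congrArg (show V.carrier →ₗ[ℂ] ℂ from φ) (pivInv_piv V.ρ v))
  transpose_eq {V W} f := Hom.ext (LinearMap.ext fun φ => by
    refine Eq.trans (b := ((show W.carrier →ₗ[ℂ] ℂ from φ) ∘ₗ f.toLin)) ?_ (Eq.symm ?_)
    · exact (congrArg (TensorProduct.lid ℂ _) (move_left f.toLin evL
        (show Module.Dual ℂ W.carrier from φ) (coevL 1))).trans
        (contract_coevL _ _ _ fun v => rfl)
    · exact (congrArg (TensorProduct.rid ℂ _) (move_right f.toLin (evR W.ρ)
        (show Module.Dual ℂ W.carrier from φ) (coevR V.ρ 1))).trans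
        (contract_coevR V.ρ _ _ _ fun v => congrArg (show W.carrier →ₗ[ℂ] ℂ from φ)
          ((pivInv_comm f _).symm.trans (congrArg f.toLin (pivInv_piv V.ρ v)))))
  tensor_dual_eq V W := Hom.ext (TensorProduct.ext' fun g f => by
    refine Eq.trans (b := TensorProduct.lid ℂ ℂ ∘ₗ TensorProduct.map
      (show V.carrier →ₗ[ℂ] ℂ from f) (show W.carrier →ₗ[ℂ] ℂ from g)) ?_ (Eq.symm ?_)
    · exact contract_coevL (V := V.carrier ⊗[ℂ] W.carrier) _ _ _ <| apply_left _ _ _ fun v w =>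
        (show W.carrier →ₗ[ℂ] ℂ from g).map_smul _ _
    · refine contract_coevR (tensorRep V.ρ W.ρ) _ _ _ fun t => ?_
      refine (apply_right _ _ ((TensorProduct.lid ℂ ℂ ∘ₗ TensorProduct.map
        (show V.carrier →ₗ[ℂ] ℂ from f) (show W.carrier →ₗ[ℂ] ℂ from g)) ∘ₗ
          pivInv (tensorRep V.ρ W.ρ)) (fun v w => ?_) _).trans ?_
      · rw [LinearMap.comp_apply, pivInv_tensor]
        exact mul_comm ((show W.carrier →ₗ[ℂ] ℂ from g) (pivInv W.ρ w))
          ((show V.carrier →ₗ[ℂ] ℂ from f) (pivInv V.ρ v))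
      · rw [LinearMap.comp_apply, pivInv_piv])

end WeightModule

end UqSl2

/-! ### Highest weight modules and the modified dimension -/

namespace UqSl2

open Ubar

/-- The ground ring of the category of weight modules is `ℂ`. -/
def groundEquiv (R : RootData) : ℂ ≃+* End (𝟙_ (WeightModule R)) where
  toFun c := (⟨c • LinearMap.id, fun x v => by simp⟩ : WeightModule.triv R ⟶ WeightModule.triv R)
  invFun f := WeightModule.Hom.toLin (V := WeightModule.triv R) (W := WeightModule.triv R) f (1 : ℂ)
  left_inv c := mul_one c
  right_inv f := WeightModule.Hom.ext (LinearMap.ext_ring (mul_one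
    (show ℂ from WeightModule.Hom.toLin (V := WeightModule.triv R) (W := WeightModule.triv R) f
      (1 : ℂ))))
  map_mul' _ _ := WeightModule.Hom.ext (LinearMap.ext fun v => mul_assoc _ _ (show ℂ from v))
  map_add' _ _ := WeightModule.Hom.ext (LinearMap.ext fun v => add_mul _ _ (show ℂ from v))

variable (R : RootData)

/-- The exact period of `x ↦ q^x`. -/
def RootData.period : ℂ := 2 * R.r / R.k

lemma RootData.qpow_periodic : Function.Periodic R.qpow R.period := by
  intro x
  have hk := R.k_ne
  have hr := R.r_ne
  have : (x + R.period) * R.k * Complex.I * Real.pi / R.r =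
      x * R.k * Complex.I * Real.pi / R.r + 2 * Real.pi * Complex.I := by
    rw [RootData.period]
    field_simp
  rw [RootData.qpow, this, Complex.exp_add, Complex.exp_two_pi_mul_I, mul_one, RootData.qpow]

/-- The group of weights `ℂ / (2r/k)ℤ`; it is `ℂ / 2rℤ` when `k = ±1`. The function `x ↦ q^x` is
well defined and injective on it. -/
abbrev Weight : Type := ℂ ⧸ AddSubgroup.zmultiples R.period

variable {R}

/-- `q^x` for a weight `x`. -/
def Weight.qpow (x : Weight R) : ℂ := R.qpow_periodic.lift x

/-- `{x} = q^x - q^{-x}`. -/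
def Weight.brace (x : Weight R) : ℂ := x.qpow - (-x).qpow

/-- `V` is a highest weight module of highest weight `x`: it is generated by a non-zero vector `v`
with `E v = 0` and `K v = q^x v`. -/
def IsHighestWeight (V : WeightModule R) (x : Weight R) : Prop :=
  ∃ v : V.carrier, v ≠ 0 ∧ V.ρ (gen R .K) v = x.qpow • v ∧ V.ρ (gen R .E) v = 0 ∧
    ∀ w : V.carrier, ∃ a : Ubar R, V.ρ a v = w

variable (R) in
/-- The index set `(ℂ ∖ (1/k)ℤ) / (2r/k)ℤ`; it is `(ℂ ∖ ℤ) / 2rℤ` when `k = ±1`. -/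
def Index : Type := {x : Weight R // ∀ n : ℤ, x ≠ ((n / R.k : ℂ) : Weight R)}

/-- The involution `i ↦ -i`. -/
def Index.star (i : Index R) : Index R :=
  ⟨-i.1, fun n h => i.2 (-n) (by
    have h' := congrArg Neg.neg h
    rw [neg_neg] at h'
    rw [h', ← QuotientAddGroup.mk_neg]
    push_cast
    rw [neg_div])⟩

/-- The modified dimension `1 / ∏_{j=0}^{r-2} {i - 1 - j}`. -/
def modifiedDim (i : Index R) : ℂ :=
  1 / ∏ j ∈ Finset.range (R.r - 1), Weight.brace (i.1 - ((1 : ℂ) : Weight R) - ((j : ℂ) : Weight R))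

end UqSl2

end

/-! The quantum trace vanishes on the modules `V_i`, so a cut graph is evaluated instead by an
ordinary trace with a correction inserted on one strand. The correction comes from an averaging
operator.

For a linear map `k : V → W` between representations let `powSum x k = ∑ x^a k x^(r-1-a)` and `avg k
= powSum E (powSum F k)`. Since `q²` is a primitive `r`-th root of unity, `∑ x^a y^(r-1-a) =
∏_{0<j<r} (x - q^(2j) y)` for commuting `x`, `y`; this is applied to left and right multiplication
by `E` or `F`. If `k` commutes with `K`, each linear factor is one step of an adjoint action on
linear maps, once `k` has been twisted by `K^(r-1)` (left action, `k ↦ a₁ k S(a₂)`) or by `K^(1-r)`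
(right action, `k ↦ a₂ k S⁻¹(a₁)`). So `avg` is a twisted action of `E^(r-1) F^(r-1)`. A Casimir
argument shows that this equals the action of `F^(r-1) E^(r-1)` on vectors fixed by `K`
(`avg_eq_powSum_F_powSum_E`). Three facts follow: `avg k` is a morphism (`equivariant_avg`); `tr
(avg m ∘ n) = tr (m ∘ avg n)` when `n` commutes with `K` (`trace_avg_comp`); and `avg (m ⊗ t
K^(1-r)) = avg m ⊗ t`, `avg (t K^(r-1) ⊗ m) = t ⊗ avg m` for morphisms `t` (`avg_map_left`,
`avg_map_right`).

Call `X` relatively projective if its identity is the average of a map commuting with `K`. These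
modules absorb tensor products. In a diagram with a strand of relatively projective color, replace
the piece at that strand by a weight preserving map with the same average, and correct the pieces to
its right by `K^(1-r)` and those to its left by `K^(r-1)`. The result averages to the value of the
diagram, and its trace pairing with a morphism does not depend on the place or the choice of the
mark (`Mark.pairing_eq`): self-adjointness carries the average from one mark to another, while the
corrections by the pivot turn ordinary traces over neighbouring factors into partial traces built
from `b, d'` and `b', d`. Marks survive every elementary isotopy, and the two closures of a marked
diagram have the same value because the corrections cancel the pivots in the cups and caps
(`marksAgree_sphereIsotopic`). For a marked cut along one strand this value is a plain trace, so the
trace depends only on the closed graph (`trace_mark_eq`).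

It remains to compute. In `V_i` with highest weight vector `w` the vectors `F^n w`, `n < r`, form a
basis and `E F^n w = c_n F^(n-1) w`. The projection onto `w` has average `c_1 ⋯ c_(r-1)`, so `V_i`
is relatively projective, and its identity is the average of a map of trace `(c_1 ⋯ c_(r-1))⁻¹`
(`exists_avg_eq_id`). A cut with scalar `a` thus has marked trace `a (c_1 ⋯ c_(r-1))⁻¹`. As `c_n =
-{n}{i-n}/{1}²`, this inverse product is the modified dimension up to a factor that does not involve
`i` (`modifiedDim_eq_mul`). For the basic data, the dual of `V_(-i)` again has highest weight
`i+r-1`; as `i ≠ -i`, one isomorphism is chosen for each pair `{i, -i}` and the other is defined by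
the compatibility condition. -/

/-! ### A product formula at roots of unity -/

section RootProduct

universe w

/-- The ascending products `(x - ω^n y) ⋯ (x - ω y)`. -/
def ascProd {A : Type*} [Ring A] [Algebra ℂ A] (ω : ℂ) (x y : A) : ℕ → A
  | 0 => 1
  | n + 1 => (x - ω ^ (n + 1) • y) * ascProd ω x y n

/-- The descending products `(x - ω^(m+1-n) y) ⋯ (x - ω^m y)`. -/
def descProd {A : Type*} [Ring A] [Algebra ℂ A] (ω : ℂ) (m : ℕ) (x y : A) : ℕ → A
  | 0 => 1
  | n + 1 => (x - ω ^ (m - n) • y) * descProd ω m x y n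

/-- Both sides become `X^(m+1) - Y^(m+1)` after multiplication by `X - Y`. The cancellation takes
place in the domain `ℂ[X, Y]`, and the identity is then specialised, because `x - y` may be a zero
divisor in `B`. -/
lemma prod_sub_eq_sum {B : Type*} [CommRing B] [Algebra ℂ B] {ω : ℂ} {m : ℕ}
    (h : IsPrimitiveRoot ω (m + 1)) (x y : B) :
    ∏ j ∈ Finset.range m, (x - ω ^ (j + 1) • y) =
      ∑ a ∈ Finset.range (m + 1), x ^ a * y ^ (m - a) := by
  let X0 : MvPolynomial (Fin 2) ℂ := MvPolynomial.X 0
  let X1 : MvPolynomial (Fin 2) ℂ := MvPolynomial.X 1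
  have hne : X0 - X1 ≠ 0 := by
    rw [sub_ne_zero]
    intro h
    exact absurd (MvPolynomial.X_injective h) (by decide)
  have hω : IsPrimitiveRoot (algebraMap ℂ (MvPolynomial (Fin 2) ℂ) ω) (m + 1) :=
    h.map_of_injective (f := algebraMap ℂ (MvPolynomial (Fin 2) ℂ))
      (FaithfulSMul.algebraMap_injective ℂ (MvPolynomial (Fin 2) ℂ))
  have key := congrArg (Polynomial.eval X0)
    (X_pow_sub_C_eq_prod hω (Nat.succ_pos m) (rfl : X1 ^ (m + 1) = _))
  rw [Polynomial.eval_prod] at key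
  simp only [Polynomial.eval_sub, Polynomial.eval_pow, Polynomial.eval_X, Polynomial.eval_C] at key
  rw [Finset.prod_range_succ', ← (Commute.all X0 X1).mul_geom_sum₂] at key
  simp only [pow_zero, one_mul] at key
  rw [mul_comm] at key
  have key2 := mul_right_cancel₀ hne key
  have := congrArg (MvPolynomial.aeval (R := ℂ) ![x, y]) key2
  simp only [map_sum, map_prod, map_sub, map_mul, map_pow, X0, X1, MvPolynomial.aeval_X,
    Matrix.cons_val_zero, Matrix.cons_val_one, AlgHom.commutes] at this
  simp only [Algebra.smul_def, map_pow]
  rw [← this]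
  refine Finset.sum_congr rfl fun a ha => ?_
  simp

lemma descProd_eq_reflect {B : Type*} [CommRing B] [Algebra ℂ B] (ω : ℂ) (m : ℕ) (x y : B)
    (n : ℕ) : descProd ω m x y n = ∏ j ∈ Finset.range n, (x - ω ^ (m - j) • y) := by
  induction n with
  | zero => rfl
  | succ n ih => rw [descProd, ih, Finset.prod_range_succ, mul_comm]

lemma ascProd_eq {B : Type*} [CommRing B] [Algebra ℂ B] (ω : ℂ) (x y : B)
    (n : ℕ) : ascProd ω x y n = ∏ j ∈ Finset.range n, (x - ω ^ (j + 1) • y) := by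
  induction n with
  | zero => rfl
  | succ n ih => rw [ascProd, ih, Finset.prod_range_succ, mul_comm]

lemma map_ascProd {A B : Type*} [Ring A] [Algebra ℂ A] [Ring B] [Algebra ℂ B] (f : B →ₐ[ℂ] A)
    (ω : ℂ) (x y : B) (n : ℕ) : f (ascProd ω x y n) = ascProd ω (f x) (f y) n := by
  induction n with
  | zero => simp [ascProd]
  | succ n ih => simp [ascProd, ih]

lemma map_descProd {A B : Type*} [Ring A] [Algebra ℂ A] [Ring B] [Algebra ℂ B] (f : B →ₐ[ℂ] A)
    (ω : ℂ) (m : ℕ) (x y : B) (n : ℕ) :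
    f (descProd ω m x y n) = descProd ω m (f x) (f y) n := by
  induction n with
  | zero => simp [descProd]
  | succ n ih => simp [descProd, ih]

variable {A : Type*} [Ring A] [Algebra ℂ A]

/-- Two commuting elements generate a commutative subalgebra, so identities between them may be
proved in commutative rings. -/
lemma exists_commutative_model {A : Type w} [Ring A] [Algebra ℂ A] {x y : A} (h : Commute x y) :
    ∃ (B : Type w) (_ : CommRing B) (_ : Algebra ℂ B) (f : B →ₐ[ℂ] A) (x' y' : B),
      f x' = x ∧ f y' = y := by
  have : IsMulCommutative (Algebra.adjoin ℂ ({x, y} : Set A)) :=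
    Algebra.isMulCommutative_adjoin ℂ (by
      rintro a (rfl | rfl) b (rfl | rfl)
      exacts [rfl, h, h.symm, rfl])
  let _ : CommRing (Algebra.adjoin ℂ ({x, y} : Set A)) :=
    { (inferInstance : Ring (Algebra.adjoin ℂ ({x, y} : Set A))) with
      mul_comm := this.is_comm.comm }
  exact ⟨Algebra.adjoin ℂ ({x, y} : Set A), inferInstance, inferInstance, Subalgebra.val _,
    ⟨x, Algebra.subset_adjoin (by simp)⟩, ⟨y, Algebra.subset_adjoin (by simp)⟩, rfl, rfl⟩

lemma ascProd_eq_sum {ω : ℂ} {m : ℕ} (hω : IsPrimitiveRoot ω (m + 1)) {x y : A}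
    (h : Commute x y) :
    ascProd ω x y m = ∑ a ∈ Finset.range (m + 1), x ^ a * y ^ (m - a) := by
  obtain ⟨B, _, _, f, x', y', rfl, rfl⟩ := exists_commutative_model h
  rw [← map_ascProd, ascProd_eq, prod_sub_eq_sum hω]
  simp

/-- The factors are those of `ascProd` in the opposite order. Both orders are needed: a twist that
is used up step by step produces decreasing powers of `ω`, a permanent one increasing powers. -/
lemma descProd_eq_sum {ω : ℂ} {m : ℕ} (hω : IsPrimitiveRoot ω (m + 1)) {x y : A}
    (h : Commute x y) :
    descProd ω m x y m = ∑ a ∈ Finset.range (m + 1), x ^ a * y ^ (m - a) := by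
  obtain ⟨B, _, _, f, x', y', rfl, rfl⟩ := exists_commutative_model h
  rw [← map_descProd, descProd_eq_reflect]
  rw [← Finset.prod_range_reflect]
  have : ∏ j ∈ Finset.range m, (x' - ω ^ (m - (m - 1 - j)) • y') =
      ∏ j ∈ Finset.range m, (x' - ω ^ (j + 1) • y') := by
    refine Finset.prod_congr rfl fun j hj => ?_
    have := Finset.mem_range.1 hj
    congr 3
    omega
  rw [this, prod_sub_eq_sum hω]
  simp

end RootProduct

/-! ### Averaging of linear maps between representations -/

namespace UqSl2

open Ubar
open scoped TensorProduct

lemma RootData.isPrimitiveRoot (R : RootData) : IsPrimitiveRoot (R.q ^ 2) (R.r - 1 + 1) := by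
  rw [Nat.sub_add_cancel R.one_lt.le]
  exact ⟨(R.q_sq_pow_eq_one_iff _).2 dvd_rfl, fun l hl => (R.q_sq_pow_eq_one_iff l).1 hl⟩

lemma RootData.q_sq_mul_inv (R : RootData) : R.q ^ 2 * (R.q⁻¹) ^ 2 = 1 := by
  rw [← mul_pow, mul_inv_cancel₀ R.q_ne, one_pow]

lemma RootData.q_sub_inv_ne (R : RootData) : R.q - R.q⁻¹ ≠ 0 := by
  have := R.q_sq_ne_one
  have hq := R.q_ne
  intro h
  apply this
  field_simp at h
  linear_combination h

/-! ### Commutation of powers of `K` with `E` and `F`. -/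

section Commutation

variable {R : RootData}

lemma K_pow_mul_E (s : ℕ) :
    gen R .K ^ s * gen R .E = (R.q ^ 2) ^ s • (gen R .E * gen R .K ^ s) := by
  induction s with
  | zero => simp
  | succ s ih =>
    rw [pow_succ, mul_assoc, satisfies_gen.KE, mul_smul_comm, ← mul_assoc, ih, smul_mul_assoc,
      smul_smul, mul_assoc, ← pow_succ, ← pow_succ']

lemma Kinv_pow_mul_F (s : ℕ) :
    gen R .Kinv ^ s * gen R .F = (R.q ^ 2) ^ s • (gen R .F * gen R .Kinv ^ s) := by
  induction s with
  | zero => simp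
  | succ s ih =>
    rw [pow_succ, mul_assoc, satisfies_gen.KinvF, mul_smul_comm, ← mul_assoc, ih, smul_mul_assoc,
      smul_smul, mul_assoc, ← pow_succ, ← pow_succ']

/-- `K^r` is central, so `K^(r-1)` passes `F` in the same way as `K⁻¹`. -/
lemma K_pow_pred_mul_F :
    gen R .K ^ (R.r - 1) * gen R .F = R.q ^ 2 • (gen R .F * gen R .K ^ (R.r - 1)) := by
  rw [← K_pow_mul_Kinv, mul_assoc, satisfies_gen.KinvF, mul_smul_comm, ← mul_assoc, ← mul_assoc,
    (K_pow_central .F).eq]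

end Commutation

/-! ### The Casimir argument for `E^n F^n` and `F^n E^n`. -/

section Operators

variable {A : Type*} [Ring A] [Algebra ℂ A]

/-- In a representation, `E^n F^n` and `F^n E^n` agree on the vectors of weight `1`. -/
lemma pow_mul_pow_comm {M : Type*} [AddCommGroup M] [Module ℂ M] {q : ℂ} (hq : q ≠ 0)
    {e f κ κi : Module.End ℂ M} (hκ : κ * κi = 1) (hκ' : κi * κ = 1) (he : κ * e = q ^ 2 • (e * κ))
    (hf : κ * f = (q⁻¹) ^ 2 • (f * κ)) (hef : e * f - f * e = (q - q⁻¹)⁻¹ • (κ - κi))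
    (v : M) (hv : κ v = v) (n : ℕ) : (e ^ n) ((f ^ n) v) = (f ^ n) ((e ^ n) v) := by
  have hki : ∀ (c : ℂ) (w : M), c ≠ 0 → κ w = c • w → κi w = c⁻¹ • w := by
    intro c w hc h
    have := congrArg κi h
    rw [← Module.End.mul_apply, hκ', map_smul, Module.End.one_apply] at this
    rw [eq_inv_smul_iff₀ hc]
    exact this.symm
  have hq2' : (q ^ 2) ≠ 0 := pow_ne_zero _ hq
  -- the Casimir element
  set C : Module.End ℂ M := e * f + ((q - q⁻¹) ^ 2)⁻¹ • (q⁻¹ • κ + q • κi) with hC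
  have hC' : C = f * e + ((q - q⁻¹) ^ 2)⁻¹ • (q • κ + q⁻¹ • κi) := by
    have : e * f = f * e + (q - q⁻¹)⁻¹ • (κ - κi) := by rw [← hef]; abel
    rw [hC, this, add_assoc]
    congr 1
    ext w
    simp only [LinearMap.add_apply, LinearMap.smul_apply, LinearMap.sub_apply]
    have e1 : (q - q⁻¹)⁻¹ = ((q - q⁻¹) ^ 2)⁻¹ * (q - q⁻¹) := by field_simp
    rw [e1, mul_smul, ← smul_add]
    congr 1
    module
  have eκi : e * κi = q ^ 2 • (κi * e) := by
    calc e * κi = κi * (κ * e) * κi := by rw [← mul_assoc, hκ', one_mul]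
      _ = q ^ 2 • (κi * e) := by
        rw [he, mul_smul_comm, smul_mul_assoc, mul_assoc κi, mul_assoc e, hκ, mul_one]
  have fκi : f * κi = (q⁻¹) ^ 2 • (κi * f) := by
    calc f * κi = κi * (κ * f) * κi := by rw [← mul_assoc, hκ', one_mul]
      _ = (q⁻¹) ^ 2 • (κi * f) := by
        rw [hf, mul_smul_comm, smul_mul_assoc, mul_assoc κi, mul_assoc f, hκ, mul_one]
  have hCe : Commute C e := by
    show C * e = e * C
    -- With the form `e f + …` of `C` on the left and `f e + …` on the right, both sides have the
    -- leading term `e f e`.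
    conv_lhs => rw [hC]
    rw [hC', add_mul, mul_add, smul_mul_assoc, mul_smul_comm, add_mul, mul_add, smul_mul_assoc,
      smul_mul_assoc, mul_smul_comm, mul_smul_comm, he, eκi, mul_assoc, smul_smul, smul_smul]
    congr 4
    · field_simp
    · field_simp
  have hCf : Commute C f := by
    show C * f = f * C
    conv_lhs => rw [hC']
    rw [hC, add_mul, mul_add, smul_mul_assoc, mul_smul_comm, add_mul, mul_add, smul_mul_assoc,
      smul_mul_assoc, mul_smul_comm, mul_smul_comm, hf, fκi, mul_assoc, smul_smul, smul_smul]
    congr 4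
    · field_simp
    · field_simp
  have we : ∀ n : ℕ, κ ((e ^ n) v) = (q ^ 2) ^ n • (e ^ n) v := by
    intro n
    induction n with
    | zero => simpa using hv
    | succ n ih =>
      rw [pow_succ', Module.End.mul_apply, ← Module.End.mul_apply, he, LinearMap.smul_apply,
        Module.End.mul_apply, ih, map_smul, smul_smul, ← pow_succ']
  have wf : ∀ n : ℕ, κ ((f ^ n) v) = ((q⁻¹) ^ 2) ^ n • (f ^ n) v := by
    intro n
    induction n with
    | zero => simpa using hv
    | succ n ih =>
      rw [pow_succ', Module.End.mul_apply, ← Module.End.mul_apply, hf, LinearMap.smul_apply,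
        Module.End.mul_apply, ih, map_smul, smul_smul, ← pow_succ']
  induction n with
  | zero => simp
  | succ n ih =>
    -- The weights of `f^n v` and `e^n v` are inverse to each other, and the two forms of `C`
    -- exchange `κ` and `κi`. Hence `e f` on `f^n v` and `f e` on `e^n v` are both `C - c` with the
    -- same scalar, and `C` commutes with the remaining powers.
    set c : ℂ := ((q - q⁻¹) ^ 2)⁻¹ * (q * (q ^ 2) ^ n + q⁻¹ * ((q⁻¹) ^ 2) ^ n) with hc
    have hinv : ((q ^ 2) ^ n)⁻¹ = ((q⁻¹) ^ 2) ^ n := by rw [inv_pow, inv_pow]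
    have hinv' : (((q⁻¹) ^ 2) ^ n)⁻¹ = (q ^ 2) ^ n := by rw [← hinv, inv_inv]
    have h1 : e (f ((f ^ n) v)) = C ((f ^ n) v) - c • (f ^ n) v := by
      rw [hC, LinearMap.add_apply, LinearMap.smul_apply, LinearMap.add_apply,
        LinearMap.smul_apply, LinearMap.smul_apply, wf,
        hki _ _ (pow_ne_zero _ (pow_ne_zero _ (inv_ne_zero hq))) (wf n), hinv', hc,
        Module.End.mul_apply]
      module
    have h2 : f (e ((e ^ n) v)) = C ((e ^ n) v) - c • (e ^ n) v := by
      rw [hC', LinearMap.add_apply, LinearMap.smul_apply, LinearMap.add_apply,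
        LinearMap.smul_apply, LinearMap.smul_apply, we,
        hki _ _ (pow_ne_zero _ hq2') (we n), hinv, hc,
        Module.End.mul_apply]
      module
    have l1 : (e ^ (n + 1)) ((f ^ (n + 1)) v) = (e ^ n) (e (f ((f ^ n) v))) := by
      rw [pow_succ, pow_succ', Module.End.mul_apply, Module.End.mul_apply]
    have l2 : (f ^ (n + 1)) ((e ^ (n + 1)) v) = (f ^ n) (f (e ((e ^ n) v))) := by
      rw [pow_succ, pow_succ', Module.End.mul_apply, Module.End.mul_apply]
    rw [l1, l2, h1, h2, map_sub, map_sub, map_smul, map_smul, ih, ← Module.End.mul_apply (e ^ n) C,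
      ← (hCe.pow_right n).eq, Module.End.mul_apply C, ih,
      ← Module.End.mul_apply (f ^ n) C, ← (hCf.pow_right n).eq, Module.End.mul_apply]

end Operators

/-! ### The averaging operator and the adjoint actions on linear maps. -/

section Averaging

variable {R : RootData} {V W : Type*} [AddCommGroup V] [Module ℂ V] [AddCommGroup W] [Module ℂ W]
variable (ρ : Ubar R →ₐ[ℂ] Module.End ℂ V) (σ : Ubar R →ₐ[ℂ] Module.End ℂ W)

/-- The operator `k ↦ a k b` on linear maps between representations. -/
def sandwich (a b : Ubar R) : Module.End ℂ (V →ₗ[ℂ] W) where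
  toFun k := σ a ∘ₗ k ∘ₗ ρ b
  map_add' k l := by ext; simp
  map_smul' c k := by ext; simp

lemma sandwich_apply (a b : Ubar R) (k : V →ₗ[ℂ] W) (v : V) :
    sandwich ρ σ a b k v = σ a (k (ρ b v)) := rfl

lemma sandwich_mul (a b a' b' : Ubar R) :
    sandwich ρ σ a b * sandwich ρ σ a' b' = sandwich ρ σ (a * a') (b' * b) := by
  ext k v
  simp [sandwich_apply]

lemma sandwich_sandwich (a b a' b' : Ubar R) (k : V →ₗ[ℂ] W) :
    sandwich ρ σ a b (sandwich ρ σ a' b' k) = sandwich ρ σ (a * a') (b' * b) k := by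
  rw [← sandwich_mul]; rfl

lemma sandwich_one : sandwich ρ σ 1 1 = 1 := by
  ext k v
  simp [sandwich_apply]

lemma sandwich_smul_left (c : ℂ) (a b : Ubar R) :
    sandwich ρ σ (c • a) b = c • sandwich ρ σ a b := by
  ext k v
  simp [sandwich_apply]

lemma sandwich_smul_right (c : ℂ) (a b : Ubar R) :
    sandwich ρ σ a (c • b) = c • sandwich ρ σ a b := by
  ext k v
  simp [sandwich_apply]

lemma sandwich_sub_left (a a' b : Ubar R) :
    sandwich ρ σ (a - a') b = sandwich ρ σ a b - sandwich ρ σ a' b := by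
  ext k v
  simp [sandwich_apply]

lemma sandwich_sub_right (a b b' : Ubar R) :
    sandwich ρ σ a (b - b') = sandwich ρ σ a b - sandwich ρ σ a b' := by
  ext k v
  simp [sandwich_apply]

lemma sandwich_pow_left (a : Ubar R) (n : ℕ) :
    sandwich ρ σ a 1 ^ n = sandwich ρ σ (a ^ n) 1 := by
  induction n with
  | zero => simp [sandwich_one]
  | succ n ih => rw [pow_succ, ih, sandwich_mul, one_mul, pow_succ]

lemma sandwich_pow_right (a : Ubar R) (n : ℕ) :
    sandwich ρ σ 1 a ^ n = sandwich ρ σ 1 (a ^ n) := by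
  induction n with
  | zero => simp [sandwich_one]
  | succ n ih => rw [pow_succ, ih, sandwich_mul, one_mul, pow_succ']

lemma sandwich_commute (a b : Ubar R) :
    Commute (sandwich ρ σ a 1) (sandwich ρ σ 1 b) := by
  show _ * _ = _ * _
  simp [sandwich_mul]

/-- The operator `k ↦ ∑ x^a k x^(r-1-a)`. -/
def powSum (x : Ubar R) : Module.End ℂ (V →ₗ[ℂ] W) :=
  ∑ a ∈ Finset.range R.r, sandwich ρ σ (x ^ a) (x ^ (R.r - 1 - a))

lemma powSum_eq_geom (x : Ubar R) : powSum ρ σ x = ∑ a ∈ Finset.range (R.r - 1 + 1),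
    sandwich ρ σ x 1 ^ a * sandwich ρ σ 1 x ^ (R.r - 1 - a) := by
  rw [powSum, Nat.sub_add_cancel R.one_lt.le]
  refine Finset.sum_congr rfl fun a _ => ?_
  rw [sandwich_pow_left, sandwich_pow_right, sandwich_mul, mul_one, mul_one]

/-- Left and right multiplication by `x` commute, so the product formula applies with `ω = q²` and
`m = r - 1`. -/
lemma powSum_eq_ascProd (x : Ubar R) : powSum ρ σ x =
    ascProd (R.q ^ 2) (sandwich ρ σ x 1) (sandwich ρ σ 1 x) (R.r - 1) := by
  rw [powSum_eq_geom, ascProd_eq_sum R.isPrimitiveRoot (sandwich_commute ρ σ x x)]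

lemma powSum_eq_descProd (x : Ubar R) : powSum ρ σ x =
    descProd (R.q ^ 2) (R.r - 1) (sandwich ρ σ x 1) (sandwich ρ σ 1 x) (R.r - 1) := by
  rw [powSum_eq_geom, descProd_eq_sum R.isPrimitiveRoot (sandwich_commute ρ σ x x)]

/-- The linear map `k` shifts weights by the factor `ω`. -/
def HasShift (ω : ℂ) (k : V →ₗ[ℂ] W) : Prop :=
  sandwich ρ σ (gen R .K) 1 k = ω • sandwich ρ σ 1 (gen R .K) k

/-- Commutation with the action of `K`. -/
def WeightPreserving (k : V →ₗ[ℂ] W) : Prop :=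
  ∀ v, k (ρ (gen R .K) v) = σ (gen R .K) (k v)

variable {ρ σ}

lemma WeightPreserving.hasShift {k : V →ₗ[ℂ] W} (h : WeightPreserving ρ σ k) :
    HasShift ρ σ 1 k := by
  rw [HasShift, one_smul]
  ext v
  simpa [sandwich_apply] using (h v).symm

/-- Both `x` and `y` are weight vectors under conjugation by `K`, and their weights multiply with
that of `k`. -/
lemma HasShift.sandwich {ω a b : ℂ} {k : V →ₗ[ℂ] W} (h : HasShift ρ σ ω k) {x y : Ubar R}
    (hx : gen R .K * x = a • (x * gen R .K)) (hy : gen R .K * y = b • (y * gen R .K)) :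
    HasShift ρ σ (a * b * ω) (sandwich ρ σ x y k) := by
  have h1 : UqSl2.sandwich ρ σ x y (UqSl2.sandwich ρ σ (gen R .K) 1 k) =
      UqSl2.sandwich ρ σ x y (ω • UqSl2.sandwich ρ σ 1 (gen R .K) k) := by rw [h]
  rw [map_smul, sandwich_sandwich, sandwich_sandwich, one_mul, mul_one, hy,
    sandwich_smul_right, LinearMap.smul_apply] at h1
  rw [HasShift, sandwich_sandwich, sandwich_sandwich, hx, mul_one, one_mul, sandwich_smul_left,
    LinearMap.smul_apply, h1, smul_smul, smul_smul]
  congr 1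
  ring

lemma HasShift.sub {ω : ℂ} {k l : V →ₗ[ℂ] W} (h : HasShift ρ σ ω k) (h' : HasShift ρ σ ω l) :
    HasShift ρ σ ω (k - l) := by
  rw [HasShift, map_sub, map_sub, h, h', smul_sub]

lemma HasShift.smul {ω : ℂ} {k : V →ₗ[ℂ] W} (h : HasShift ρ σ ω k) (c : ℂ) :
    HasShift ρ σ ω (c • k) := by
  rw [HasShift, map_smul, map_smul, h, smul_comm]

lemma HasShift.ascProd {ω a b : ℂ} {k : V →ₗ[ℂ] W} (h : HasShift ρ σ ω k) {x : Ubar R}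
    (hx : gen R .K * x = a • (x * gen R .K)) (n : ℕ) :
    HasShift ρ σ (a ^ n * ω)
      (ascProd b (UqSl2.sandwich ρ σ x 1) (UqSl2.sandwich ρ σ 1 x) n k) := by
  have h1 : gen R .K * 1 = (1 : ℂ) • (1 * gen R .K) := by simp
  induction n with
  | zero => simpa [_root_.ascProd] using h
  | succ n ih =>
    rw [_root_.ascProd, Module.End.mul_apply, LinearMap.sub_apply, LinearMap.smul_apply]
    have e1 := ih.sandwich hx h1
    have e2 := ih.sandwich h1 hx
    rw [mul_one, ← mul_assoc, ← pow_succ'] at e1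
    rw [one_mul, ← mul_assoc, ← pow_succ'] at e2
    exact e1.sub (e2.smul _)

lemma HasShift.powSum {ω a : ℂ} {k : V →ₗ[ℂ] W} (h : HasShift ρ σ ω k) {x : Ubar R}
    (hx : gen R .K * x = a • (x * gen R .K)) :
    HasShift ρ σ (a ^ (R.r - 1) * ω) (powSum ρ σ x k) := by
  rw [powSum_eq_ascProd]
  exact h.ascProd hx _

lemma HasShift.sandwich_Kinv {ω : ℂ} (hω : ω ≠ 0) {k : V →ₗ[ℂ] W} (h : HasShift ρ σ ω k) :
    UqSl2.sandwich ρ σ (gen R .Kinv) 1 k = ω⁻¹ • UqSl2.sandwich ρ σ 1 (gen R .Kinv) k := by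
  have h1 := congrArg (UqSl2.sandwich ρ σ (gen R .Kinv) (gen R .Kinv)) h
  rw [map_smul, sandwich_sandwich, sandwich_sandwich, satisfies_gen.Kinv_K, one_mul, mul_one,
    satisfies_gen.K_Kinv] at h1
  rw [eq_inv_smul_iff₀ hω, ← h1]

lemma HasShift.sandwich_K {ω : ℂ} {k : V →ₗ[ℂ] W} (h : HasShift ρ σ ω k) :
    UqSl2.sandwich ρ σ (gen R .K) 1 k = ω • UqSl2.sandwich ρ σ 1 (gen R .K) k := h

variable (ρ σ)

/-- The left adjoint action of `E`. -/
def adE : Module.End ℂ (V →ₗ[ℂ] W) :=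
  sandwich ρ σ (gen R .E) (gen R .Kinv) - sandwich ρ σ 1 (gen R .E * gen R .Kinv)

/-- The left adjoint action of `F`. -/
def adF : Module.End ℂ (V →ₗ[ℂ] W) :=
  sandwich ρ σ (gen R .F) 1 - sandwich ρ σ (gen R .Kinv) (gen R .K * gen R .F)

/-- The right adjoint action of `E`. -/
def adE' : Module.End ℂ (V →ₗ[ℂ] W) :=
  sandwich ρ σ (gen R .E) 1 - sandwich ρ σ (gen R .K) (gen R .Kinv * gen R .E)

/-- The right adjoint action of `F`. -/
def adF' : Module.End ℂ (V →ₗ[ℂ] W) :=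
  sandwich ρ σ (gen R .F) (gen R .K) - sandwich ρ σ 1 (gen R .F * gen R .K)

variable {ρ σ}

/-- One step sends `l K^s` to `(E l - q^(2s) l E) K^(s-1)`: the twist loses one power of `K`, and
moving `K^s` past `E` yields the coefficient. Hence the descending product. -/
lemma adE_pow_twist (k : V →ₗ[ℂ] W) (m n : ℕ) (h : n ≤ m) :
    (adE ρ σ ^ n) (sandwich ρ σ 1 (gen R .K ^ m) k) = sandwich ρ σ 1 (gen R .K ^ (m - n))
      (descProd (R.q ^ 2) m (sandwich ρ σ (gen R .E) 1) (sandwich ρ σ 1 (gen R .E)) n k) := by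
  induction n with
  | zero => simp [descProd]
  | succ n ih =>
    obtain ⟨s, hs⟩ : ∃ s, m - n = s + 1 := ⟨m - n - 1, by omega⟩
    have hs' : m - (n + 1) = s := by omega
    have e1 : gen R .K ^ (s + 1) * gen R .Kinv = gen R .K ^ s := by
      rw [pow_succ, mul_assoc, satisfies_gen.K_Kinv, mul_one]
    have e2 : gen R .K ^ (s + 1) * (gen R .E * gen R .Kinv) =
        (R.q ^ 2) ^ (s + 1) • (gen R .E * gen R .K ^ s) := by
      rw [← mul_assoc, K_pow_mul_E, smul_mul_assoc, mul_assoc, e1]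
    have e3 : gen R .Kinv * gen R .K ^ (s + 1) = gen R .K ^ s := by
      rw [pow_succ', ← mul_assoc, satisfies_gen.Kinv_K, one_mul]
    have e4 : gen R .E * gen R .Kinv * gen R .K ^ (s + 1) = gen R .E * gen R .K ^ s := by
      rw [mul_assoc, e3]
    rw [pow_succ', Module.End.mul_apply, ih (by omega), hs, hs', descProd, hs,
      Module.End.mul_apply, LinearMap.sub_apply, LinearMap.smul_apply, adE, LinearMap.sub_apply]
    simp only [sandwich_sandwich, map_sub, map_smul, e1, e2, mul_one, one_mul,
      sandwich_smul_right, LinearMap.smul_apply]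

lemma adF'_pow_twist (k : V →ₗ[ℂ] W) (m n : ℕ) (h : n ≤ m) :
    (adF' ρ σ ^ n) (sandwich ρ σ 1 (gen R .Kinv ^ m) k) = sandwich ρ σ 1 (gen R .Kinv ^ (m - n))
      (descProd (R.q ^ 2) m (sandwich ρ σ (gen R .F) 1) (sandwich ρ σ 1 (gen R .F)) n k) := by
  induction n with
  | zero => simp [descProd]
  | succ n ih =>
    obtain ⟨s, hs⟩ : ∃ s, m - n = s + 1 := ⟨m - n - 1, by omega⟩
    have hs' : m - (n + 1) = s := by omega
    have e1 : gen R .Kinv ^ (s + 1) * gen R .K = gen R .Kinv ^ s := by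
      rw [pow_succ, mul_assoc, satisfies_gen.Kinv_K, mul_one]
    have e2 : gen R .Kinv ^ (s + 1) * (gen R .F * gen R .K) =
        (R.q ^ 2) ^ (s + 1) • (gen R .F * gen R .Kinv ^ s) := by
      rw [← mul_assoc, Kinv_pow_mul_F, smul_mul_assoc, mul_assoc, e1]
    rw [pow_succ', Module.End.mul_apply, ih (by omega), hs, hs', descProd, hs,
      Module.End.mul_apply, LinearMap.sub_apply, LinearMap.smul_apply, adF', LinearMap.sub_apply]
    simp only [sandwich_sandwich, map_sub, map_smul, e1, e2, mul_one, one_mul,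
      sandwich_smul_right, LinearMap.smul_apply]

lemma q_inv_sq_ne (R : RootData) : (R.q⁻¹) ^ 2 ≠ 0 := pow_ne_zero _ (inv_ne_zero R.q_ne)

lemma inv_q_inv_pow (R : RootData) (n : ℕ) : (((R.q⁻¹) ^ 2) ^ n)⁻¹ = (R.q ^ 2) ^ n := by
  rw [inv_pow, inv_pow, inv_inv]

/-- Here the twist stays. After `n` steps the map shifts weights by `q^(-2n)`, so moving `K⁻¹` from
its left to its right costs `q^(2n)`; passing `K^(r-1)` over `F` costs one more `q²`. This makes the
coefficient `q^(2(n+1))`. -/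
lemma adF_pow_twist {k : V →ₗ[ℂ] W} (hk : HasShift ρ σ 1 k) (n : ℕ) :
    (adF ρ σ ^ n) (sandwich ρ σ 1 (gen R .K ^ (R.r - 1)) k) =
      sandwich ρ σ 1 (gen R .K ^ (R.r - 1))
        (ascProd (R.q ^ 2) (sandwich ρ σ (gen R .F) 1) (sandwich ρ σ 1 (gen R .F)) n k) := by
  induction n with
  | zero => simp [ascProd]
  | succ n ih =>
    have hs := hk.ascProd (b := R.q ^ 2) satisfies_gen.KF n
    rw [mul_one] at hs
    have hs := hs.sandwich_Kinv (pow_ne_zero _ (q_inv_sq_ne R))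
    rw [inv_q_inv_pow] at hs
    rw [pow_succ', Module.End.mul_apply, ih, ascProd,
      Module.End.mul_apply, LinearMap.sub_apply, LinearMap.smul_apply, adF, LinearMap.sub_apply]
    set k' := ascProd (R.q ^ 2) (sandwich ρ σ (gen R .F) 1) (sandwich ρ σ 1 (gen R .F)) n k
    have e0 : gen R .Kinv * (gen R .K ^ (R.r - 1) * (gen R .K * gen R .F)) =
        R.q ^ 2 • (gen R .F * gen R .K ^ (R.r - 1)) := by
      rw [← mul_assoc (gen R .K ^ _), ← pow_succ, pow_succ', mul_assoc, ← mul_assoc,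
        satisfies_gen.Kinv_K, one_mul, K_pow_pred_mul_F]
    have e1 : sandwich ρ σ (gen R .Kinv) (gen R .K ^ (R.r - 1) * (gen R .K * gen R .F)) k' =
        (R.q ^ 2) ^ (n + 1) • sandwich ρ σ 1 (gen R .F * gen R .K ^ (R.r - 1)) k' := by
      have := sandwich_sandwich ρ σ 1 (gen R .K ^ (R.r - 1) * (gen R .K * gen R .F))
        (gen R .Kinv) 1 k'
      rw [one_mul, one_mul] at this
      rw [← this, hs, map_smul, sandwich_sandwich, one_mul, e0, sandwich_smul_right,
        LinearMap.smul_apply, smul_smul, pow_succ (R.q ^ 2) n]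
    simp only [sandwich_sandwich, map_sub, map_smul, mul_one, one_mul, e1]

/-- No twist is present, but the shift `q^(-2)` of `k` supplies the extra factor `q²` that `K^(r-1)`
supplies in `adF_pow_twist`. -/
lemma adF_pow {k : V →ₗ[ℂ] W} (hk : HasShift ρ σ ((R.q⁻¹) ^ 2) k) (n : ℕ) :
    (adF ρ σ ^ n) k =
      ascProd (R.q ^ 2) (sandwich ρ σ (gen R .F) 1) (sandwich ρ σ 1 (gen R .F)) n k := by
  induction n with
  | zero => simp [ascProd]
  | succ n ih =>
    have hs := hk.ascProd (b := R.q ^ 2) satisfies_gen.KF n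
    rw [← pow_succ] at hs
    have hs := hs.sandwich_Kinv (pow_ne_zero _ (q_inv_sq_ne R))
    rw [inv_q_inv_pow] at hs
    rw [pow_succ', Module.End.mul_apply, ih, ascProd,
      Module.End.mul_apply, LinearMap.sub_apply, LinearMap.smul_apply, adF, LinearMap.sub_apply]
    congr 1
    have := sandwich_sandwich ρ σ 1 (gen R .K * gen R .F) (gen R .Kinv) 1
      (ascProd (R.q ^ 2) (sandwich ρ σ (gen R .F) 1) (sandwich ρ σ 1 (gen R .F)) n k)
    rw [one_mul, one_mul] at this
    rw [← this, hs, map_smul, sandwich_sandwich, one_mul, ← mul_assoc, satisfies_gen.Kinv_K,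
      one_mul]

lemma adE'_pow {k : V →ₗ[ℂ] W} (hk : HasShift ρ σ (R.q ^ 2) k) (n : ℕ) :
    (adE' ρ σ ^ n) k =
      ascProd (R.q ^ 2) (sandwich ρ σ (gen R .E) 1) (sandwich ρ σ 1 (gen R .E)) n k := by
  induction n with
  | zero => simp [ascProd]
  | succ n ih =>
    have hs := hk.ascProd (b := R.q ^ 2) satisfies_gen.KE n
    rw [← pow_succ] at hs
    have hs := hs.sandwich_K
    rw [pow_succ', Module.End.mul_apply, ih, ascProd,
      Module.End.mul_apply, LinearMap.sub_apply, LinearMap.smul_apply, adE', LinearMap.sub_apply]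
    congr 1
    have := sandwich_sandwich ρ σ 1 (gen R .Kinv * gen R .E) (gen R .K) 1
      (ascProd (R.q ^ 2) (sandwich ρ σ (gen R .E) 1) (sandwich ρ σ 1 (gen R .E)) n k)
    rw [one_mul, one_mul] at this
    rw [← this, hs, map_smul, sandwich_sandwich, one_mul, ← mul_assoc, satisfies_gen.K_Kinv,
      one_mul]

variable (ρ σ) in
/-- The average of a linear map: up to a twist by the pivot it is the action of the integral
`E^(r-1) F^(r-1)` on linear maps. -/
def avg : Module.End ℂ (V →ₗ[ℂ] W) := powSum ρ σ (gen R .E) * powSum ρ σ (gen R .F)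

lemma q_sq_pow_pred (R : RootData) : (R.q ^ 2) ^ (R.r - 1) = (R.q⁻¹) ^ 2 := by
  have h : (R.q ^ 2) ^ (R.r - 1 + 1) = 1 := R.isPrimitiveRoot.pow_eq_one
  rw [pow_succ] at h
  rw [inv_pow]
  exact eq_inv_of_mul_eq_one_left h

lemma q_inv_sq_pow_pred (R : RootData) : ((R.q⁻¹) ^ 2) ^ (R.r - 1) = R.q ^ 2 := by
  rw [inv_pow, inv_pow, q_sq_pow_pred, inv_pow, inv_inv]

/-- The steps of `adF` preserve the twist by `K^(r-1)`, and the `r - 1` steps of `adE` use it up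
exactly. -/
lemma avg_eq_adE_adF {k : V →ₗ[ℂ] W} (hk : WeightPreserving ρ σ k) :
    avg ρ σ k = (adE ρ σ ^ (R.r - 1)) ((adF ρ σ ^ (R.r - 1))
      (sandwich ρ σ 1 (gen R .K ^ (R.r - 1)) k)) := by
  rw [adF_pow_twist hk.hasShift, ← powSum_eq_ascProd, adE_pow_twist _ _ _ le_rfl,
    ← powSum_eq_descProd, Nat.sub_self, pow_zero, sandwich_one]
  rfl

/-- Now `adE` uses up the twist first. What remains has shift `q^(2(r-1)) = q^(-2)`, which is the
hypothesis of `adF_pow`. -/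
lemma powSum_powSum_eq_adF_adE {k : V →ₗ[ℂ] W} (hk : WeightPreserving ρ σ k) :
    powSum ρ σ (gen R .F) (powSum ρ σ (gen R .E) k) =
      (adF ρ σ ^ (R.r - 1)) ((adE ρ σ ^ (R.r - 1))
        (sandwich ρ σ 1 (gen R .K ^ (R.r - 1)) k)) := by
  have hs := hk.hasShift.powSum satisfies_gen.KE
  rw [q_sq_pow_pred, mul_one] at hs
  rw [adE_pow_twist _ _ _ le_rfl, ← powSum_eq_descProd, Nat.sub_self, pow_zero, sandwich_one,
    Module.End.one_apply, adF_pow hs, ← powSum_eq_ascProd]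

/-- The form of the average for the right adjoint action; it serves tensor products whose second
factor is averaged. -/
lemma avg_eq_adE'_adF' {k : V →ₗ[ℂ] W} (hk : WeightPreserving ρ σ k) :
    avg ρ σ k = (adE' ρ σ ^ (R.r - 1)) ((adF' ρ σ ^ (R.r - 1))
      (sandwich ρ σ 1 (gen R .Kinv ^ (R.r - 1)) k)) := by
  have hs := hk.hasShift.powSum satisfies_gen.KF
  rw [q_inv_sq_pow_pred, mul_one] at hs
  rw [adF'_pow_twist _ _ _ le_rfl, ← powSum_eq_descProd, Nat.sub_self, pow_zero, sandwich_one,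
    Module.End.one_apply, adE'_pow hs, ← powSum_eq_ascProd]
  rfl

/-- The adjoint action is an action of the Hopf algebra, with `K` acting by `k ↦ K k K⁻¹`; this is
its relation for `E F - F E`. -/
lemma adE_mul_adF_sub : adE ρ σ * adF ρ σ - adF ρ σ * adE ρ σ = (R.q - R.q⁻¹)⁻¹ •
    (sandwich ρ σ (gen R .K) (gen R .Kinv) - sandwich ρ σ (gen R .Kinv) (gen R .K)) := by
  have h := satisfies_gen (R := R)
  have hc : (R.q⁻¹) ^ 2 * R.q ^ 2 = 1 := by rw [mul_comm, R.q_sq_mul_inv]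
  have e1 : gen R .K * gen R .F * gen R .Kinv = (R.q⁻¹) ^ 2 • gen R .F := h.K_F
  have e2 : gen R .K * gen R .F * (gen R .E * gen R .Kinv) = gen R .F * gen R .E := by
    rw [h.EKinv, mul_smul_comm, ← mul_assoc, e1, smul_mul_assoc, smul_smul, mul_comm, hc, one_smul]
  have e3 : gen R .E * gen R .Kinv * (gen R .K * gen R .F) = gen R .E * gen R .F := by
    rw [mul_assoc, ← mul_assoc (gen R .Kinv), h.Kinv_K, one_mul]
  have e4 : gen R .Kinv * (gen R .K * gen R .F) = gen R .F := by
    rw [← mul_assoc, h.Kinv_K, one_mul]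
  have e5 : (R.q⁻¹) ^ 2 • sandwich ρ σ (gen R .E * gen R .Kinv) (gen R .F) =
      sandwich ρ σ (gen R .Kinv * gen R .E) (gen R .F) := by
    rw [h.EKinv, sandwich_smul_left, smul_smul, hc, one_smul]
  have key : adE ρ σ * adF ρ σ - adF ρ σ * adE ρ σ =
      sandwich ρ σ (gen R .E * gen R .F - gen R .F * gen R .E) (gen R .Kinv) -
        sandwich ρ σ (gen R .Kinv) (gen R .E * gen R .F - gen R .F * gen R .E) := by
    simp only [adE, adF, sub_mul, mul_sub, sandwich_mul, mul_one, one_mul, e1, e2, e3, e4,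
      sandwich_sub_left, sandwich_sub_right, sandwich_smul_right, e5]
    abel
  rw [key, h.E_F, sandwich_smul_left, sandwich_smul_right, sandwich_sub_left, sandwich_sub_right]
  exact (smul_sub _ _ _).symm.trans (congrArg _ (sub_sub_sub_cancel_right _ _ _))

/-- Both orders are powers of `adE` and `adF` applied to `k K^(r-1)`. This map is fixed by
conjugation with `K`, so `pow_mul_pow_comm` exchanges the powers. -/
lemma avg_eq_powSum_F_powSum_E {k : V →ₗ[ℂ] W} (hk : WeightPreserving ρ σ k) :
    avg ρ σ k = powSum ρ σ (gen R .F) (powSum ρ σ (gen R .E) k) := by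
  have h := satisfies_gen (R := R)
  rw [avg_eq_adE_adF hk, powSum_powSum_eq_adF_adE hk]
  refine pow_mul_pow_comm R.q_ne
    (κ := sandwich ρ σ (gen R .K) (gen R .Kinv)) (κi := sandwich ρ σ (gen R .Kinv) (gen R .K))
    ?_ ?_ ?_ ?_ adE_mul_adF_sub _ ?_ _
  · rw [sandwich_mul, h.K_Kinv, sandwich_one]
  · rw [sandwich_mul, h.Kinv_K, sandwich_one]
  · have e : gen R .E * gen R .Kinv * gen R .Kinv =
        R.q ^ 2 • (gen R .Kinv * (gen R .E * gen R .Kinv)) := by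
      rw [h.EKinv, smul_mul_assoc, mul_assoc, h.EKinv]
    simp only [adE, sub_mul, mul_sub, sandwich_mul, h.KE, mul_one, one_mul, e, smul_sub,
      sandwich_smul_left, sandwich_smul_right]
  · have e1 : gen R .Kinv * (gen R .K * gen R .F) = gen R .F := by
      rw [← mul_assoc, h.Kinv_K, one_mul]
    have e2 : sandwich ρ σ (gen R .K * gen R .F) (gen R .Kinv) =
        (R.q⁻¹) ^ 2 • sandwich ρ σ (gen R .F * gen R .K) (gen R .Kinv) := by
      rw [h.KF, sandwich_smul_left]
    simp only [adF, sub_mul, mul_sub, sandwich_mul, h.K_F, mul_one, one_mul, e1, e2, smul_sub,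
      sandwich_smul_right, h.K_Kinv, h.Kinv_K]
  · have hs : sandwich ρ σ (gen R .K) 1 k = sandwich ρ σ 1 (gen R .K) k := by
      simpa using hk.hasShift.sandwich_K
    have := congrArg (sandwich ρ σ 1 (gen R .K ^ (R.r - 1) * gen R .Kinv)) hs
    rw [sandwich_sandwich, sandwich_sandwich, one_mul, one_mul, one_mul, ← mul_assoc, K_mul_pow,
      K_pow_mul_Kinv] at this
    rw [sandwich_sandwich, mul_one, this]

end Averaging

end UqSl2

/-! ### Properties of the average: equivariance, trace pairing, tensor products. -/

namespace UqSl2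

open Ubar
open scoped TensorProduct

section AveragingProperties

variable {R : RootData} {V W V' W' : Type*} [AddCommGroup V] [Module ℂ V] [AddCommGroup W]
  [Module ℂ W] [AddCommGroup V'] [Module ℂ V'] [AddCommGroup W'] [Module ℂ W']
variable {ρ : Ubar R →ₐ[ℂ] Module.End ℂ V} {σ : Ubar R →ₐ[ℂ] Module.End ℂ W}
  {ρ' : Ubar R →ₐ[ℂ] Module.End ℂ V'} {σ' : Ubar R →ₐ[ℂ] Module.End ℂ W'}

/-- The sum telescopes: `x · powSum - powSum · x` is `x^r k - k x^r`, which vanishes. -/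
lemma sandwich_powSum {x : Ubar R} (hx : x ^ R.r = 0) (k : V →ₗ[ℂ] W) :
    sandwich ρ σ x 1 (powSum ρ σ x k) = sandwich ρ σ 1 x (powSum ρ σ x k) := by
  have h := (sandwich_commute ρ σ x x).mul_geom_sum₂ R.r
  have h0 : ∀ a : Ubar R, sandwich ρ σ a 0 = 0 := fun a => by ext; simp [sandwich_apply]
  have h0' : ∀ a : Ubar R, sandwich ρ σ 0 a = 0 := fun a => by ext; simp [sandwich_apply]
  rw [sandwich_pow_left, sandwich_pow_right, hx, h0, h0', sub_zero] at h
  have h2 := powSum_eq_geom ρ σ x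
  rw [Nat.sub_add_cancel R.one_lt.le] at h2
  rw [← h2] at h
  have := LinearMap.congr_fun h k
  rwa [Module.End.mul_apply, LinearMap.sub_apply, LinearMap.zero_apply, sub_eq_zero] at this

lemma WeightPreserving.avg {k : V →ₗ[ℂ] W} (hk : WeightPreserving ρ σ k) :
    WeightPreserving ρ σ (avg ρ σ k) := by
  have h := (hk.hasShift.powSum satisfies_gen.KF).powSum satisfies_gen.KE
  rw [q_inv_sq_pow_pred, q_sq_pow_pred, mul_one, mul_comm, R.q_sq_mul_inv] at h
  intro v
  have := LinearMap.congr_fun h v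
  simp only [sandwich_apply, one_smul, map_one, Module.End.one_apply] at this
  exact this.symm

lemma WeightPreserving.Kinv {k : V →ₗ[ℂ] W} (hk : WeightPreserving ρ σ k) (v : V) :
    k (ρ (gen R .Kinv) v) = σ (gen R .Kinv) (k v) := by
  have h := hk.hasShift.sandwich_Kinv one_ne_zero
  have := LinearMap.congr_fun h v
  simp only [sandwich_apply, one_smul, map_one, Module.End.one_apply, inv_one] at this
  exact this.symm

lemma WeightPreserving.K_pow {k : V →ₗ[ℂ] W} (hk : WeightPreserving ρ σ k) (n : ℕ) (v : V) :
    k (ρ (gen R .K ^ n) v) = σ (gen R .K ^ n) (k v) := by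
  induction n generalizing v with
  | zero => simp
  | succ n ih => rw [pow_succ, map_mul, map_mul, Module.End.mul_apply, Module.End.mul_apply, ih, hk]

lemma WeightPreserving.Kinv_pow {k : V →ₗ[ℂ] W} (hk : WeightPreserving ρ σ k) (n : ℕ) (v : V) :
    k (ρ (gen R .Kinv ^ n) v) = σ (gen R .Kinv ^ n) (k v) := by
  induction n generalizing v with
  | zero => simp
  | succ n ih =>
    rw [pow_succ, map_mul, map_mul, Module.End.mul_apply, Module.End.mul_apply, ih, hk.Kinv]

lemma WeightPreserving.piv {k : V →ₗ[ℂ] W} (hk : WeightPreserving ρ σ k) (v : V) :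
    k (piv ρ v) = piv σ (k v) := hk.K_pow _ v

lemma WeightPreserving.pivInv {k : V →ₗ[ℂ] W} (hk : WeightPreserving ρ σ k) (v : V) :
    k (pivInv ρ v) = pivInv σ (k v) := hk.Kinv_pow _ v

/-- The average of a weight preserving map is a morphism of representations. -/
lemma WeightPreserving.equivariant_avg {k : V →ₗ[ℂ] W} (hk : WeightPreserving ρ σ k) :
    Equivariant ρ σ (UqSl2.avg ρ σ k) := by
  intro g v
  cases g
  · have := LinearMap.congr_fun (sandwich_powSum (ρ := ρ) (σ := σ) satisfies_gen.E_pow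
      (powSum ρ σ (gen R .F) k)) v
    simp only [sandwich_apply, map_one, Module.End.one_apply] at this
    exact this.symm
  · have := LinearMap.congr_fun (sandwich_powSum (ρ := ρ) (σ := σ) satisfies_gen.F_pow
      (powSum ρ σ (gen R .E) k)) v
    -- `E` is the outer sum in `avg`, so it commutes directly; for `F` the opposite order is
    -- required.
    rw [← avg_eq_powSum_F_powSum_E hk] at this
    simp only [sandwich_apply, map_one, Module.End.one_apply] at this
    exact this.symm
  · exact hk.avg v
  · exact hk.avg.Kinv v

lemma powSum_comp (f : W →ₗ[ℂ] W') (hf : ∀ x v, f (σ x v) = σ' x (f v)) (g : V' →ₗ[ℂ] V)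
    (hg : ∀ x v, g (ρ' x v) = ρ x (g v)) (x : Ubar R) (k : V →ₗ[ℂ] W) :
    powSum ρ' σ' x (f ∘ₗ k ∘ₗ g) = f ∘ₗ powSum ρ σ x k ∘ₗ g := by
  ext v
  simp only [powSum, LinearMap.sum_apply, sandwich_apply, hf, hg, LinearMap.comp_apply, map_sum]

lemma avg_comp (f : W →ₗ[ℂ] W') (hf : ∀ x v, f (σ x v) = σ' x (f v)) (g : V' →ₗ[ℂ] V)
    (hg : ∀ x v, g (ρ' x v) = ρ x (g v)) (k : V →ₗ[ℂ] W) :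
    avg ρ' σ' (f ∘ₗ k ∘ₗ g) = f ∘ₗ avg ρ σ k ∘ₗ g := by
  rw [avg, Module.End.mul_apply, powSum_comp f hf g hg, powSum_comp f hf g hg]
  rfl

lemma avg_comp_left (f : W →ₗ[ℂ] W') (hf : ∀ x v, f (σ x v) = σ' x (f v)) (k : V →ₗ[ℂ] W) :
    avg ρ σ' (f ∘ₗ k) = f ∘ₗ avg ρ σ k :=
  avg_comp (ρ' := ρ) f hf LinearMap.id (fun _ _ => rfl) k

lemma avg_comp_right (g : V' →ₗ[ℂ] V) (hg : ∀ x v, g (ρ' x v) = ρ x (g v)) (k : V →ₗ[ℂ] W) :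
    avg ρ' σ (k ∘ₗ g) = avg ρ σ k ∘ₗ g :=
  avg_comp (σ' := σ) LinearMap.id (fun _ _ => rfl) g hg k

section Trace

variable [Module.Finite ℂ W]

/-- Cyclicity of the trace exchanges the powers on the two sides of `m`, and `a ↦ r - 1 - a`
restores their names. -/
lemma trace_powSum_comp (x : Ubar R) (m : V →ₗ[ℂ] W) (n : W →ₗ[ℂ] V) :
    LinearMap.trace ℂ W (powSum ρ σ x m ∘ₗ n) = LinearMap.trace ℂ W (m ∘ₗ powSum σ ρ x n) := by
  have e1 : powSum ρ σ x m ∘ₗ n = ∑ a ∈ Finset.range R.r,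
      σ (x ^ a) ∘ₗ (m ∘ₗ ρ (x ^ (R.r - 1 - a)) ∘ₗ n) := by
    ext v; simp [powSum, LinearMap.sum_apply, sandwich_apply]
  have e2 : m ∘ₗ powSum σ ρ x n = ∑ a ∈ Finset.range R.r,
      (m ∘ₗ ρ (x ^ a) ∘ₗ n) ∘ₗ σ (x ^ (R.r - 1 - a)) := by
    ext v; simp [powSum, LinearMap.sum_apply, sandwich_apply]
  rw [e1, e2, map_sum, map_sum, ← Finset.sum_range_reflect]
  refine Finset.sum_congr rfl fun a ha => ?_
  have := Finset.mem_range.1 ha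
  rw [LinearMap.trace_comp_comm', show R.r - 1 - (R.r - 1 - a) = a by omega]

/-- Averaging is self-adjoint for the trace pairing. -/
lemma trace_avg_comp (m : V →ₗ[ℂ] W) {n : W →ₗ[ℂ] V} (hn : WeightPreserving σ ρ n) :
    LinearMap.trace ℂ W (avg ρ σ m ∘ₗ n) = LinearMap.trace ℂ W (m ∘ₗ avg σ ρ n) := by
  -- Carrying the two sums across the trace reverses their order, which is harmless on `n`.
  rw [avg_eq_powSum_F_powSum_E hn, avg, Module.End.mul_apply, trace_powSum_comp,
    trace_powSum_comp]

end Trace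

section Tensor

lemma WeightPreserving.comp {U : Type*} [AddCommGroup U] [Module ℂ U]
    {τ : Ubar R →ₐ[ℂ] Module.End ℂ U} {l : W →ₗ[ℂ] U} {k : V →ₗ[ℂ] W}
    (hl : WeightPreserving σ τ l) (hk : WeightPreserving ρ σ k) :
    WeightPreserving ρ τ (l ∘ₗ k) := fun v => by
  rw [LinearMap.comp_apply, hk, hl, LinearMap.comp_apply]

lemma WeightPreserving.map {m : V →ₗ[ℂ] W} {t : V' →ₗ[ℂ] W'} (hm : WeightPreserving ρ σ m)
    (ht : WeightPreserving ρ' σ' t) :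
    WeightPreserving (tensorRep ρ ρ') (tensorRep σ σ') (TensorProduct.map m t) := by
  intro v
  induction v using TensorProduct.induction_on with
  | zero => simp
  | add a b ha hb => simp only [map_add, ha, hb]
  | tmul a b => rw [tensorRep_K, TensorProduct.map_tmul, TensorProduct.map_tmul, tensorRep_K, hm, ht]

lemma weightPreserving_piv : WeightPreserving ρ ρ (piv ρ) := fun v => by
  rw [piv, ← Module.End.mul_apply, ← Module.End.mul_apply, ← map_mul, ← map_mul, ← pow_succ,
    ← pow_succ']

lemma weightPreserving_pivInv : WeightPreserving ρ ρ (pivInv ρ) := fun v => by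
  have hc : Commute (gen R .Kinv) (gen R .K) :=
    satisfies_gen.Kinv_K.trans satisfies_gen.K_Kinv.symm
  rw [pivInv, ← Module.End.mul_apply, ← Module.End.mul_apply, ← map_mul, ← map_mul,
    (hc.pow_left _).eq]

lemma weightPreserving_of_comm {k : V →ₗ[ℂ] W} (h : ∀ x v, k (ρ x v) = σ x (k v)) :
    WeightPreserving ρ σ k := h _

lemma rep_K_Kinv (v : V) : ρ (gen R .K) (ρ (gen R .Kinv) v) = v := by
  rw [← Module.End.mul_apply, ← map_mul, satisfies_gen.K_Kinv, map_one, Module.End.one_apply]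

lemma rep_Kinv_K (v : V) : ρ (gen R .Kinv) (ρ (gen R .K) v) = v := by
  rw [← Module.End.mul_apply, ← map_mul, satisfies_gen.Kinv_K, map_one, Module.End.one_apply]

/-- On `m ⊗ t` the adjoint action reads `a₁ m S(a₄) ⊗ a₂ t S(a₃)`. Since `t` is equivariant, the
second factor collapses to the counit. -/
lemma adE_map (m : V →ₗ[ℂ] W) (t : V' →ₗ[ℂ] W') (ht : ∀ x v, t (ρ' x v) = σ' x (t v)) :
    adE (tensorRep ρ ρ') (tensorRep σ σ') (TensorProduct.map m t) =
      TensorProduct.map (adE ρ σ m) t := by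
  refine TensorProduct.ext' fun v v' => ?_
  simp only [adE, LinearMap.sub_apply, sandwich_apply, TensorProduct.map_tmul, map_one,
    Module.End.one_apply, map_mul, Module.End.mul_apply, tensorRep_Kinv, tensorRep_E, map_add, ht,
    rep_K_Kinv, TensorProduct.sub_tmul]
  abel

lemma adF_map (m : V →ₗ[ℂ] W) (t : V' →ₗ[ℂ] W') (ht : ∀ x v, t (ρ' x v) = σ' x (t v)) :
    adF (tensorRep ρ ρ') (tensorRep σ σ') (TensorProduct.map m t) =
      TensorProduct.map (adF ρ σ m) t := by
  refine TensorProduct.ext' fun v v' => ?_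
  simp only [adF, LinearMap.sub_apply, sandwich_apply, TensorProduct.map_tmul, map_one,
    Module.End.one_apply, map_mul, Module.End.mul_apply, tensorRep_Kinv, tensorRep_F,
    tensorRep_K, map_add, ht, rep_K_Kinv, rep_Kinv_K, TensorProduct.sub_tmul]
  abel

/-- For the right action the inner terms fall on the first factor, `a₃ t S⁻¹(a₂) ⊗ a₄ m S⁻¹(a₁)`, so
it is now the left tensor factor that must be equivariant. -/
lemma adE'_map (t : V →ₗ[ℂ] W) (m : V' →ₗ[ℂ] W') (ht : ∀ x v, t (ρ x v) = σ x (t v)) :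
    adE' (tensorRep ρ ρ') (tensorRep σ σ') (TensorProduct.map t m) =
      TensorProduct.map t (adE' ρ' σ' m) := by
  refine TensorProduct.ext' fun v v' => ?_
  simp only [adE', LinearMap.sub_apply, sandwich_apply, TensorProduct.map_tmul, map_one,
    Module.End.one_apply, map_mul, Module.End.mul_apply, tensorRep_Kinv, tensorRep_E,
    tensorRep_K, map_add, ht, rep_K_Kinv, rep_Kinv_K, TensorProduct.tmul_sub]
  abel

lemma adF'_map (t : V →ₗ[ℂ] W) (m : V' →ₗ[ℂ] W') (ht : ∀ x v, t (ρ x v) = σ x (t v)) :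
    adF' (tensorRep ρ ρ') (tensorRep σ σ') (TensorProduct.map t m) =
      TensorProduct.map t (adF' ρ' σ' m) := by
  refine TensorProduct.ext' fun v v' => ?_
  simp only [adF', LinearMap.sub_apply, sandwich_apply, TensorProduct.map_tmul, map_one,
    Module.End.one_apply, map_mul, Module.End.mul_apply, tensorRep_K, tensorRep_F,
    map_add, ht, rep_Kinv_K, TensorProduct.tmul_sub]
  abel

lemma tensorRep_K_pow (n : ℕ) (v : V) (v' : V') : tensorRep ρ ρ' (gen R .K ^ n) (v ⊗ₜ v') =
    ρ (gen R .K ^ n) v ⊗ₜ ρ' (gen R .K ^ n) v' := by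
  induction n with
  | zero => simp
  | succ n ih =>
    rw [pow_succ', map_mul, Module.End.mul_apply, ih, tensorRep_K, map_mul, map_mul,
      Module.End.mul_apply, Module.End.mul_apply]

lemma tensorRep_Kinv_pow (n : ℕ) (v : V) (v' : V') :
    tensorRep ρ ρ' (gen R .Kinv ^ n) (v ⊗ₜ v') =
      ρ (gen R .Kinv ^ n) v ⊗ₜ ρ' (gen R .Kinv ^ n) v' := by
  induction n with
  | zero => simp
  | succ n ih =>
    rw [pow_succ', map_mul, Module.End.mul_apply, ih, tensorRep_Kinv, map_mul, map_mul,
      Module.End.mul_apply, Module.End.mul_apply]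

/-- The twist by `K^(r-1)` in `avg_eq_adE_adF` cancels `K^(1-r)` on the second factor and leaves `m
K^(r-1) ⊗ t`, on which the adjoint action touches only the first factor. -/
lemma avg_map_left {m : V →ₗ[ℂ] W} (hm : WeightPreserving ρ σ m) (t : V' →ₗ[ℂ] W')
    (ht : ∀ x v, t (ρ' x v) = σ' x (t v)) :
    avg (tensorRep ρ ρ') (tensorRep σ σ') (TensorProduct.map m (t ∘ₗ pivInv ρ')) =
      TensorProduct.map (avg ρ σ m) t := by
  have hE : ∀ (n : ℕ) (m : V →ₗ[ℂ] W), (adE (tensorRep ρ ρ') (tensorRep σ σ') ^ n)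
      (TensorProduct.map m t) = TensorProduct.map ((adE ρ σ ^ n) m) t := by
    intro n m
    induction n with
    | zero => rfl
    | succ n ih => rw [pow_succ', Module.End.mul_apply, ih, adE_map _ _ ht, pow_succ']; rfl
  have hF : ∀ (n : ℕ) (m : V →ₗ[ℂ] W), (adF (tensorRep ρ ρ') (tensorRep σ σ') ^ n)
      (TensorProduct.map m t) = TensorProduct.map ((adF ρ σ ^ n) m) t := by
    intro n m
    induction n with
    | zero => rfl
    | succ n ih => rw [pow_succ', Module.End.mul_apply, ih, adF_map _ _ ht, pow_succ']; rfl
  rw [avg_eq_adE_adF hm,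
    avg_eq_adE_adF (hm.map ((weightPreserving_of_comm ht).comp weightPreserving_pivInv)),
    ← hE, ← hF]
  congr 2
  refine TensorProduct.ext' fun v v' => ?_
  rw [sandwich_apply, tensorRep_K_pow]
  simp only [map_one, Module.End.one_apply, TensorProduct.map_tmul, LinearMap.comp_apply,
    sandwich_apply]
  congr 2
  exact pivInv_piv ρ' v'

/-- The mirror image: the right adjoint action twists by `K^(1-r)`, which cancels `K^(r-1)` on the
first factor. -/
lemma avg_map_right (t : V →ₗ[ℂ] W) (ht : ∀ x v, t (ρ x v) = σ x (t v)) {m : V' →ₗ[ℂ] W'}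
    (hm : WeightPreserving ρ' σ' m) :
    avg (tensorRep ρ ρ') (tensorRep σ σ') (TensorProduct.map (t ∘ₗ piv ρ) m) =
      TensorProduct.map t (avg ρ' σ' m) := by
  have hE : ∀ (n : ℕ) (m : V' →ₗ[ℂ] W'), (adE' (tensorRep ρ ρ') (tensorRep σ σ') ^ n)
      (TensorProduct.map t m) = TensorProduct.map t ((adE' ρ' σ' ^ n) m) := by
    intro n m
    induction n with
    | zero => rfl
    | succ n ih => rw [pow_succ', Module.End.mul_apply, ih, adE'_map _ _ ht, pow_succ']; rfl
  have hF : ∀ (n : ℕ) (m : V' →ₗ[ℂ] W'), (adF' (tensorRep ρ ρ') (tensorRep σ σ') ^ n)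
      (TensorProduct.map t m) = TensorProduct.map t ((adF' ρ' σ' ^ n) m) := by
    intro n m
    induction n with
    | zero => rfl
    | succ n ih => rw [pow_succ', Module.End.mul_apply, ih, adF'_map _ _ ht, pow_succ']; rfl
  rw [avg_eq_adE'_adF' hm,
    avg_eq_adE'_adF' (((weightPreserving_of_comm ht).comp weightPreserving_piv).map hm),
    ← hE, ← hF]
  congr 2
  refine TensorProduct.ext' fun v v' => ?_
  rw [sandwich_apply, tensorRep_Kinv_pow]
  simp only [map_one, Module.End.one_apply, TensorProduct.map_tmul, LinearMap.comp_apply,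
    sandwich_apply]
  congr 2
  exact piv_pivInv ρ v

end Tensor

end AveragingProperties

end UqSl2

/-! ### Partial traces -/

namespace UqSl2

open Ubar
open scoped TensorProduct

section PartialTraceLinear

variable {V V' W W' : Type*} [AddCommGroup V] [Module ℂ V] [Module.Finite ℂ V] [AddCommGroup V']
  [Module ℂ V'] [Module.Finite ℂ V'] [AddCommGroup W] [Module ℂ W] [AddCommGroup W'] [Module ℂ W']

lemma trace_eq_sum_repr {ι U : Type*} [Fintype ι] [AddCommGroup U] [Module ℂ U]
    (e : Module.Basis ι ℂ U) (f : U →ₗ[ℂ] U) :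
    LinearMap.trace ℂ U f = ∑ i, e.repr (f (e i)) i := by
  classical
  rw [LinearMap.trace_eq_matrix_trace ℂ e, Matrix.trace]
  simp [LinearMap.toMatrix_apply]

/-- The trace is taken over `V'` first; `p` is the partial trace of `G` weighted by `c`. -/
lemma trace_map_comp_right (m : W →ₗ[ℂ] V) (c : V' →ₗ[ℂ] V')
    (G : V ⊗[ℂ] V' →ₗ[ℂ] W ⊗[ℂ] V') (p : V →ₗ[ℂ] W)
    (hp : ∀ v, p v = ∑ j, TensorProduct.rid ℂ W (TensorProduct.map LinearMap.id
      ((Module.Basis.ofVectorSpace ℂ V').coord j ∘ₗ c)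
        (G (v ⊗ₜ Module.Basis.ofVectorSpace ℂ V' j)))) :
    LinearMap.trace ℂ _ (TensorProduct.map m c ∘ₗ G) = LinearMap.trace ℂ V (m ∘ₗ p) := by
  rw [trace_eq_sum_repr ((Module.Basis.ofVectorSpace ℂ V).tensorProduct
    (Module.Basis.ofVectorSpace ℂ V')), trace_eq_sum_repr (Module.Basis.ofVectorSpace ℂ V),
    Fintype.sum_prod_type]
  refine Finset.sum_congr rfl fun i _ => ?_
  rw [LinearMap.comp_apply, hp, map_sum, map_sum, Finset.sum_apply']
  refine Finset.sum_congr rfl fun j _ => ?_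
  rw [LinearMap.comp_apply, Module.Basis.tensorProduct_apply]
  induction G (Module.Basis.ofVectorSpace ℂ V i ⊗ₜ Module.Basis.ofVectorSpace ℂ V' j) using
    TensorProduct.induction_on with
  | zero => simp
  | add a b ha hb => simp only [map_add, Finsupp.add_apply, ha, hb]
  | tmul a b => simp [Module.Basis.tensorProduct_repr_tmul_apply]

lemma trace_map_comp_left (m : W' →ₗ[ℂ] V') (c : V →ₗ[ℂ] V)
    (G : V ⊗[ℂ] V' →ₗ[ℂ] V ⊗[ℂ] W') (p : V' →ₗ[ℂ] W')
    (hp : ∀ v, p v = ∑ j, TensorProduct.lid ℂ W' (TensorProduct.map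
      ((Module.Basis.ofVectorSpace ℂ V).coord j) LinearMap.id
        (G (c (Module.Basis.ofVectorSpace ℂ V j) ⊗ₜ v)))) :
    LinearMap.trace ℂ _ (TensorProduct.map c m ∘ₗ G) = LinearMap.trace ℂ V' (m ∘ₗ p) := by
  have e : TensorProduct.map c m ∘ₗ G =
      TensorProduct.map c LinearMap.id ∘ₗ (TensorProduct.map LinearMap.id m ∘ₗ G) := by
    rw [← LinearMap.comp_assoc, ← TensorProduct.map_comp, LinearMap.comp_id, LinearMap.id_comp]
  -- By cyclicity `c` moves to the input of `G`, where the left partial trace through `b'` has its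
  -- pivot.
  rw [e, LinearMap.trace_comp_comm', trace_eq_sum_repr ((Module.Basis.ofVectorSpace ℂ V).tensorProduct
    (Module.Basis.ofVectorSpace ℂ V')), trace_eq_sum_repr (Module.Basis.ofVectorSpace ℂ V'),
    Fintype.sum_prod_type_right]
  refine Finset.sum_congr rfl fun i _ => ?_
  rw [LinearMap.comp_apply, hp, map_sum, map_sum, Finset.sum_apply']
  refine Finset.sum_congr rfl fun j _ => ?_
  rw [LinearMap.comp_apply, LinearMap.comp_apply, Module.Basis.tensorProduct_apply,
    TensorProduct.map_tmul, LinearMap.id_apply]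
  induction G (c (Module.Basis.ofVectorSpace ℂ V j) ⊗ₜ Module.Basis.ofVectorSpace ℂ V' i) using
    TensorProduct.induction_on with
  | zero => simp
  | add a b ha hb => simp only [map_add, Finsupp.add_apply, ha, hb]
  | tmul a b => simp [Module.Basis.tensorProduct_repr_tmul_apply, mul_comm]

end PartialTraceLinear

namespace WeightModule

variable {R : RootData}

/-- Linear maps between weight modules. -/
abbrev Lin (X Y : WeightModule R) : Type := X.carrier →ₗ[ℂ] Y.carrier

/-- The tensor product of linear maps between weight modules. -/
def Lin.tmap {X Y X' Y' : WeightModule R} (m : Lin X Y) (m' : Lin X' Y') :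
    Lin (X ⊗ X') (Y ⊗ Y') := TensorProduct.map m m'

/-- Commutation with `K`. -/
def Lin.WP {X Y : WeightModule R} (m : Lin X Y) : Prop := WeightPreserving X.ρ Y.ρ m

/-- The average of a linear map between weight modules. -/
def Lin.avg {X Y : WeightModule R} (m : Lin X Y) : Lin X Y := UqSl2.avg X.ρ Y.ρ m

/-- The trace pairing of a linear map with a morphism in the other direction. -/
noncomputable def Lin.pairing {X Y : WeightModule R} (m : Lin X Y) (f : Y ⟶ X) : ℂ :=
  LinearMap.trace ℂ Y.carrier (m ∘ₗ f.toLin)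

/-- The action of `K^(r-1)`. -/
def pivot (X : WeightModule R) : Lin X X := piv X.ρ

/-- The action of `K^(1-r)`. -/
def pivotInv (X : WeightModule R) : Lin X X := pivInv X.ρ

section

variable {X Y Z X' Y' : WeightModule R}

lemma wp_hom (f : X ⟶ Y) : Lin.WP f.toLin := weightPreserving_of_comm f.comm

lemma wp_pivot : X.pivot.WP := weightPreserving_piv

lemma wp_pivotInv : X.pivotInv.WP := weightPreserving_pivInv

lemma Lin.WP.comp {l : Lin Y Z} {k : Lin X Y} (hl : l.WP) (hk : k.WP) :
    Lin.WP (l ∘ₗ k : Lin X Z) := WeightPreserving.comp hl hk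

lemma Lin.WP.tmap {m : Lin X Y} {m' : Lin X' Y'} (h : m.WP) (h' : m'.WP) : (m.tmap m').WP :=
  WeightPreserving.map h h'

lemma avg_hom_comp (f : Y ⟶ Z) (m : Lin X Y) :
    Lin.avg (f.toLin ∘ₗ m : Lin X Z) = f.toLin ∘ₗ m.avg := avg_comp_left _ f.comm m

lemma avg_comp_hom (m : Lin Y Z) (f : X ⟶ Y) :
    Lin.avg (m ∘ₗ f.toLin : Lin X Z) = m.avg ∘ₗ f.toLin := avg_comp_right _ f.comm m

lemma avg_tmap_left {m : Lin X Y} (hm : m.WP) (t : X' ⟶ Y') :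
    Lin.avg (m.tmap (t.toLin ∘ₗ X'.pivotInv)) = m.avg.tmap t.toLin := avg_map_left hm _ t.comm

lemma avg_tmap_right (t : X ⟶ Y) {m : Lin X' Y'} (hm : m.WP) :
    Lin.avg (Lin.tmap (t.toLin ∘ₗ X.pivot : Lin X Y) m) = Lin.tmap t.toLin m.avg :=
  avg_map_right _ t.comm hm

lemma trace_avg (m : Lin X Y) {n : Lin Y X} (hn : n.WP) :
    LinearMap.trace ℂ Y.carrier (m.avg ∘ₗ n) = LinearMap.trace ℂ Y.carrier (m ∘ₗ n.avg) :=
  trace_avg_comp m hn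

lemma pairing_hom_comp (m : Lin X Y) (t : Y ⟶ Z) (f : Z ⟶ X) :
    Lin.pairing (t.toLin ∘ₗ m : Lin X Z) f = m.pairing (t ≫ f) := by
  rw [Lin.pairing, Lin.pairing, LinearMap.comp_assoc, LinearMap.trace_comp_comm']
  rfl

lemma pairing_comp_hom (s : X ⟶ Y) (m : Lin Y Z) (f : Z ⟶ X) :
    Lin.pairing (m ∘ₗ s.toLin : Lin X Z) f = m.pairing (f ≫ s) := rfl

/-- The right partial trace of `f` composed with `t`. -/
noncomputable def ptrRight (f : Y ⊗ Y' ⟶ X ⊗ X') (t : X' ⟶ Y') : Y ⟶ X :=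
  (ρ_ Y).inv ≫ Y ◁ Pivotal.b Y' ≫ (α_ _ _ _).inv ≫ (f ≫ X ◁ t) ▷ Pivotal.dual Y' ≫
    (α_ _ _ _).hom ≫ X ◁ Pivotal.d' Y' ≫ (ρ_ X).hom

/-- The left partial trace of `f` composed with `s`. -/
noncomputable def ptrLeft (f : Y ⊗ Y' ⟶ X ⊗ X') (s : X ⟶ Y) : Y' ⟶ X' :=
  (λ_ Y').inv ≫ Pivotal.b' Y ▷ Y' ≫ (α_ _ _ _).hom ≫ Pivotal.dual Y ◁ (f ≫ s ▷ X') ≫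
    (α_ _ _ _).inv ≫ Pivotal.d Y ▷ X' ≫ (λ_ X').hom

/-- The correction `K^(1-r)` on the second factor is the one contained in `d'`, so the ordinary
trace over that factor is the partial trace in the category. -/
lemma pairing_tmap_left (m : Lin X Y) (t : X' ⟶ Y') (f : Y ⊗ Y' ⟶ X ⊗ X') :
    Lin.pairing (m.tmap (t.toLin ∘ₗ X'.pivotInv)) f = m.pairing (ptrRight f t) := by
  have e : m.tmap (t.toLin ∘ₗ X'.pivotInv) ∘ₗ f.toLin =
      TensorProduct.map m (pivInv Y'.ρ) ∘ₗ
        (show Y.carrier ⊗[ℂ] Y'.carrier →ₗ[ℂ] X.carrier ⊗[ℂ] Y'.carrier from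
          (f ≫ X ◁ t).toLin) := by
    have : m.tmap (t.toLin ∘ₗ X'.pivotInv) =
        TensorProduct.map m (pivInv Y'.ρ) ∘ₗ TensorProduct.map LinearMap.id t.toLin := by
      refine TensorProduct.ext' fun x x' => ?_
      exact congrArg (fun z => m x ⊗ₜ[ℂ] z) (pivInv_comm t x')
    rw [this]
    rfl
  rw [Lin.pairing, Lin.pairing, e]
  refine trace_map_comp_right m (pivInv Y'.ρ) _ _ fun v => ?_
  set G := (show Y.carrier ⊗[ℂ] Y'.carrier →ₗ[ℂ] X.carrier ⊗[ℂ] Y'.carrier from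
    (f ≫ X ◁ t).toLin)
  have h : (ptrRight f t).toLin v = TensorProduct.rid ℂ _ (TensorProduct.map LinearMap.id
      (evR Y'.ρ) (TensorProduct.assoc ℂ _ _ _ (TensorProduct.map G LinearMap.id
        ((TensorProduct.assoc ℂ _ _ _).symm (v ⊗ₜ coevL 1))))) := rfl
  rw [h, coevL_one, TensorProduct.tmul_sum, map_sum, map_sum, map_sum, map_sum, map_sum]
  refine Finset.sum_congr rfl fun j _ => ?_
  rw [TensorProduct.assoc_symm_tmul, TensorProduct.map_tmul]
  induction G (v ⊗ₜ Module.Basis.ofVectorSpace ℂ Y'.carrier j) using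
    TensorProduct.induction_on with
  | zero => simp
  | add a b ha hb => simp only [map_add, TensorProduct.add_tmul, ha, hb]
  | tmul a b => simp

/-- The correction `K^(r-1)` on the first factor is the one contained in `b'`. -/
lemma pairing_tmap_right (s : X ⟶ Y) (m : Lin X' Y') (f : Y ⊗ Y' ⟶ X ⊗ X') :
    Lin.pairing (Lin.tmap (s.toLin ∘ₗ X.pivot : Lin X Y) m) f = m.pairing (ptrLeft f s) := by
  have e : Lin.tmap (s.toLin ∘ₗ X.pivot : Lin X Y) m ∘ₗ f.toLin =
      TensorProduct.map (piv Y.ρ) m ∘ₗ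
        (show Y.carrier ⊗[ℂ] Y'.carrier →ₗ[ℂ] Y.carrier ⊗[ℂ] X'.carrier from
          (f ≫ s ▷ X').toLin) := by
    have : Lin.tmap (s.toLin ∘ₗ X.pivot : Lin X Y) m =
        TensorProduct.map (piv Y.ρ) m ∘ₗ TensorProduct.map s.toLin LinearMap.id := by
      refine TensorProduct.ext' fun x x' => ?_
      exact congrArg (fun z => z ⊗ₜ[ℂ] m x') (piv_comm s x)
    rw [this]
    rfl
  rw [Lin.pairing, Lin.pairing, e]
  refine trace_map_comp_left m (piv Y.ρ) _ _ fun v => ?_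
  set G := (show Y.carrier ⊗[ℂ] Y'.carrier →ₗ[ℂ] Y.carrier ⊗[ℂ] X'.carrier from
    (f ≫ s ▷ X').toLin)
  have h : (ptrLeft f s).toLin v = TensorProduct.lid ℂ _ (TensorProduct.map evL LinearMap.id
      ((TensorProduct.assoc ℂ _ _ _).symm (TensorProduct.map LinearMap.id G
        (TensorProduct.assoc ℂ _ _ _ (coevR Y.ρ 1 ⊗ₜ v))))) := rfl
  rw [h, coevR_one, TensorProduct.sum_tmul, map_sum, map_sum, map_sum, map_sum, map_sum]
  refine Finset.sum_congr rfl fun j _ => ?_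
  rw [TensorProduct.assoc_tmul, TensorProduct.map_tmul]
  induction G (piv Y.ρ (Module.Basis.ofVectorSpace ℂ Y.carrier j) ⊗ₜ v) using
    TensorProduct.induction_on with
  | zero => simp
  | add a b ha hb => simp only [map_add, TensorProduct.tmul_add, ha, hb]
  | tmul a b => simp

end

end WeightModule

end UqSl2

/-! ### Relatively projective modules and marked diagrams -/

namespace UqSl2

open Ubar Pivotal
open scoped TensorProduct

namespace WeightModule

variable {R : RootData}

/-- The identity of `X` is the average of a weight preserving linear map. -/
def IsProj (X : WeightModule R) : Prop := ∃ k : Lin X X, k.WP ∧ k.avg = LinearMap.id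

section

variable {X Y Z X' Y' : WeightModule R}

lemma avg_tmap_id_left {k : Lin X Y} (hk : k.WP) :
    (k.tmap Z.pivotInv).avg = k.avg.tmap (LinearMap.id : Lin Z Z) :=
  avg_tmap_left hk (𝟙 Z)

lemma avg_tmap_id_right {k : Lin Y Y} (hk : k.WP) :
    (Lin.tmap X.pivot k).avg = Lin.tmap (LinearMap.id : Lin X X) k.avg :=
  avg_tmap_right (𝟙 X) hk

/-- If `avg k = id`, then `k ⊗ K^(1-r)` averages to the identity of the tensor product. -/
lemma IsProj.tensor_left (h : IsProj X) (Y : WeightModule R) : IsProj (X ⊗ Y) := by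
  obtain ⟨k, hk, h⟩ := h
  refine ⟨k.tmap Y.pivotInv, hk.tmap wp_pivotInv, ?_⟩
  rw [avg_tmap_id_left hk, h]
  exact TensorProduct.map_id

lemma IsProj.tensor_right (X : WeightModule R) (h : IsProj Y) : IsProj (X ⊗ Y) := by
  obtain ⟨k, hk, h⟩ := h
  refine ⟨Lin.tmap X.pivot k, wp_pivot.tmap hk, ?_⟩
  rw [avg_tmap_id_right hk, h]
  exact TensorProduct.map_id

/-- Write the identity of the projective end as `avg k`, insert it in the trace, and move the
average from `k` to the other factor: the pairing becomes an expression in `avg m` alone. -/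
lemma pairing_eq_of_avg_eq {m m' : Lin X Y} (hm : m.WP) (hm' : m'.WP) (h : m.avg = m'.avg)
    (hp : IsProj X ∨ IsProj Y) (f : Y ⟶ X) : m.pairing f = m'.pairing f := by
  rcases hp with ⟨k, hk, hk1⟩ | ⟨k, hk, hk1⟩
  · have key : ∀ m : Lin X Y, m.WP → m.pairing f =
        LinearMap.trace ℂ X.carrier (k ∘ₗ f.toLin ∘ₗ m.avg) := by
      intro m hm
      rw [Lin.pairing, LinearMap.trace_comp_comm', ← LinearMap.id_comp (f.toLin ∘ₗ m), ← hk1,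
        trace_avg _ ((wp_hom f).comp hm), avg_hom_comp]
    rw [key m hm, key m' hm', h]
  · have key : ∀ m : Lin X Y, m.WP → m.pairing f =
        LinearMap.trace ℂ Y.carrier (k ∘ₗ m.avg ∘ₗ f.toLin) := by
      intro m hm
      rw [Lin.pairing, ← LinearMap.id_comp (m ∘ₗ f.toLin), ← hk1,
        trace_avg _ (hm.comp (wp_hom f)), avg_comp_hom]
    rw [key m hm, key m' hm', h]

/-- Two marks at successive places of a composition. -/
lemma pairing_comp_eq {m : Lin X Y} {n : Lin Y Z} (hm : m.WP) {s : X ⟶ Y} {t : Y ⟶ Z}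
    (hs : m.avg = s.toLin) (ht : n.avg = t.toLin) (f : Z ⟶ X) :
    Lin.pairing (t.toLin ∘ₗ m : Lin X Z) f = Lin.pairing (n ∘ₗ s.toLin : Lin X Z) f := by
  -- Here `tr (avg n ∘ m ∘ f) = tr (n ∘ avg (m ∘ f)) = tr (n ∘ avg m ∘ f)`.
  rw [Lin.pairing, Lin.pairing, ← ht, ← hs, LinearMap.comp_assoc,
    trace_avg n (hm.comp (wp_hom f)), avg_comp_hom, LinearMap.comp_assoc]

/-- Two marks at neighbouring places of a tensor product. -/
lemma pairing_tmap_eq {m : Lin X Y} {n : Lin X' Y'} (hm : m.WP) (hn : n.WP) {s : X ⟶ Y}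
    {t : X' ⟶ Y'} (hs : m.avg = s.toLin) (ht : n.avg = t.toLin) (f : Y ⊗ Y' ⟶ X ⊗ X') :
    (m.tmap (t.toLin ∘ₗ X'.pivotInv)).pairing f =
      (Lin.tmap (s.toLin ∘ₗ X.pivot : Lin X Y) n).pairing f := by
  -- Both marks are the composite of `m ⊗ K^(1-r)` after `K^(r-1) ⊗ n` with one of the two averaged;
  -- self-adjointness moves the average to the other.
  have e1 : m.tmap (t.toLin ∘ₗ X'.pivotInv) =
      m.tmap Y'.pivotInv ∘ₗ (Lin.tmap X.pivot n).avg := by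
    rw [show (Lin.tmap X.pivot n).avg = Lin.tmap (LinearMap.id : Lin X X) n.avg from
      avg_tmap_right (𝟙 X) hn, ht]
    refine TensorProduct.ext' fun x x' => ?_
    exact congrArg (fun z => m x ⊗ₜ[ℂ] z) (pivInv_comm t x')
  have e2 : Lin.tmap (s.toLin ∘ₗ X.pivot : Lin X Y) n =
      (m.tmap Y'.pivotInv).avg ∘ₗ Lin.tmap X.pivot n := by
    rw [avg_tmap_id_left hm, hs]
    exact TensorProduct.ext' fun x x' => rfl
  rw [Lin.pairing, Lin.pairing, e1, e2, LinearMap.comp_assoc, LinearMap.comp_assoc,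
    trace_avg _ ((wp_pivot.tmap hn).comp (wp_hom f)), avg_comp_hom]

end

end WeightModule

open WeightModule

variable {R : RootData}

/-- A strand of the word has a color in `P`. -/
def Meets (P : Set (WeightModule R)) (X : Word (WeightModule R)) : Prop := ∃ V ∈ P, V ∈ X.colors

/-- The evaluations of a diagram after the insertion, at one strand with color in `P`, of a weight
preserving map whose average is the identity. The other pieces on the same level are corrected by
the pivot. -/
inductive Mark (P : Set (WeightModule R)) : {X Y : Word (WeightModule R)} → Diagram X Y →
    Lin X.obj Y.obj → Prop
  | base {X Y : Word (WeightModule R)} {D : Diagram X Y} {m : Lin X.obj Y.obj}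
      (h : Meets P X ∨ Meets P Y) (hm : m.WP) (havg : m.avg = D.eval.toLin) : Mark P D m
  | compL {X Y Z : Word (WeightModule R)} {S : Diagram X Y} (T : Diagram Y Z)
      {m : Lin X.obj Y.obj} (h : Mark P S m) : Mark P (S.comp T) (T.eval.toLin ∘ₗ m)
  | compR {X Y Z : Word (WeightModule R)} (S : Diagram X Y) {T : Diagram Y Z}
      {m : Lin Y.obj Z.obj} (h : Mark P T m) : Mark P (S.comp T) (m ∘ₗ S.eval.toLin)
  | tensorL {X Y X' Y' : Word (WeightModule R)} {S : Diagram X Y} (T : Diagram X' Y')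
      {m : Lin X.obj Y.obj} (h : Mark P S m) :
      Mark P (S.tensor T) (m.tmap (T.eval.toLin ∘ₗ X'.obj.pivotInv))
  | tensorR {X Y X' Y' : Word (WeightModule R)} (S : Diagram X Y) {T : Diagram X' Y'}
      {m : Lin X'.obj Y'.obj} (h : Mark P T m) :
      Mark P (S.tensor T) (Lin.tmap (S.eval.toLin ∘ₗ X.obj.pivot : Lin X.obj Y.obj) m)

section Marks

variable {P : Set (WeightModule R)} {X Y Z W X' Y' Z' : Word (WeightModule R)}

lemma Mark.wp {D : Diagram X Y} {m : Lin X.obj Y.obj} (h : Mark P D m) : m.WP := by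
  induction h with
  | base h hm havg => exact hm
  | compL T h ih => exact (wp_hom _).comp ih
  | compR S h ih => exact ih.comp (wp_hom _)
  | tensorL T h ih => exact ih.tmap ((wp_hom _).comp wp_pivotInv)
  | tensorR S h ih => exact ((wp_hom _).comp wp_pivot).tmap ih

lemma Mark.avg {D : Diagram X Y} {m : Lin X.obj Y.obj} (h : Mark P D m) :
    m.avg = D.eval.toLin := by
  induction h with
  | base h hm havg => exact havg
  | compL T h ih => rw [avg_hom_comp, ih]; rfl
  | compR S h ih => rw [avg_comp_hom, ih]; rfl
  | tensorL T h ih => exact (avg_tmap_left h.wp _).trans (by rw [ih]; rfl)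
  | tensorR S h ih => exact (avg_tmap_right _ h.wp).trans (by rw [ih]; rfl)

lemma word_colors_subset_left (D : Diagram X Y) : X.colors ⊆ D.colors := by
  induction D with
  | comp S T ih ih' => exact fun V h => Or.inl (ih h)
  | tensor S T ih ih' => exact Set.union_subset_union ih ih'
  | _ => simp [Diagram.colors, Word.colors] <;> tauto_set

lemma word_colors_subset_right (D : Diagram X Y) : Y.colors ⊆ D.colors := by
  induction D with
  | comp S T ih ih' => exact fun V h => Or.inr (ih' h)
  | tensor S T ih ih' => exact Set.union_subset_union ih ih'
  | _ => simp [Diagram.colors, Word.colors] <;> tauto_set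

lemma Mark.exists_color {D : Diagram X Y} {m : Lin X.obj Y.obj} (hm : Mark P D m) :
    ∃ V ∈ P, V ∈ D.colors := by
  induction hm with
  | base h hm havg =>
    rcases h with ⟨V, hV, h⟩ | ⟨V, hV, h⟩
    · exact ⟨V, hV, word_colors_subset_left _ h⟩
    · exact ⟨V, hV, word_colors_subset_right _ h⟩
  | compL T h ih => obtain ⟨V, hV, h⟩ := ih; exact ⟨V, hV, Or.inl h⟩
  | compR S h ih => obtain ⟨V, hV, h⟩ := ih; exact ⟨V, hV, Or.inr h⟩
  | tensorL T h ih => obtain ⟨V, hV, h⟩ := ih; exact ⟨V, hV, Or.inl h⟩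
  | tensorR S h ih => obtain ⟨V, hV, h⟩ := ih; exact ⟨V, hV, Or.inr h⟩

variable (hP : ∀ V ∈ P, IsProj V ∧ IsProj (Pivotal.dual V))

include hP

lemma Meets.isProj (h : Meets P X) : IsProj X.obj := by
  obtain ⟨V, hV, h⟩ := h
  induction X with
  | unit => exact absurd h (by simp [Word.colors])
  | strand W ε =>
    obtain rfl : V = W := h
    cases ε
    exacts [(hP V hV).2, (hP V hV).1]
  | tensor X Y ih ih' =>
    rcases h with h | h
    · exact (ih h).tensor_left _
    · exact IsProj.tensor_right _ (ih' h)

lemma exists_mark_base (h : Meets P X ∨ Meets P Y) (D : Diagram X Y) : ∃ m, Mark P D m := by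
  rcases id h with h' | h'
  · obtain ⟨k, hk, hk1⟩ := h'.isProj hP
    refine ⟨D.eval.toLin ∘ₗ k, .base h ((wp_hom _).comp hk) ?_⟩
    rw [avg_hom_comp, hk1, LinearMap.comp_id]
  · obtain ⟨k, hk, hk1⟩ := h'.isProj hP
    refine ⟨k ∘ₗ D.eval.toLin, .base h (hk.comp (wp_hom _)) ?_⟩
    rw [avg_comp_hom, hk1, LinearMap.id_comp]

lemma exists_mark_color {V : WeightModule R} (hV : V ∈ P) (D : Diagram X Y)
    (h : V ∈ X.colors ∨ V ∈ Y.colors) : ∃ m, Mark P D m :=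
  exists_mark_base hP (h.imp (fun h => ⟨V, hV, h⟩) (fun h => ⟨V, hV, h⟩)) D

lemma exists_mark {D : Diagram X Y} (h : ∃ V ∈ P, V ∈ D.colors) : ∃ m, Mark P D m := by
  obtain ⟨V, hV, h⟩ := h
  induction D with
  | comp S T ih ih' =>
    rcases h with h | h
    · obtain ⟨m, hm⟩ := ih h; exact ⟨_, hm.compL T⟩
    · obtain ⟨m, hm⟩ := ih' h; exact ⟨_, hm.compR S⟩
  | tensor S T ih ih' =>
    rcases h with h | h
    · obtain ⟨m, hm⟩ := ih h; exact ⟨_, hm.tensorL T⟩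
    · obtain ⟨m, hm⟩ := ih' h; exact ⟨_, hm.tensorR S⟩
  | coupon a c f => exact exists_mark_color hP hV _ h
  | id X => exact exists_mark_color hP hV _ (Or.inl h)
  | assoc X Y Z => exact exists_mark_color hP hV _ (Or.inl h)
  | assocInv X Y Z => exact exists_mark_color hP hV _ (Or.inr h)
  | lunit X => exact exists_mark_color hP hV _ (Or.inr h)
  | lunitInv X => exact exists_mark_color hP hV _ (Or.inl h)
  | runit X => exact exists_mark_color hP hV _ (Or.inr h)
  | runitInv X => exact exists_mark_color hP hV _ (Or.inl h)
  | cup W => exact exists_mark_color hP hV _ (Or.inr (Or.inl h))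
  | cup' W => exact exists_mark_color hP hV _ (Or.inr (Or.inl h))
  | cap W => exact exists_mark_color hP hV _ (Or.inl (Or.inl h))
  | cap' W => exact exists_mark_color hP hV _ (Or.inl (Or.inl h))

/-- The trace pairing of a marked diagram does not depend on the mark. -/
lemma Mark.pairing_eq {D : Diagram X Y} {m m' : Lin X.obj Y.obj} (h : Mark P D m)
    (h' : Mark P D m') (f : Y.obj ⟶ X.obj) : m.pairing f = m'.pairing f := by
  -- A strand of `P` on the boundary makes the source or target relatively projective. Then only the
  -- average matters, and every mark of `D` averages to the value of `D`.
  have base : ∀ {X Y : Word (WeightModule R)} {D : Diagram X Y} {m m' : Lin X.obj Y.obj}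
      (f : Y.obj ⟶ X.obj), (Meets P X ∨ Meets P Y) → Mark P D m → Mark P D m' →
        m.pairing f = m'.pairing f := fun f hM h h' =>
    pairing_eq_of_avg_eq h.wp h'.wp (h.avg.trans h'.avg.symm)
      (hM.imp (Meets.isProj hP) (Meets.isProj hP)) f
  induction h with
  | base hM hm havg => exact base f hM (.base hM hm havg) h'
  | compL T h ih =>
    cases h' with
    | base hM hm havg => exact base f hM (h.compL T) (.base hM hm havg)
    | compL _ h' => rw [pairing_hom_comp, pairing_hom_comp, ih h']
    | compR _ h' => exact pairing_comp_eq h.wp h.avg h'.avg f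
  | compR S h ih =>
    cases h' with
    | base hM hm havg => exact base f hM (h.compR S) (.base hM hm havg)
    | compL _ h' => exact (pairing_comp_eq h'.wp h'.avg h.avg f).symm
    | compR _ h' => rw [pairing_comp_hom, pairing_comp_hom, ih h']
  | tensorL T h ih =>
    cases h' with
    | base hM hm havg => exact base f hM (h.tensorL T) (.base hM hm havg)
    | tensorL _ h' =>
      exact (pairing_tmap_left _ _ f).trans ((ih h' _).trans (pairing_tmap_left _ _ f).symm)
    | tensorR _ h' => exact pairing_tmap_eq h.wp h'.wp h.avg h'.avg f
  | tensorR S h ih =>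
    cases h' with
    | base hM hm havg => exact base f hM (h.tensorR S) (.base hM hm havg)
    | tensorL _ h' => exact (pairing_tmap_eq h'.wp h.wp h'.avg h.avg f).symm
    | tensorR _ h' =>
      exact (pairing_tmap_right _ _ f).trans ((ih h' _).trans (pairing_tmap_right _ _ f).symm)

end Marks

end UqSl2

/-! ### Cups and caps of words -/

namespace UqSl2

open Ubar Pivotal
open scoped TensorProduct

lemma pairing_ext_four {A B C D : Type*} [AddCommGroup A] [Module ℂ A] [AddCommGroup B]
    [Module ℂ B] [AddCommGroup C] [Module ℂ C] [AddCommGroup D] [Module ℂ D]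
    (F : (A ⊗[ℂ] B) ⊗[ℂ] (C ⊗[ℂ] D) →ₗ[ℂ] ℂ) (G : (C ⊗[ℂ] D) ⊗[ℂ] (A ⊗[ℂ] B) →ₗ[ℂ] ℂ)
    (f : A →ₗ[ℂ] A) (g : B →ₗ[ℂ] B)
    (h : ∀ a b c d, F ((a ⊗ₜ b) ⊗ₜ (c ⊗ₜ d)) = G ((c ⊗ₜ d) ⊗ₜ (f a ⊗ₜ g b)))
    (s : A ⊗[ℂ] B) (t : C ⊗[ℂ] D) : F (s ⊗ₜ t) = G (t ⊗ₜ TensorProduct.map f g s) := by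
  induction s using TensorProduct.induction_on with
  | zero => simp
  | add a b ha hb => simp only [map_add, TensorProduct.add_tmul, TensorProduct.tmul_add, ha, hb]
  | tmul x y =>
    induction t using TensorProduct.induction_on with
    | zero => simp
    | add a b ha hb => simp only [map_add, TensorProduct.add_tmul, TensorProduct.tmul_add, ha, hb]
    | tmul c d => exact h x y c d

section WordDuality

variable {R : RootData}

lemma trivRep_K_pow (n : ℕ) (c : ℂ) : trivRep R (gen R .K ^ n) c = c := by
  induction n generalizing c with
  | zero => simp
  | succ n ih => rw [pow_succ, map_mul, Module.End.mul_apply, trivRep_gen, ih, counitGen, one_mul]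

lemma trivRep_Kinv_pow (n : ℕ) (c : ℂ) : trivRep R (gen R .Kinv ^ n) c = c := by
  induction n generalizing c with
  | zero => simp
  | succ n ih => rw [pow_succ, map_mul, Module.End.mul_apply, trivRep_gen, ih, counitGen, one_mul]

lemma pivot_unit : (𝟙_ (WeightModule R)).pivot = LinearMap.id :=
  LinearMap.ext fun c => trivRep_K_pow _ (show ℂ from c)

lemma pivotInv_unit : (𝟙_ (WeightModule R)).pivotInv = LinearMap.id :=
  LinearMap.ext fun c => trivRep_Kinv_pow _ (show ℂ from c)

lemma pivot_tensor (X Y : WeightModule R) : (X ⊗ Y).pivot = X.pivot.tmap Y.pivot :=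
  TensorProduct.ext' fun v w => tensorRep_K_pow _ v w

lemma pivotInv_tensor (X Y : WeightModule R) : (X ⊗ Y).pivotInv = X.pivotInv.tmap Y.pivotInv :=
  TensorProduct.ext' fun v w => tensorRep_Kinv_pow _ v w

lemma hom_pivot {X Y : WeightModule R} (f : X ⟶ Y) (x : X.carrier) :
    f.toLin (X.pivot x) = Y.pivot (f.toLin x) := WeightModule.piv_comm f x

lemma hom_pivotInv {X Y : WeightModule R} (f : X ⟶ Y) (x : X.carrier) :
    f.toLin (X.pivotInv x) = Y.pivotInv (f.toLin x) := WeightModule.pivInv_comm f x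

/-- The nested caps `X* X ⟶ ∅` as a pairing. -/
noncomputable def wordEvL (X : Word (WeightModule R)) : X.dual.obj.carrier ⊗[ℂ] X.obj.carrier →ₗ[ℂ] ℂ :=
  (Diagram.evL X).eval.toLin

/-- The nested caps `X X* ⟶ ∅` as a pairing. -/
noncomputable def wordEvR (X : Word (WeightModule R)) : X.obj.carrier ⊗[ℂ] X.dual.obj.carrier →ₗ[ℂ] ℂ :=
  (Diagram.evR X).eval.toLin

/-- The tensor of the nested cups `∅ ⟶ X X*`. -/
noncomputable def wordCoevL (X : Word (WeightModule R)) : X.obj.carrier ⊗[ℂ] X.dual.obj.carrier :=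
  (Diagram.coevL X).eval.toLin (1 : ℂ)

/-- The tensor of the nested cups `∅ ⟶ X* X`. -/
noncomputable def wordCoevR (X : Word (WeightModule R)) : X.dual.obj.carrier ⊗[ℂ] X.obj.carrier :=
  (Diagram.coevR X).eval.toLin (1 : ℂ)

lemma wordEvL_pivot (X : Word (WeightModule R)) (ξ : X.dual.obj.carrier) (x : X.obj.carrier) :
    wordEvL X (X.dual.obj.pivot ξ ⊗ₜ X.obj.pivot x) = wordEvL X (ξ ⊗ₜ x) := by
  have h := hom_pivot (Diagram.evL X).eval (ξ ⊗ₜ[ℂ] x)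
  have e : (X.dual.tensor X).obj.pivot (ξ ⊗ₜ[ℂ] x) =
      X.dual.obj.pivot ξ ⊗ₜ[ℂ] X.obj.pivot x := LinearMap.congr_fun (pivot_tensor _ _) (ξ ⊗ₜ[ℂ] x)
  rw [e] at h
  exact h.trans (LinearMap.congr_fun pivot_unit _)

lemma wordEvL_pivotInv (X : Word (WeightModule R)) (ξ : X.dual.obj.carrier) (x : X.obj.carrier) :
    wordEvL X (X.dual.obj.pivotInv ξ ⊗ₜ X.obj.pivotInv x) = wordEvL X (ξ ⊗ₜ x) := by
  have h := hom_pivotInv (Diagram.evL X).eval (ξ ⊗ₜ[ℂ] x)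
  have e : (X.dual.tensor X).obj.pivotInv (ξ ⊗ₜ[ℂ] x) =
      X.dual.obj.pivotInv ξ ⊗ₜ[ℂ] X.obj.pivotInv x :=
    LinearMap.congr_fun (pivotInv_tensor _ _) (ξ ⊗ₜ[ℂ] x)
  rw [e] at h
  exact h.trans (LinearMap.congr_fun pivotInv_unit _)

lemma wordCoevL_pivot (X : Word (WeightModule R)) :
    TensorProduct.map X.obj.pivot X.dual.obj.pivot (wordCoevL X) = wordCoevL X := by
  have h := hom_pivot (Diagram.coevL X).eval (1 : ℂ)
  have e : (X.tensor X.dual).obj.pivot = TensorProduct.map X.obj.pivot X.dual.obj.pivot :=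
    pivot_tensor _ _
  rw [e] at h
  refine Eq.trans h.symm ?_
  exact congrArg (Diagram.coevL X).eval.toLin (LinearMap.congr_fun pivot_unit (1 : ℂ))

lemma wordCoevL_pivotInv (X : Word (WeightModule R)) :
    TensorProduct.map X.obj.pivotInv X.dual.obj.pivotInv (wordCoevL X) = wordCoevL X := by
  have h := hom_pivotInv (Diagram.coevL X).eval (1 : ℂ)
  have e : (X.tensor X.dual).obj.pivotInv = TensorProduct.map X.obj.pivotInv X.dual.obj.pivotInv :=
    pivotInv_tensor _ _
  rw [e] at h
  refine Eq.trans h.symm ?_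
  exact congrArg (Diagram.coevL X).eval.toLin (LinearMap.congr_fun pivotInv_unit (1 : ℂ))

/-- The two caps of a word differ by the pivot. -/
lemma wordEvR_eq (X : Word (WeightModule R)) (x : X.obj.carrier) (ξ : X.dual.obj.carrier) :
    wordEvR X (x ⊗ₜ ξ) = wordEvL X (ξ ⊗ₜ X.obj.pivotInv x) := by
  induction X with
  | unit =>
    rw [show (Word.unit : Word (WeightModule R)).obj.pivotInv = LinearMap.id from pivotInv_unit]
    exact mul_comm (show ℂ from x) (show ℂ from ξ)
  | strand V ε =>
    cases ε
    -- For an upward strand the two caps exchange roles; invariance of the cap under the pivot moves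
    -- `K^(1-r)` to the other factor.
    · exact (wordEvL_pivotInv (Word.strand V true) x ξ).symm
    · rfl
  | tensor X Y ihX ihY =>
    have h := pairing_ext_four
      (show (X.obj.carrier ⊗[ℂ] Y.obj.carrier) ⊗[ℂ] (Y.dual.obj.carrier ⊗[ℂ] X.dual.obj.carrier)
        →ₗ[ℂ] ℂ from wordEvR (X.tensor Y))
      (show (Y.dual.obj.carrier ⊗[ℂ] X.dual.obj.carrier) ⊗[ℂ] (X.obj.carrier ⊗[ℂ] Y.obj.carrier)
        →ₗ[ℂ] ℂ from wordEvL (X.tensor Y)) X.obj.pivotInv Y.obj.pivotInv (fun x y η ξ => by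
        have e1 : wordEvR (X.tensor Y) ((x ⊗ₜ[ℂ] y) ⊗ₜ[ℂ] (η ⊗ₜ[ℂ] ξ)) =
            wordEvR X (x ⊗ₜ[ℂ] (wordEvR Y (y ⊗ₜ[ℂ] η) • ξ)) := rfl
        have e2 : wordEvL (X.tensor Y) ((η ⊗ₜ[ℂ] ξ) ⊗ₜ[ℂ]
            (X.obj.pivotInv x ⊗ₜ[ℂ] Y.obj.pivotInv y)) =
            wordEvL Y (η ⊗ₜ[ℂ] (wordEvL X (ξ ⊗ₜ[ℂ] X.obj.pivotInv x) • Y.obj.pivotInv y)) := rfl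
        refine e1.trans (Eq.trans ?_ e2.symm)
        rw [TensorProduct.tmul_smul, map_smul, TensorProduct.tmul_smul, map_smul, ihX,
          ihY, smul_eq_mul, smul_eq_mul, mul_comm]) x ξ
    have e : (X.tensor Y).obj.pivotInv = TensorProduct.map X.obj.pivotInv Y.obj.pivotInv :=
      pivotInv_tensor _ _
    rw [e]
    exact h

/-- The two cups of a word differ by the pivot. -/
lemma wordCoevR_eq (X : Word (WeightModule R)) : wordCoevR X =
    TensorProduct.map LinearMap.id X.obj.pivot (TensorProduct.comm ℂ _ _ (wordCoevL X)) := by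
  induction X with
  | unit =>
    rw [show (Word.unit : Word (WeightModule R)).obj.pivot = LinearMap.id from pivot_unit,
      TensorProduct.map_id]
    rfl
  | strand V ε =>
    cases ε
    -- The same exchange for cups: the invariance of the cup carries the pivot from `V` to `V*`.
    · have h := wordCoevL_pivot (Word.strand V true)
      have e : wordCoevL (Word.strand V false) = TensorProduct.map LinearMap.id V.pivot
        (TensorProduct.comm ℂ _ _ (wordCoevL (Word.strand V true))) := rfl
      have e' : wordCoevR (Word.strand V false) = wordCoevL (Word.strand V true) := rfl
      rw [e', e]
      refine Eq.trans h.symm ?_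
      have : ∀ t : V.carrier ⊗[ℂ] (WeightModule.dual V).carrier,
          TensorProduct.map V.pivot (WeightModule.dual V).pivot t =
          TensorProduct.map LinearMap.id (WeightModule.dual V).pivot
            (TensorProduct.comm ℂ _ _ (TensorProduct.map LinearMap.id V.pivot
              (TensorProduct.comm ℂ _ _ t))) := by
        intro t
        induction t using TensorProduct.induction_on with
        | zero => simp
        | add a b ha hb => simp only [map_add, ha, hb]
        | tmul a b => simp
      exact this _
    · rfl
  | tensor X Y ihX ihY =>
    have e1 : wordCoevL (X.tensor Y) = (TensorProduct.assoc ℂ _ _ _).symm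
        (TensorProduct.map LinearMap.id ((TensorProduct.assoc ℂ _ _ _).toLinearMap ∘ₗ
          TensorProduct.mk ℂ _ X.dual.obj.carrier (wordCoevL Y)) (wordCoevL X)) :=
      congrArg (fun L => (TensorProduct.assoc ℂ _ _ _).symm
        (TensorProduct.map LinearMap.id L (wordCoevL X))) (LinearMap.ext fun x => rfl :
          (TensorProduct.assoc ℂ Y.obj.carrier Y.dual.obj.carrier X.dual.obj.carrier).toLinearMap ∘ₗ
            TensorProduct.map (Diagram.coevL Y).eval.toLin LinearMap.id ∘ₗ
              (TensorProduct.lid ℂ X.dual.obj.carrier).symm.toLinearMap = _)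
    have e2 : wordCoevR (X.tensor Y) = (TensorProduct.assoc ℂ _ _ _).symm
        (TensorProduct.map LinearMap.id ((TensorProduct.assoc ℂ _ _ _).toLinearMap ∘ₗ
          TensorProduct.mk ℂ _ Y.obj.carrier (wordCoevR X)) (wordCoevR Y)) :=
      congrArg (fun L => (TensorProduct.assoc ℂ _ _ _).symm
        (TensorProduct.map LinearMap.id L (wordCoevR Y))) (LinearMap.ext fun x => rfl :
          (TensorProduct.assoc ℂ X.dual.obj.carrier X.obj.carrier Y.obj.carrier).toLinearMap ∘ₗ
            TensorProduct.map (Diagram.coevR X).eval.toLin LinearMap.id ∘ₗ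
              (TensorProduct.lid ℂ Y.obj.carrier).symm.toLinearMap = _)
    have e : (X.tensor Y).obj.pivot = TensorProduct.map X.obj.pivot Y.obj.pivot :=
      pivot_tensor _ _
    rw [e1, e2, e, ihX, ihY]
    -- Each nested cup is bilinear in the cups of `X` and `Y`, so these are replaced by arbitrary
    -- tensors and the comparison is made on pure ones.
    have key : ∀ (s : X.obj.carrier ⊗[ℂ] X.dual.obj.carrier)
        (t : Y.obj.carrier ⊗[ℂ] Y.dual.obj.carrier),
        (TensorProduct.assoc ℂ _ _ _).symm
        (TensorProduct.map LinearMap.id ((TensorProduct.assoc ℂ _ _ _).toLinearMap ∘ₗ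
          TensorProduct.mk ℂ _ Y.obj.carrier (TensorProduct.map LinearMap.id X.obj.pivot
            (TensorProduct.comm ℂ _ _ s))) (TensorProduct.map LinearMap.id Y.obj.pivot
              (TensorProduct.comm ℂ _ _ t))) =
        TensorProduct.map LinearMap.id (TensorProduct.map X.obj.pivot Y.obj.pivot)
          (TensorProduct.comm ℂ _ _ ((TensorProduct.assoc ℂ _ _ _).symm
        (TensorProduct.map LinearMap.id ((TensorProduct.assoc ℂ _ _ _).toLinearMap ∘ₗ
          TensorProduct.mk ℂ _ X.dual.obj.carrier t) s))) := by
      intro s t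
      induction s using TensorProduct.induction_on with
      | zero => simp
      | add a b ha hb =>
        simp only [map_add, LinearMap.comp_add, TensorProduct.map_add_right, LinearMap.add_apply,
          ha, hb]
      | tmul x ξ =>
        induction t using TensorProduct.induction_on with
        | zero => simp
        | add a b ha hb =>
          simp only [map_add, LinearMap.comp_add, TensorProduct.map_add_right,
            LinearMap.add_apply, ha, hb]
        | tmul y η => simp
    exact key _ _

end WordDuality

end UqSl2

/-! ### Isotopy invariance of marked diagrams -/

namespace UqSl2

open Ubar Pivotal WeightModule
open scoped TensorProduct

/-! ### Colors of nested cups and caps, rotations and closures. -/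

section Colors

variable {R : RootData} (X : Word (WeightModule R))

@[simp] lemma word_colors_dual : X.dual.colors = X.colors := by
  induction X with
  | tensor X Y ih ih' => simp [Word.dual, Word.colors, ih, ih', Set.union_comm]
  | _ => rfl

@[simp] lemma colors_coevL : (Diagram.coevL X).colors = X.colors := by
  induction X with
  | unit => rfl
  | strand V ε => cases ε <;> rfl
  | tensor X Y ih ih' =>
    simp only [Diagram.coevL, Diagram.colors, Word.colors, ih, ih', word_colors_dual]
    tauto_set

@[simp] lemma colors_coevR : (Diagram.coevR X).colors = X.colors := by
  induction X with
  | unit => rfl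
  | strand V ε => cases ε <;> rfl
  | tensor X Y ih ih' =>
    simp only [Diagram.coevR, Diagram.colors, Word.colors, ih, ih', word_colors_dual]
    tauto_set

@[simp] lemma colors_evL : (Diagram.evL X).colors = X.colors := by
  induction X with
  | unit => rfl
  | strand V ε => cases ε <;> rfl
  | tensor X Y ih ih' =>
    simp only [Diagram.evL, Diagram.colors, Word.colors, ih, ih', word_colors_dual]
    tauto_set

@[simp] lemma colors_evR : (Diagram.evR X).colors = X.colors := by
  induction X with
  | unit => rfl
  | strand V ε => cases ε <;> rfl
  | tensor X Y ih ih' =>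
    simp only [Diagram.evR, Diagram.colors, Word.colors, ih, ih', word_colors_dual]
    tauto_set

variable {X} {Y : Word (WeightModule R)}

lemma colors_rotL (S : Diagram X Y) : S.rotL.colors = S.colors := by
  have h := word_colors_subset_left S
  have h' := word_colors_subset_right S
  simp only [Diagram.rotL, Diagram.colors, word_colors_dual, colors_coevL, colors_evL]
  tauto_set

lemma colors_rotR (S : Diagram X Y) : S.rotR.colors = S.colors := by
  have h := word_colors_subset_left S
  have h' := word_colors_subset_right S
  simp only [Diagram.rotR, Diagram.colors, word_colors_dual, colors_coevR, colors_evR]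
  tauto_set

lemma colors_closeR (S : Diagram X X) : S.closeR.colors = S.colors := by
  have h := word_colors_subset_left S
  simp only [Diagram.closeR, Diagram.colors, word_colors_dual, colors_coevL, colors_evR]
  tauto_set

lemma colors_closeL (S : Diagram X X) : S.closeL.colors = S.colors := by
  have h := word_colors_subset_left S
  simp only [Diagram.closeL, Diagram.colors, word_colors_dual, colors_coevR, colors_evL]
  tauto_set

end Colors

/-! ### Contractions along a cup. -/

section Contractions

variable {X X' Y Y' : Type*} [AddCommGroup X] [Module ℂ X] [AddCommGroup X'] [Module ℂ X']
  [AddCommGroup Y] [Module ℂ Y] [AddCommGroup Y'] [Module ℂ Y']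

lemma contract_left (F : Y' ⊗[ℂ] Y →ₗ[ℂ] ℂ) (A : X →ₗ[ℂ] Y) (β : X' →ₗ[ℂ] X') (ξ : Y')
    (t : X ⊗[ℂ] X') :
    TensorProduct.lid ℂ X' (TensorProduct.map F LinearMap.id
      ((TensorProduct.assoc ℂ Y' Y X').symm (ξ ⊗ₜ TensorProduct.map A β t))) =
    TensorProduct.lid ℂ X' (TensorProduct.map (F ∘ₗ TensorProduct.mk ℂ Y' Y ξ ∘ₗ A) β t) := by
  induction t using TensorProduct.induction_on with
  | zero => simp
  | add a b ha hb => simp only [map_add, TensorProduct.tmul_add, ha, hb]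
  | tmul x x' => simp

lemma contract_right (F : Y ⊗[ℂ] Y' →ₗ[ℂ] ℂ) (A : X →ₗ[ℂ] Y) (c : X →ₗ[ℂ] X)
    (β : X' →ₗ[ℂ] X') (ξ : Y') (t : X ⊗[ℂ] X') :
    TensorProduct.rid ℂ X' (TensorProduct.map LinearMap.id F
      (TensorProduct.assoc ℂ X' Y Y' (TensorProduct.map β A (TensorProduct.map LinearMap.id c
        (TensorProduct.comm ℂ X X' t)) ⊗ₜ ξ))) =
    TensorProduct.lid ℂ X' (TensorProduct.map
      (F ∘ₗ (TensorProduct.mk ℂ Y Y').flip ξ ∘ₗ A ∘ₗ c) β t) := by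
  induction t using TensorProduct.induction_on with
  | zero => simp
  | add a b ha hb => simp only [map_add, TensorProduct.add_tmul, ha, hb]
  | tmul x x' => simp

lemma map_map_apply {Z Z' : Type*} [AddCommGroup Z] [Module ℂ Z] [AddCommGroup Z'] [Module ℂ Z']
    (f : Y →ₗ[ℂ] Z) (f' : Y' →ₗ[ℂ] Z') (g : X →ₗ[ℂ] Y) (g' : X' →ₗ[ℂ] Y') (t : X ⊗[ℂ] X') :
    TensorProduct.map f f' (TensorProduct.map g g' t) =
      TensorProduct.map (f ∘ₗ g) (f' ∘ₗ g') t := by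
  rw [TensorProduct.map_comp]; rfl

end Contractions

/-! ### Rotations and closures of marked diagrams. -/

section Rotation

variable {R : RootData} {X Y : Word (WeightModule R)}

lemma WeightModule.Lin.WP.pivot {X Y : WeightModule R} {m : Lin X Y} (h : m.WP) (x : X.carrier) :
    m (X.pivot x) = Y.pivot (m x) := WeightPreserving.piv h x

lemma WeightModule.Lin.WP.pivotInv {X Y : WeightModule R} {m : Lin X Y} (h : m.WP) (x : X.carrier) :
    m (X.pivotInv x) = Y.pivotInv (m x) := WeightPreserving.pivInv h x

lemma pivot_pivotInv {X : WeightModule R} (x : X.carrier) : X.pivot (X.pivotInv x) = x :=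
  piv_pivInv X.ρ x

lemma pivotInv_pivot {X : WeightModule R} (x : X.carrier) : X.pivotInv (X.pivot x) = x :=
  pivInv_piv X.ρ x

/-- The transpose of a linear map with respect to the nested cups and caps. -/
noncomputable def transpose (m : Lin X.obj Y.obj) (ξ : Y.dual.obj.carrier) : X.dual.obj.carrier :=
  TensorProduct.lid ℂ _ (TensorProduct.map
    (wordEvL Y ∘ₗ TensorProduct.mk ℂ Y.dual.obj.carrier Y.obj.carrier ξ ∘ₗ m) LinearMap.id
      (wordCoevL X))

/-- A mark inside `rotL` leaves `K^(r-1)` on the strands of `Y*` to its left and `K^(1-r)` on those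
of `X*` to its right. The two cancel because `m` commutes with `K` and cups and caps are invariant.
-/
lemma rotate_left_pivot {m : Lin X.obj Y.obj} (hm : m.WP) (ξ : Y.dual.obj.carrier) :
    TensorProduct.lid ℂ _ (TensorProduct.map (wordEvL Y ∘ₗ TensorProduct.mk ℂ
      Y.dual.obj.carrier Y.obj.carrier (Y.dual.obj.pivot ξ) ∘ₗ m) X.dual.obj.pivotInv
        (wordCoevL X)) = transpose m ξ := by
  rw [transpose]
  conv_rhs => rw [← wordCoevL_pivotInv, map_map_apply, LinearMap.id_comp]
  congr 3
  refine LinearMap.ext fun x => ?_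
  rw [LinearMap.comp_apply, LinearMap.comp_apply, LinearMap.comp_apply, LinearMap.comp_apply,
    LinearMap.comp_apply, hm.pivotInv, TensorProduct.mk_apply, TensorProduct.mk_apply,
    ← wordEvL_pivotInv, pivotInv_pivot]

/-- The counterpart inside `rotR`; the factor `K^(r-1)` after `m` is the one by which the cup of
`rotR` differs from `wordCoevL`. -/
lemma rotate_right_pivot (m : Lin X.obj Y.obj) (ξ : Y.dual.obj.carrier) :
    TensorProduct.lid ℂ _ (TensorProduct.map (wordEvR Y ∘ₗ (TensorProduct.mk ℂ
      Y.obj.carrier Y.dual.obj.carrier).flip (Y.dual.obj.pivotInv ξ) ∘ₗ m ∘ₗ X.obj.pivot)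
        X.dual.obj.pivot (wordCoevL X)) = transpose m ξ := by
  rw [transpose]
  conv_rhs => rw [← wordCoevL_pivot, map_map_apply, LinearMap.id_comp]
  congr 3
  refine LinearMap.ext fun x => ?_
  simp only [LinearMap.comp_apply, LinearMap.flip_apply, TensorProduct.mk_apply]
  rw [wordEvR_eq, wordEvL_pivotInv]

lemma rotate_right {m : Lin X.obj Y.obj} (hm : m.WP) (ξ : Y.dual.obj.carrier) :
    TensorProduct.lid ℂ _ (TensorProduct.map (wordEvR Y ∘ₗ (TensorProduct.mk ℂ
      Y.obj.carrier Y.dual.obj.carrier).flip ξ ∘ₗ m ∘ₗ X.obj.pivot)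
        LinearMap.id (wordCoevL X)) = transpose m ξ := by
  rw [transpose]
  congr 3
  refine LinearMap.ext fun x => ?_
  simp only [LinearMap.comp_apply, LinearMap.flip_apply, TensorProduct.mk_apply]
  rw [wordEvR_eq, ← hm.pivotInv, pivotInv_pivot]

lemma eval_rotL (S : Diagram X Y) (ξ : Y.dual.obj.carrier) :
    S.rotL.eval.toLin ξ = transpose S.eval.toLin ξ :=
  contract_left (wordEvL Y) S.eval.toLin LinearMap.id ξ (wordCoevL X)

lemma eval_rotR (S : Diagram X Y) (ξ : Y.dual.obj.carrier) :
    S.rotR.eval.toLin ξ = transpose S.eval.toLin ξ := by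
  have h : S.rotR.eval.toLin ξ = TensorProduct.rid ℂ _ (TensorProduct.map LinearMap.id
      (wordEvR Y) (TensorProduct.assoc ℂ _ _ _ (TensorProduct.map LinearMap.id S.eval.toLin
        (wordCoevR X) ⊗ₜ ξ))) := rfl
  rw [h, wordCoevR_eq, contract_right]
  exact rotate_right (wp_hom _) ξ

lemma Mark.congr {P : Set (WeightModule R)} {S : Diagram X Y} {m n : Lin X.obj Y.obj}
    (h : Mark P S m) (e : n = m) : Mark P S n := e ▸ h

lemma Mark.rotL {P : Set (WeightModule R)} {S : Diagram X Y} {m : Lin X.obj Y.obj}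
    (h : Mark P S m) {n : Lin Y.dual.obj X.dual.obj} (hn : ∀ ξ, n ξ = transpose m ξ) :
    Mark P S.rotL n := by
  have key := ((((h.tensorL (.id X.dual)).tensorR (.id Y.dual)).compL
    ((Diagram.assocInv Y.dual Y X.dual).comp
      (((Diagram.evL Y).tensor (.id X.dual)).comp (.lunit X.dual)))).compR
        ((Diagram.id Y.dual).tensor (.coevL X))).compR (.runitInv Y.dual)
  refine Mark.congr (S := S.rotL) key (LinearMap.ext fun ξ => (hn ξ).trans (Eq.trans ?_
    (contract_left (wordEvL Y) m X.dual.obj.pivotInv (Y.dual.obj.pivot ξ) (wordCoevL X)).symm))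
  exact (rotate_left_pivot h.wp ξ).symm

lemma Mark.rotR {P : Set (WeightModule R)} {S : Diagram X Y} {m : Lin X.obj Y.obj}
    (h : Mark P S m) {n : Lin Y.dual.obj X.dual.obj} (hn : ∀ ξ, n ξ = transpose m ξ) :
    Mark P S.rotR n := by
  have key := ((((h.tensorR (.id X.dual)).tensorL (.id Y.dual)).compL
    ((Diagram.assoc X.dual Y Y.dual).comp
      (((Diagram.id X.dual).tensor (.evR Y)).comp (.runit X.dual)))).compR
        ((Diagram.coevR X).tensor (.id Y.dual))).compR (.lunitInv Y.dual)
  refine Mark.congr (S := S.rotR) key (LinearMap.ext fun ξ => (hn ξ).trans ?_)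
  have e : TensorProduct.rid ℂ _ (TensorProduct.map LinearMap.id
      (wordEvR Y) (TensorProduct.assoc ℂ _ _ _ (TensorProduct.map X.dual.obj.pivot m
        (wordCoevR X) ⊗ₜ Y.dual.obj.pivotInv ξ))) = transpose m ξ := by
    rw [wordCoevR_eq, contract_right]
    exact rotate_right_pivot m ξ
  exact e.symm

/-- Both half-turns of a marked diagram are the transpose of the mark, so one linear map marks both;
this is what the full turn requires. -/
lemma Mark.exists_transpose {P : Set (WeightModule R)} {S : Diagram X Y} {m : Lin X.obj Y.obj}
    (h : Mark P S m) : ∃ n, Mark P S.rotL n ∧ Mark P S.rotR n := by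
  have e : ∀ ξ, transpose m ξ = TensorProduct.lid ℂ _ (TensorProduct.map
    (wordEvL Y ∘ₗ TensorProduct.mk ℂ Y.dual.obj.carrier Y.obj.carrier ξ ∘ₗ m) LinearMap.id
      (wordCoevL X)) := fun _ => rfl
  refine ⟨⟨⟨transpose m, fun ξ η => ?_⟩, fun c ξ => ?_⟩, h.rotL fun ξ => rfl, h.rotR fun ξ => rfl⟩
  · rw [e, e, e, map_add, LinearMap.add_comp, LinearMap.comp_add,
      TensorProduct.map_add_left, LinearMap.add_apply, map_add]
  · refine (e _).trans (Eq.trans ?_ (congrArg (c • ·) (e ξ)).symm)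
    rw [map_smul, LinearMap.smul_comp, LinearMap.comp_smul,
      TensorProduct.map_smul_left, LinearMap.smul_apply, map_smul]

/-- The value of the closure of a diagram with a mark. -/
noncomputable def closeValue (m : Lin X.obj X.obj) : ℂ :=
  wordEvL X (TensorProduct.comm ℂ _ _ (TensorProduct.map m LinearMap.id (wordCoevL X)))

/-- The correction `K^(1-r)` on the closing arcs and the `K^(1-r)` by which `evR` differs from `evL`
cancel by invariance of the cup, leaving a value without pivots. -/
lemma closeValue_right {m : Lin X.obj X.obj} (hm : m.WP) :
    wordEvR X (TensorProduct.map m X.dual.obj.pivotInv (wordCoevL X)) = closeValue m := by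
  rw [closeValue]
  conv_rhs => rw [← wordCoevL_pivotInv, map_map_apply, LinearMap.id_comp]
  induction wordCoevL X using TensorProduct.induction_on with
  | zero => simp
  | add a b ha hb => simp only [map_add, ha, hb]
  | tmul x ξ =>
    rw [TensorProduct.map_tmul, TensorProduct.map_tmul, TensorProduct.comm_tmul, wordEvR_eq,
      LinearMap.comp_apply, hm.pivotInv]

/-- Likewise on the left, where `K^(r-1)` on the arcs cancels with the pivot in `coevR`. The two
closures therefore agree after marking. -/
lemma closeValue_left {m : Lin X.obj X.obj} (hm : m.WP) :
    wordEvL X (TensorProduct.map X.dual.obj.pivot m (wordCoevR X)) = closeValue m := by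
  rw [closeValue, wordCoevR_eq]
  induction wordCoevL X using TensorProduct.induction_on with
  | zero => simp
  | add a b ha hb => simp only [map_add, ha, hb]
  | tmul x ξ =>
    simp only [TensorProduct.map_tmul, TensorProduct.comm_tmul, LinearMap.id_apply]
    rw [hm.pivot, wordEvL_pivot]

/-- Multiplication by a scalar on the unit object. -/
def scalar (R : RootData) (c : ℂ) : Lin (𝟙_ (WeightModule R)) (𝟙_ (WeightModule R)) :=
  (c • LinearMap.id : ℂ →ₗ[ℂ] ℂ)

lemma eq_scalar {n : Lin (𝟙_ (WeightModule R)) (𝟙_ (WeightModule R))} {c : ℂ}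
    (h : n (1 : ℂ) = c) : scalar R c = n := by
  exact LinearMap.ext_ring (f := (show ℂ →ₗ[ℂ] ℂ from scalar R c))
    (g := (show ℂ →ₗ[ℂ] ℂ from n)) ((mul_one c).trans h.symm)

lemma Mark.closeR {P : Set (WeightModule R)} {S : Diagram X X} {m : Lin X.obj X.obj}
    (h : Mark P S m) : Mark P S.closeR (scalar R (closeValue m)) := by
  have key := ((h.tensorL (.id X.dual)).compL (.evR X)).compR (.coevL X)
  exact Mark.congr (S := S.closeR) key (eq_scalar (closeValue_right h.wp))

lemma Mark.closeL {P : Set (WeightModule R)} {S : Diagram X X} {m : Lin X.obj X.obj}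
    (h : Mark P S m) : Mark P S.closeL (scalar R (closeValue m)) := by
  have key := ((h.tensorR (.id X.dual)).compL (.evL X)).compR (.coevR X)
  exact Mark.congr (S := S.closeL) key (eq_scalar (closeValue_left h.wp))

/-- No pivot is left in `closeValue`, so a single strand gives the ordinary trace and not the
quantum trace. -/
lemma closeValue_strand {V : WeightModule R} (m : Lin V V) :
    closeValue (X := .strand V true) m = LinearMap.trace ℂ V.carrier m := by
  have h : closeValue (X := .strand V true) m = UqSl2.evL (TensorProduct.comm ℂ _ _
    (TensorProduct.map m LinearMap.id (coevL (V := V.carrier) 1))) := rfl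
  rw [h, coevL_one, trace_eq_sum_repr (Module.Basis.ofVectorSpace ℂ V.carrier), map_sum, map_sum,
    map_sum]
  refine Finset.sum_congr rfl fun j _ => ?_
  rw [TensorProduct.map_tmul, TensorProduct.comm_tmul, evL_tmul]
  rfl

end Rotation

end UqSl2

namespace UqSl2

open Ubar Pivotal WeightModule
open scoped TensorProduct

/-! ### Comparison of marks under the elementary isotopies. -/

section IsotopyInvariance

variable {R : RootData} {P : Set (WeightModule R)} {X Y Z X' Y' X'' Y'' : Word (WeightModule R)}

/-- Two diagrams have the same colors and the same trace pairings after marking. -/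
structure MarksAgree (P : Set (WeightModule R)) (S T : Diagram X Y) : Prop where
  colors : S.colors = T.colors
  pairing : ∀ m m' : Lin X.obj Y.obj, Mark P S m → Mark P T m' →
    ∀ f : Y.obj ⟶ X.obj, m.pairing f = m'.pairing f

variable (hP : ∀ V ∈ P, IsProj V ∧ IsProj (Pivotal.dual V))

lemma MarksAgree.symm {S T : Diagram X Y} (h : MarksAgree P S T) : MarksAgree P T S :=
  ⟨h.colors.symm, fun m m' hm hm' f => (h.pairing m' m hm' hm f).symm⟩

include hP

lemma MarksAgree.trans {S T U : Diagram X Y} (h : MarksAgree P S T) (h' : MarksAgree P T U) :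
    MarksAgree P S U := by
  refine ⟨h.colors.trans h'.colors, fun m m' hm hm' f => ?_⟩
  obtain ⟨V, hV, hVS⟩ := hm.exists_color
  -- Transitivity needs some mark on the middle diagram; equality of colors provides it.
  obtain ⟨n, hn⟩ := exists_mark hP ⟨V, hV, h.colors ▸ hVS⟩
  exact (h.pairing m n hm hn f).trans (h'.pairing n m' hn hm' f)

/-- Pairings do not depend on the mark, so one well chosen pair of marks for each color suffices. -/
lemma MarksAgree.of_exists {S T : Diagram X Y} (hc : S.colors = T.colors)
    (h : ∀ V ∈ P, V ∈ S.colors → ∃ m m', Mark P S m ∧ Mark P T m' ∧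
      ∀ f : Y.obj ⟶ X.obj, m.pairing f = m'.pairing f) : MarksAgree P S T := by
  refine ⟨hc, fun m m' hm hm' f => ?_⟩
  obtain ⟨V, hV, hVS⟩ := hm.exists_color
  obtain ⟨n, n', hn, hn', hf⟩ := h V hV hVS
  rw [hm.pairing_eq hP hn, hf, hn'.pairing_eq hP hm']

lemma MarksAgree.of_common {S T : Diagram X Y} (hc : S.colors = T.colors)
    (h : ∀ V ∈ P, V ∈ S.colors → ∃ m, Mark P S m ∧ Mark P T m) : MarksAgree P S T :=
  .of_exists hP hc fun V hV hVS => by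
    obtain ⟨m, hm, hm'⟩ := h V hV hVS
    exact ⟨m, m, hm, hm', fun f => rfl⟩

/-- When every color is visible on the boundary, a mark of `S` is also a `base` mark of `T`, since
that constructor asks only for the right average. -/
lemma MarksAgree.of_boundary {S T : Diagram X Y} (he : S.eval = T.eval) (hc : S.colors = T.colors)
    (h : S.colors ⊆ X.colors ∪ Y.colors) : MarksAgree P S T :=
  .of_common hP hc fun V hV hVS => by
    have hM : Meets P X ∨ Meets P Y := (h hVS).imp (fun h => ⟨V, hV, h⟩) fun h => ⟨V, hV, h⟩
    obtain ⟨m, hm⟩ := exists_mark_base hP hM S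
    exact ⟨m, hm, .base hM hm.wp (hm.avg.trans (congrArg Hom.toLin he))⟩

lemma MarksAgree.comp {S S' : Diagram X Y} {T T' : Diagram Y Z} (hS : MarksAgree P S S')
    (hS' : S.eval = S'.eval) (hT : MarksAgree P T T') (hT' : T.eval = T'.eval) :
    MarksAgree P (S.comp T) (S'.comp T') := by
  refine .of_exists hP (congrArg₂ _ hS.colors hT.colors) fun V hV h => ?_
  rcases h with h | h
  · obtain ⟨m, hm⟩ := exists_mark hP ⟨V, hV, h⟩
    obtain ⟨m', hm'⟩ := exists_mark hP ⟨V, hV, hS.colors ▸ h⟩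
    refine ⟨_, _, hm.compL T, hm'.compL T', fun f => ?_⟩
    rw [pairing_hom_comp, pairing_hom_comp, hT', hS.pairing m m' hm hm']
  · obtain ⟨m, hm⟩ := exists_mark hP ⟨V, hV, h⟩
    obtain ⟨m', hm'⟩ := exists_mark hP ⟨V, hV, hT.colors ▸ h⟩
    refine ⟨_, _, hm.compR S, hm'.compR S', fun f => ?_⟩
    rw [pairing_comp_hom, pairing_comp_hom, hS', hT.pairing m m' hm hm']

lemma MarksAgree.tensor {S S' : Diagram X Y} {T T' : Diagram X' Y'} (hS : MarksAgree P S S')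
    (hS' : S.eval = S'.eval) (hT : MarksAgree P T T') (hT' : T.eval = T'.eval) :
    MarksAgree P (S.tensor T) (S'.tensor T') := by
  refine .of_exists hP (congrArg₂ _ hS.colors hT.colors) fun V hV h => ?_
  rcases h with h | h
  · obtain ⟨m, hm⟩ := exists_mark hP ⟨V, hV, h⟩
    obtain ⟨m', hm'⟩ := exists_mark hP ⟨V, hV, hS.colors ▸ h⟩
    refine ⟨_, _, hm.tensorL T, hm'.tensorL T', fun f => ?_⟩
    rw [hT']
    exact (pairing_tmap_left _ _ f).trans ((hS.pairing m m' hm hm' _).trans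
      (pairing_tmap_left _ _ f).symm)
  · obtain ⟨m, hm⟩ := exists_mark hP ⟨V, hV, h⟩
    obtain ⟨m', hm'⟩ := exists_mark hP ⟨V, hV, hT.colors ▸ h⟩
    refine ⟨_, _, hm.tensorR S, hm'.tensorR S', fun f => ?_⟩
    rw [hS']
    exact (pairing_tmap_right _ _ f).trans ((hT.pairing m m' hm hm' _).trans
      (pairing_tmap_right _ _ f).symm)

/-- The same piece is marked on both sides. The corrections stand at different heights of the
neighbouring column and slide along it, because morphisms commute with `K`. -/
lemma marksAgree_tensor_comp (S : Diagram X Y) (T : Diagram Y Z) (S' : Diagram X' Y')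
    (T' : Diagram Y' Z'') :
    MarksAgree P ((S.comp T).tensor (S'.comp T')) ((S.tensor S').comp (T.tensor T')) := by
  refine .of_common hP (by simp only [Diagram.colors]; tauto_set) fun V hV h => ?_
  rcases h with (h | h) | (h | h)
  · obtain ⟨m, hm⟩ := exists_mark hP ⟨V, hV, h⟩
    refine ⟨_, (hm.compL T).tensorL (S'.comp T'), ((hm.tensorL S').compL (T.tensor T')).congr ?_⟩
    exact TensorProduct.ext' fun x x' => rfl
  · obtain ⟨m, hm⟩ := exists_mark hP ⟨V, hV, h⟩
    refine ⟨_, (hm.compR S).tensorL (S'.comp T'), ((hm.tensorL T').compR (S.tensor S')).congr ?_⟩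
    exact TensorProduct.ext' fun x x' => congrArg (fun z => m (S.eval.toLin x) ⊗ₜ T'.eval.toLin z)
      (hom_pivotInv S'.eval x')
  · obtain ⟨m, hm⟩ := exists_mark hP ⟨V, hV, h⟩
    refine ⟨_, (hm.compL T').tensorR (S.comp T), ((hm.tensorR S).compL (T.tensor T')).congr ?_⟩
    exact TensorProduct.ext' fun x x' => rfl
  · obtain ⟨m, hm⟩ := exists_mark hP ⟨V, hV, h⟩
    refine ⟨_, (hm.compR S').tensorR (S.comp T), ((hm.tensorR T).compR (S.tensor S')).congr ?_⟩
    exact TensorProduct.ext' fun x x' => congrArg (fun z => T.eval.toLin z ⊗ₜ m (S'.eval.toLin x'))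
      (hom_pivot S.eval x)

/-- The same piece is marked on both sides; the corrections agree because the pivot is group-like,
so correcting a tensor product is correcting each factor. -/
lemma marksAgree_assoc_natural (S : Diagram X Y) (S' : Diagram X' Y') (S'' : Diagram X'' Y'') :
    MarksAgree P (((S.tensor S').tensor S'').comp (.assoc Y Y' Y''))
      ((Diagram.assoc X X' X'').comp (S.tensor (S'.tensor S''))) := by
  have hc : (((S.tensor S').tensor S'').comp (.assoc Y Y' Y'')).colors =
      S.colors ∪ S'.colors ∪ S''.colors :=
    Set.union_eq_self_of_subset_right (Set.union_subset_union (Set.union_subset_union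
      (word_colors_subset_right S) (word_colors_subset_right S')) (word_colors_subset_right S''))
  have hc' : ((Diagram.assoc X X' X'').comp (S.tensor (S'.tensor S''))).colors =
      S.colors ∪ S'.colors ∪ S''.colors :=
    (congrArg _ (Set.union_assoc _ _ _).symm).trans (Set.union_eq_self_of_subset_left
      (Set.union_subset_union (Set.union_subset_union (word_colors_subset_left S)
        (word_colors_subset_left S')) (word_colors_subset_left S'')))
  refine .of_common hP (hc.trans hc'.symm) fun V hV h => ?_
  rw [hc] at h
  rcases h with (h | h) | h
  · obtain ⟨m, hm⟩ := exists_mark hP ⟨V, hV, h⟩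
    refine ⟨_, ((hm.tensorL S').tensorL S'').compL _,
      ((hm.tensorL (S'.tensor S'')).compR _).congr ?_⟩
    rw [show (X'.tensor X'').obj.pivotInv = X'.obj.pivotInv.tmap X''.obj.pivotInv from
      pivotInv_tensor _ _]
    exact TensorProduct.ext_threefold fun x x' x'' => rfl
  · obtain ⟨m, hm⟩ := exists_mark hP ⟨V, hV, h⟩
    refine ⟨_, ((hm.tensorR S).tensorL S'').compL _, ((hm.tensorL S'').tensorR S |>.compR _).congr ?_⟩
    exact TensorProduct.ext_threefold fun x x' x'' => rfl
  · obtain ⟨m, hm⟩ := exists_mark hP ⟨V, hV, h⟩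
    refine ⟨_, (hm.tensorR (S.tensor S')).compL _,
      ((hm.tensorR S').tensorR S |>.compR _).congr ?_⟩
    rw [show (X.tensor X').obj.pivot = X.obj.pivot.tmap X'.obj.pivot from pivot_tensor _ _]
    exact TensorProduct.ext_threefold fun x x' x'' => rfl

lemma marksAgree_lunit_natural (S : Diagram X Y) :
    MarksAgree P (((Diagram.id .unit).tensor S).comp (.lunit Y)) ((Diagram.lunit X).comp S) := by
  have h1 := word_colors_subset_left S
  have h1' := word_colors_subset_right S
  have hc : (((Diagram.id .unit).tensor S).comp (.lunit Y)).colors = S.colors := by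
    simp only [Diagram.colors, Word.colors]; tauto_set
  refine .of_common hP (hc.trans (by simp only [Diagram.colors]; tauto_set)) fun V hV h => ?_
  rw [hc] at h
  obtain ⟨m, hm⟩ := exists_mark hP ⟨V, hV, h⟩
  refine ⟨_, (hm.tensorR _).compL _, (hm.compR _).congr ?_⟩
  rw [show (Word.unit : Word (WeightModule R)).obj.pivot = LinearMap.id from pivot_unit]
  exact TensorProduct.ext' fun c x => (m.map_smul (show ℂ from c) x).symm

lemma marksAgree_runit_natural (S : Diagram X Y) :
    MarksAgree P ((S.tensor (.id .unit)).comp (.runit Y)) ((Diagram.runit X).comp S) := by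
  have h1 := word_colors_subset_left S
  have h1' := word_colors_subset_right S
  have hc : ((S.tensor (.id .unit)).comp (.runit Y)).colors = S.colors := by
    simp only [Diagram.colors, Word.colors]; tauto_set
  refine .of_common hP (hc.trans (by simp only [Diagram.colors]; tauto_set)) fun V hV h => ?_
  rw [hc] at h
  obtain ⟨m, hm⟩ := exists_mark hP ⟨V, hV, h⟩
  refine ⟨_, (hm.tensorL _).compL _, (hm.compR _).congr ?_⟩
  rw [show (Word.unit : Word (WeightModule R)).obj.pivotInv = LinearMap.id from pivotInv_unit]
  exact TensorProduct.ext' fun x c => (m.map_smul (show ℂ from c) x).symm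

lemma marksAgree_full_turn (S : Diagram X Y) : MarksAgree P S.rotL S.rotR := by
  refine .of_exists hP ((colors_rotL S).trans (colors_rotR S).symm) fun V hV h => ?_
  rw [colors_rotL] at h
  obtain ⟨m, hm⟩ := exists_mark hP ⟨V, hV, h⟩
  obtain ⟨n, hn, hn'⟩ := hm.exists_transpose
  exact ⟨n, n, hn, hn', fun f => rfl⟩

omit hP in
-- Each elementary move is an axiom of a pivotal tensor category, except for the full turn, where
-- both half-turns evaluate to the transpose.
lemma eval_isotopic {S T : Diagram X Y} (h : Diagram.Isotopic S T) : S.eval = T.eval := by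
  induction h with
  | refl S => rfl
  | symm h ih => exact ih.symm
  | trans h h' ih ih' => exact ih.trans ih'
  | comp h h' ih ih' => exact congrArg₂ CategoryStruct.comp ih ih'
  | tensor h h' ih ih' => exact congrArg₂ MonoidalCategoryStruct.tensorHom ih ih'
  | id_comp S => exact Category.id_comp _
  | comp_id S => exact Category.comp_id _
  | comp_assoc S T U => exact Category.assoc _ _ _
  | tensor_id X Y => exact id_tensorHom_id _ _
  | tensor_comp S T S' T' => exact (tensorHom_comp_tensorHom _ _ _ _).symm
  | assoc_assocInv X Y Z => exact Iso.hom_inv_id _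
  | assocInv_assoc X Y Z => exact Iso.inv_hom_id _
  | lunit_lunitInv X => exact Iso.hom_inv_id _
  | lunitInv_lunit X => exact Iso.inv_hom_id _
  | runit_runitInv X => exact Iso.hom_inv_id _
  | runitInv_runit X => exact Iso.inv_hom_id _
  | assoc_natural S S' S'' => exact associator_naturality _ _ _
  | lunit_natural S => exact leftUnitor_naturality _
  | runit_natural S => exact rightUnitor_naturality _
  | pentagon X Y Z W => exact pentagon _ _ _ _
  | triangle X Y => exact triangle _ _
  | straighten V => exact Pivotal.zigzag V
  | straighten_dual V => exact Pivotal.zigzag_dual V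
  | straighten' V => exact Pivotal.zigzag' V
  | straighten_dual' V => exact Pivotal.zigzag_dual' V
  | full_turn S => exact Hom.ext (LinearMap.ext fun ξ => (eval_rotL S ξ).trans (eval_rotR S ξ).symm)

/-- Moves without a free diagram show all their colors on the boundary and need only the equality of
values. In the others the mark is carried along with the diagram that moves. -/
lemma marksAgree_isotopic {S T : Diagram X Y} (h : Diagram.Isotopic S T) : MarksAgree P S T := by
  have bd : ∀ {X Y : Word (WeightModule R)} {S T : Diagram X Y}, Diagram.Isotopic S T →
      S.colors = T.colors → S.colors ⊆ X.colors ∪ Y.colors → MarksAgree P S T :=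
    fun h hc h' => .of_boundary hP (eval_isotopic h) hc h'
  induction h with
  | refl S => exact ⟨rfl, fun m m' h h' f => h.pairing_eq hP h' f⟩
  | symm h ih => exact ih.symm
  | trans h h' ih ih' => exact ih.trans hP ih'
  | comp h h' ih ih' => exact ih.comp hP (eval_isotopic h) ih' (eval_isotopic h')
  | tensor h h' ih ih' => exact ih.tensor hP (eval_isotopic h) ih' (eval_isotopic h')
  | id_comp S =>
    have hc : ((Diagram.id _).comp S).colors = S.colors :=
      Set.union_eq_self_of_subset_left (word_colors_subset_left S)
    refine .of_common hP hc fun V hV h => ?_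
    obtain ⟨m, hm⟩ := exists_mark hP ⟨V, hV, hc ▸ h⟩
    exact ⟨m, hm.compR _, hm⟩
  | comp_id S =>
    have hc : (S.comp (Diagram.id _)).colors = S.colors :=
      Set.union_eq_self_of_subset_right (word_colors_subset_right S)
    refine .of_common hP hc fun V hV h => ?_
    obtain ⟨m, hm⟩ := exists_mark hP ⟨V, hV, hc ▸ h⟩
    exact ⟨m, hm.compL _, hm⟩
  | comp_assoc S T U =>
    refine .of_common hP (Set.union_assoc _ _ _) fun V hV h => ?_
    rcases h with (h | h) | h
    · obtain ⟨m, hm⟩ := exists_mark hP ⟨V, hV, h⟩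
      exact ⟨_, (hm.compL T).compL U, hm.compL (T.comp U)⟩
    · obtain ⟨m, hm⟩ := exists_mark hP ⟨V, hV, h⟩
      exact ⟨_, (hm.compR S).compL U, (hm.compL U).compR S⟩
    · obtain ⟨m, hm⟩ := exists_mark hP ⟨V, hV, h⟩
      exact ⟨_, hm.compR (S.comp T), (hm.compR T).compR S⟩
  | tensor_comp S T S' T' => exact marksAgree_tensor_comp hP S T S' T'
  | assoc_natural S S' S'' => exact marksAgree_assoc_natural hP S S' S''
  | lunit_natural S => exact marksAgree_lunit_natural hP S
  | runit_natural S => exact marksAgree_runit_natural hP S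
  | full_turn S => exact marksAgree_full_turn hP S
  | tensor_id X Y => exact bd (.tensor_id X Y) rfl (by simp [Diagram.colors, Word.colors])
  | assoc_assocInv X Y Z =>
    exact bd (.assoc_assocInv X Y Z) (by simp [Diagram.colors, Word.colors])
      (by simp [Diagram.colors, Word.colors])
  | assocInv_assoc X Y Z =>
    exact bd (.assocInv_assoc X Y Z) (by simp [Diagram.colors, Word.colors, Set.union_assoc])
      (by simp [Diagram.colors, Word.colors, Set.union_assoc])
  | lunit_lunitInv X =>
    exact bd (.lunit_lunitInv X) (by simp [Diagram.colors, Word.colors])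
      (by simp [Diagram.colors, Word.colors])
  | lunitInv_lunit X =>
    exact bd (.lunitInv_lunit X) (by simp [Diagram.colors])
      (by simp [Diagram.colors])
  | runit_runitInv X =>
    exact bd (.runit_runitInv X) (by simp [Diagram.colors, Word.colors])
      (by simp [Diagram.colors, Word.colors])
  | runitInv_runit X =>
    exact bd (.runitInv_runit X) (by simp [Diagram.colors])
      (by simp [Diagram.colors])
  | pentagon X Y Z W =>
    exact bd (.pentagon X Y Z W) (by simp only [Diagram.colors, Word.colors]; tauto_set)
      (by simp only [Diagram.colors, Word.colors]; tauto_set)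
  | triangle X Y =>
    exact bd (.triangle X Y) (by simp only [Diagram.colors, Word.colors]; tauto_set)
      (by simp only [Diagram.colors, Word.colors]; tauto_set)
  | straighten V =>
    exact bd (.straighten V) (by simp [Diagram.colors, Word.colors])
      (by simp [Diagram.colors, Word.colors])
  | straighten_dual V =>
    exact bd (.straighten_dual V) (by simp [Diagram.colors, Word.colors])
      (by simp [Diagram.colors, Word.colors])
  | straighten' V =>
    exact bd (.straighten' V) (by simp [Diagram.colors, Word.colors])
      (by simp [Diagram.colors, Word.colors])
  | straighten_dual' V =>
    exact bd (.straighten_dual' V) (by simp [Diagram.colors, Word.colors])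
      (by simp [Diagram.colors, Word.colors])

lemma marksAgree_sphereIsotopic {S T : Diagram (.unit : Word (WeightModule R)) .unit}
    (h : Diagram.SphereIsotopic S T) : MarksAgree P S T := by
  induction h with
  | plane h => exact marksAgree_isotopic hP h
  | across S =>
    -- Passing an arc across infinity is harmless: both marked closures are the scalar `closeValue
    -- m`.
    refine .of_common hP ((colors_closeR S).trans (colors_closeL S).symm) fun V hV h => ?_
    rw [colors_closeR] at h
    obtain ⟨m, hm⟩ := exists_mark hP ⟨V, hV, h⟩
    exact ⟨_, hm.closeR, hm.closeL⟩
  | symm h ih => exact ih.symm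
  | trans h h' ih ih' => exact ih.trans hP ih'

/-- Cutting presentations of the same graph have the same traces after marking. -/
lemma trace_mark_eq {T : Diagram (.unit : Word (WeightModule R)) .unit} {V W : WeightModule R}
    {A : Diagram (.strand V true) (.strand V true)} {B : Diagram (.strand W true) (.strand W true)}
    (hA : T.IsCuttingPresentation A) (hB : T.IsCuttingPresentation B) {m : Lin V V} {n : Lin W W}
    (hm : Mark P A m) (hn : Mark P B n) :
    LinearMap.trace ℂ V.carrier m = LinearMap.trace ℂ W.carrier n := by
  -- The marked closures are scalars on the unit object, and pairing with its identity returns the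
  -- scalar.
  have h := (marksAgree_sphereIsotopic hP (hA.trans hB.symm)).pairing _ _ hm.closeR hn.closeR (𝟙 _)
  have key : ∀ c : ℂ, Lin.pairing (scalar R c) (𝟙 (𝟙_ (WeightModule R))) = c := by
    intro c
    refine Eq.trans (b := LinearMap.trace ℂ ℂ (c • LinearMap.id)) rfl ?_
    simp
  rw [← closeValue_strand, ← closeValue_strand]
  exact (key _).symm.trans (h.trans (key _))

end IsotopyInvariance

end UqSl2

/-! ### Highest weight vectors -/

namespace UqSl2

open Ubar Pivotal WeightModule
open scoped TensorProduct

variable {R : RootData}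

/-- The scalars in `E F^n w = c_n F^(n-1) w` for a highest weight vector `w` with `K w = lam w`. -/
noncomputable def vermaCoeff (R : RootData) (lam : ℂ) (n : ℕ) : ℂ :=
  ∑ l ∈ Finset.range n, (R.q - R.q⁻¹)⁻¹ * (lam * R.q⁻¹ ^ (2 * l) - lam⁻¹ * R.q ^ (2 * l))

lemma vermaCoeff_zero (lam : ℂ) : vermaCoeff R lam 0 = 0 := Finset.sum_range_zero _

lemma vermaCoeff_succ (lam : ℂ) (n : ℕ) : vermaCoeff R lam (n + 1) = vermaCoeff R lam n +
    (R.q - R.q⁻¹)⁻¹ * (lam * R.q⁻¹ ^ (2 * n) - lam⁻¹ * R.q ^ (2 * n)) :=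
  Finset.sum_range_succ _ _

/-- Highest weights whose highest weight modules of dimension `r` are simple. -/
def Typical (R : RootData) (lam : ℂ) : Prop := ∀ n, n + 1 < R.r → vermaCoeff R lam (n + 1) ≠ 0

/-- The vectors `F^n w`. -/
def descend (V : WeightModule R) (w : V.carrier) (n : ℕ) : V.carrier := V.ρ (gen R .F ^ n) w

/-- Highest weight vectors. -/
structure IsHighestVector (V : WeightModule R) (lam : ℂ) (w : V.carrier) : Prop where
  ne_zero : w ≠ 0
  K : V.ρ (gen R .K) w = lam • w
  E : V.ρ (gen R .E) w = 0

section

variable {V : WeightModule R} {w : V.carrier} {lam : ℂ}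

lemma descend_zero : descend V w 0 = w := by
  rw [descend, pow_zero, map_one, Module.End.one_apply]

lemma F_descend (n : ℕ) : V.ρ (gen R .F) (descend V w n) = descend V w (n + 1) := by
  rw [descend, descend, pow_succ', map_mul, Module.End.mul_apply]

lemma descend_eq_zero {n : ℕ} (hn : R.r ≤ n) : descend V w n = 0 := by
  rw [descend, ← Nat.sub_add_cancel hn, pow_add, satisfies_gen.F_pow, mul_zero, map_zero,
    LinearMap.zero_apply]

lemma rep_Kinv_of_K {x : V.carrier} {c : ℂ} (hc : c ≠ 0) (h : V.ρ (gen R .K) x = c • x) :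
    V.ρ (gen R .Kinv) x = c⁻¹ • x := by
  rw [eq_inv_smul_iff₀ hc, ← map_smul, ← h, rep_Kinv_K]

lemma rep_E_F (x : V.carrier) : V.ρ (gen R .E) (V.ρ (gen R .F) x) =
    V.ρ (gen R .F) (V.ρ (gen R .E) x) +
      (R.q - R.q⁻¹)⁻¹ • (V.ρ (gen R .K) x - V.ρ (gen R .Kinv) x) := by
  have h := congrArg (fun a => V.ρ a x) (satisfies_gen (R := R)).E_F
  simp only [map_sub, map_mul, map_smul, LinearMap.sub_apply, LinearMap.smul_apply,
    Module.End.mul_apply] at h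
  rw [← h, add_sub_cancel]

end

namespace IsHighestVector

variable {V : WeightModule R} {w : V.carrier} {lam : ℂ} (h : IsHighestVector V lam w)

include h

lemma lam_ne : lam ≠ 0 := by
  rintro rfl
  have h1 := h.K
  rw [zero_smul] at h1
  exact h.ne_zero (by rw [← rep_Kinv_K (ρ := V.ρ) w, h1, map_zero])

lemma K_descend (n : ℕ) : V.ρ (gen R .K) (descend V w n) =
    (lam * R.q⁻¹ ^ (2 * n)) • descend V w n := by
  induction n with
  | zero => rw [descend_zero, h.K]; simp
  | succ n ih =>
    rw [← F_descend, ← Module.End.mul_apply, ← map_mul, satisfies_gen.KF, map_smul, map_mul,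
      LinearMap.smul_apply, Module.End.mul_apply, ih, map_smul, smul_smul]
    congr 1
    ring

lemma Kinv_descend (n : ℕ) : V.ρ (gen R .Kinv) (descend V w n) =
    (lam⁻¹ * R.q ^ (2 * n)) • descend V w n := by
  rw [rep_Kinv_of_K (mul_ne_zero h.lam_ne (pow_ne_zero _ (inv_ne_zero R.q_ne))) (h.K_descend n),
    mul_inv, inv_pow, inv_inv]

lemma E_descend (n : ℕ) : V.ρ (gen R .E) (descend V w n) =
    vermaCoeff R lam n • descend V w (n - 1) := by
  induction n with
  | zero => rw [descend_zero, h.E, vermaCoeff_zero, zero_smul]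
  | succ n ih =>
    rw [← F_descend, rep_E_F, ih, h.K_descend, h.Kinv_descend, map_smul, F_descend,
      vermaCoeff_succ, add_smul, Nat.add_sub_cancel, ← sub_smul, smul_smul]
    congr 1
    cases n with
    | zero => rw [vermaCoeff_zero, zero_smul, zero_smul]
    | succ n => rfl

lemma E_pow_descend (n : ℕ) : V.ρ (gen R .E ^ n) (descend V w n) =
    (∏ l ∈ Finset.range n, vermaCoeff R lam (l + 1)) • w := by
  induction n with
  | zero => simp [descend_zero]
  | succ n ih =>
    rw [pow_succ, map_mul, Module.End.mul_apply, h.E_descend, map_smul, Nat.add_sub_cancel, ih,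
      smul_smul, Finset.prod_range_succ, mul_comm]

/-- `E^n` brings `F^n w` back to a multiple of `w`, non-zero for typical weights. -/
lemma descend_ne_zero (hT : Typical R lam) {n : ℕ} (hn : n < R.r) : descend V w n ≠ 0 := by
  intro h0
  have h1 := h.E_pow_descend n
  rw [h0, map_zero] at h1
  exact smul_ne_zero (Finset.prod_ne_zero_iff.2 fun l hl => hT l
    (by have := Finset.mem_range.1 hl; omega)) h.ne_zero h1.symm

/-- The vectors `F^n w` have the `K`-eigenvalues `lam q^(-2n)`, distinct for `n < r` since `q²` has
order `r`. -/
lemma linearIndependent (hT : Typical R lam) :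
    LinearIndependent ℂ (fun n : Fin R.r => descend V w n) := by
  refine Module.End.eigenvectors_linearIndependent' (V.ρ (gen R .K))
    (fun n : Fin R.r => lam * R.q⁻¹ ^ (2 * (n : ℕ))) ?_ _ fun n =>
      ⟨Module.End.mem_eigenspace_iff.2 (h.K_descend n), h.descend_ne_zero hT n.2⟩
  intro m n hmn
  have h1 := mul_left_cancel₀ h.lam_ne hmn
  rw [inv_pow, inv_pow, inv_inj, pow_mul, pow_mul] at h1
  have hr := R.one_lt
  exact Fin.ext (R.isPrimitiveRoot.pow_inj (by omega) (by omega) h1)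

/-- The span of the `F^n w`, `n < r`, is stable under the generators and contains the generating
vector `w`, so it is everything. -/
lemma finrank_eq (hT : Typical R lam) (hg : ∀ x : V.carrier, ∃ a : Ubar R, V.ρ a w = x) :
    Module.finrank ℂ V.carrier = R.r := by
  refine le_antisymm ?_ ?_
  · set S : Submodule ℂ V.carrier := Submodule.span ℂ (Set.range fun n : Fin R.r => descend V w n)
    have hd : ∀ n, descend V w n ∈ S := fun n => by
      rcases lt_or_ge n R.r with hn | hn
      · exact Submodule.subset_span ⟨⟨n, hn⟩, rfl⟩
      · rw [descend_eq_zero hn]; exact S.zero_mem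
    have hS : ∀ (a : Ubar R), ∀ x ∈ S, V.ρ a x ∈ S := by
      intro a
      induction a using Ubar.induction with
      | hs c => intro x hx; rw [AlgHom.commutes]; exact S.smul_mem c hx
      | hadd a b ha hb => intro x hx; rw [map_add]; exact S.add_mem (ha x hx) (hb x hx)
      | hmul a b ha hb => intro x hx; rw [map_mul]; exact ha _ (hb x hx)
      | hg g =>
        intro x hx
        induction hx using Submodule.span_induction with
        | zero => rw [map_zero]; exact S.zero_mem
        | add x y _ _ hx hy => rw [map_add]; exact S.add_mem hx hy
        | smul c x _ hx => rw [map_smul]; exact S.smul_mem c hx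
        | mem x hx =>
          obtain ⟨n, rfl⟩ := hx
          cases g
          · simp only [h.E_descend]; exact S.smul_mem _ (hd _)
          · simp only [F_descend]; exact hd _
          · simp only [h.K_descend]; exact S.smul_mem _ (hd _)
          · simp only [h.Kinv_descend]; exact S.smul_mem _ (hd _)
    have htop : S = ⊤ := by
      refine eq_top_iff.2 fun x _ => ?_
      obtain ⟨a, rfl⟩ := hg x
      exact hS a w (by have := hd 0; rwa [descend_zero] at this)
    have h1 := finrank_range_le_card (R := ℂ) (fun n : Fin R.r => descend V w n)
    rw [Set.finrank, show Submodule.span ℂ (Set.range fun n : Fin R.r => descend V w n) = ⊤ from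
      htop, finrank_top, Fintype.card_fin] at h1
    exact h1
  · have h1 := (h.linearIndependent hT).fintype_card_le_finrank
    rwa [Fintype.card_fin] at h1

end IsHighestVector

/-- A module of dimension `r` with a highest weight vector of typical weight. -/
structure IsTypical (V : WeightModule R) (lam : ℂ) (w : V.carrier) : Prop
    extends IsHighestVector V lam w where
  typical : Typical R lam
  finrank : Module.finrank ℂ V.carrier = R.r

instance (R : RootData) : NeZero R.r := ⟨by have := R.one_lt; omega⟩

namespace IsTypical

variable {V W : WeightModule R} {w : V.carrier} {w' : W.carrier} {lam lam' : ℂ}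
  (h : IsTypical V lam w) (h' : IsTypical W lam' w')

/-- The basis `F^n w`. -/
noncomputable def basis : Module.Basis (Fin R.r) ℂ V.carrier :=
  basisOfLinearIndependentOfCardEqFinrank (h.linearIndependent h.typical)
    (by rw [Fintype.card_fin, h.finrank])

lemma basis_apply (n : Fin R.r) : h.basis n = descend V w n := by
  rw [basis, coe_basisOfLinearIndependentOfCardEqFinrank]

lemma basis_mk {n : ℕ} (hn : n < R.r) : h.basis ⟨n, hn⟩ = descend V w n := h.basis_apply _

lemma repr_descend {n : ℕ} (hn : n < R.r) (m : Fin R.r) :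
    h.basis.repr (descend V w n) m = if n = m then 1 else 0 := by
  rw [← h.basis_mk hn, Module.Basis.repr_self, Finsupp.single_apply]
  simp only [Fin.ext_iff]

lemma repr_self (m : Fin R.r) : h.basis.repr w m = if 0 = (m : ℕ) then 1 else 0 := by
  have := h.repr_descend (n := 0) (by have := R.one_lt; omega) m
  rwa [descend_zero] at this

lemma coord_E (n : ℕ) (hn : n + 1 < R.r) (x : V.carrier) :
    h.basis.coord ⟨n, by omega⟩ (V.ρ (gen R .E) x) =
      vermaCoeff R lam (n + 1) * h.basis.coord ⟨n + 1, hn⟩ x := by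
  have e : h.basis.coord ⟨n, by omega⟩ ∘ₗ V.ρ (gen R .E) =
      vermaCoeff R lam (n + 1) • h.basis.coord ⟨n + 1, hn⟩ := by
    refine h.basis.ext fun ⟨m, hm⟩ => ?_
    rw [LinearMap.comp_apply, basis_apply, h.E_descend, map_smul, LinearMap.smul_apply,
      Module.Basis.coord_apply, Module.Basis.coord_apply, h.repr_descend hm,
      h.repr_descend (show m - 1 < R.r by omega)]
    cases m with
    | zero => simp [vermaCoeff_zero]
    | succ m =>
      simp only [Nat.add_sub_cancel, Nat.add_right_cancel_iff]
      split_ifs with hmn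
      · rw [hmn]
      · simp
  exact LinearMap.congr_fun e x

/-- Highest weight vectors are unique up to scalars. -/
lemma eq_smul_of_E_eq_zero {x : V.carrier} (hx : V.ρ (gen R .E) x = 0) :
    x = h.basis.coord 0 x • w := by
  refine h.basis.ext_elem fun ⟨n, hn⟩ => ?_
  rw [map_smul, Finsupp.smul_apply, h.repr_self]
  cases n with
  | zero => simp
  | succ n =>
    have h1 := h.coord_E n hn x
    rw [hx, map_zero] at h1
    simpa using (mul_eq_zero.1 h1.symm).resolve_left (h.typical n hn)

lemma hom_descend (g : V ⟶ W) (n : ℕ) : g.toLin (descend V w n) = descend W (g.toLin w) n :=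
  g.comm _ _

include h h' in
-- The image of `w` is killed by `E`, hence a multiple of `w'`; comparing `K`-eigenvalues forces it
-- to vanish unless the weights agree.
lemma exists_hom_smul (g : V ⟶ W) : ∃ a : ℂ, g.toLin w = a • w' ∧ (a = 0 ∨ lam = lam') := by
  have hE : W.ρ (gen R .E) (g.toLin w) = 0 := by rw [← g.comm, h.E, map_zero]
  have hK : W.ρ (gen R .K) (g.toLin w) = lam • g.toLin w := by rw [← g.comm, h.K, map_smul]
  have e := h'.eq_smul_of_E_eq_zero hE
  refine ⟨_, e, ?_⟩
  set a := h'.basis.coord 0 (g.toLin w)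
  rw [e, map_smul, h'.K, smul_smul, smul_smul] at hK
  have h2 := smul_left_injective ℂ h'.ne_zero hK
  rw [mul_comm] at h2
  by_cases ha : a = 0
  · exact Or.inl ha
  · exact Or.inr (mul_right_cancel₀ ha h2).symm

include h in
lemma hom_ext_descend {f g : V.carrier →ₗ[ℂ] W.carrier}
    (hfg : ∀ n < R.r, f (descend V w n) = g (descend V w n)) : f = g :=
  h.basis.ext fun n => by rw [basis_apply]; exact hfg n n.2

include h h' in
lemma hom_eq_zero (hne : lam ≠ lam') (g : V ⟶ W) : g = 0 := by
  obtain ⟨a, ha, h0⟩ := h.exists_hom_smul h' g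
  rw [h0.resolve_right hne, zero_smul] at ha
  refine Hom.ext (h.hom_ext_descend fun n _ => ?_)
  rw [hom_descend, ha, descend, map_zero]
  rfl

include h in
lemma end_eq_smul (g : V ⟶ V) : ∃ a : ℂ, g.toLin = a • LinearMap.id := by
  obtain ⟨a, ha, -⟩ := h.exists_hom_smul h g
  refine ⟨a, h.hom_ext_descend fun n _ => ?_⟩
  rw [hom_descend, ha, descend, map_smul]
  rfl

include h in
/-- Typical modules are projective relative to `K`. -/
lemma exists_avg_eq_id : ∃ k : Lin V V, k.WP ∧ k.avg = LinearMap.id ∧ LinearMap.trace ℂ _ k =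
    (∏ n ∈ Finset.range (R.r - 1), vermaCoeff R lam (n + 1))⁻¹ := by
  set c := ∏ n ∈ Finset.range (R.r - 1), vermaCoeff R lam (n + 1) with hc
  have hc0 : c ≠ 0 := Finset.prod_ne_zero_iff.2 fun l hl => h.typical l
    (by have := Finset.mem_range.1 hl; omega)
  -- The projection onto the line of `w` along the other vectors `F^n w`.
  set k : Lin V V := (h.basis.coord 0).smulRight w with hk
  have hkw : k w = w := by
    rw [hk, LinearMap.smulRight_apply, Module.Basis.coord_apply, h.repr_self]
    simp
  have hkd : ∀ n, 0 < n → k (descend V w n) = 0 := by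
    intro n hn
    rcases lt_or_ge n R.r with hr | hr
    · rw [hk, LinearMap.smulRight_apply, Module.Basis.coord_apply, h.repr_descend hr]
      simp [hn.ne']
    · rw [descend_eq_zero hr, map_zero]
  have hwp : k.WP := by
    intro x
    have e : k ∘ₗ V.ρ (gen R .K) = V.ρ (gen R .K) ∘ₗ k := by
      refine h.hom_ext_descend fun n _ => ?_
      rw [LinearMap.comp_apply, LinearMap.comp_apply, h.K_descend, map_smul]
      cases n with
      | zero => rw [descend_zero, hkw, h.K]; simp
      | succ n => rw [hkd _ n.succ_pos, smul_zero, map_zero]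
    exact LinearMap.congr_fun e x
  have hF : powSum V.ρ V.ρ (gen R .F) k w = descend V w (R.r - 1) := by
    -- In `∑ F^a k F^(r-1-a) w` only `a = r - 1` survives, as `k` kills `F^n w` for `n > 0`.
    rw [powSum, LinearMap.sum_apply, LinearMap.sum_apply, Finset.sum_eq_single (R.r - 1)]
    · rw [sandwich_apply, Nat.sub_self, pow_zero, map_one, Module.End.one_apply, hkw]
      rfl
    · intro a ha hne
      have := Finset.mem_range.1 ha
      rw [sandwich_apply]
      exact (congrArg _ (hkd _ (by omega))).trans (map_zero _)
    · intro hn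
      exact absurd (Finset.mem_range.2 (by have := R.one_lt; omega)) hn
  have hav : k.avg w = c • w := by
    have e : k.avg w = powSum V.ρ V.ρ (gen R .E) (powSum V.ρ V.ρ (gen R .F) k) w := rfl
    rw [e, powSum, LinearMap.sum_apply, LinearMap.sum_apply, Finset.sum_eq_single (R.r - 1)]
    · rw [sandwich_apply, Nat.sub_self, pow_zero, map_one, Module.End.one_apply, hF,
        h.E_pow_descend]
    · intro a ha hne
      have := Finset.mem_range.1 ha
      rw [sandwich_apply, show R.r - 1 - a = (R.r - 1 - a - 1) + 1 by omega, pow_succ, map_mul,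
        Module.End.mul_apply, h.E, map_zero, map_zero, map_zero]
    · intro hn
      exact absurd (Finset.mem_range.2 (by have := R.one_lt; omega)) hn
  have hav' : k.avg = c • LinearMap.id := by
    -- The average is a morphism and `w` generates the basis under `F`, so its value at `w`
    -- determines it.
    refine h.hom_ext_descend fun n _ => ?_
    have e := hwp.equivariant_avg.comm (gen R .F ^ n) w
    refine e.trans ?_
    rw [show UqSl2.avg V.ρ V.ρ k w = c • w from hav, map_smul]
    rfl
  refine ⟨c⁻¹ • k, fun x => ?_, ?_, ?_⟩
  · rw [LinearMap.smul_apply, LinearMap.smul_apply, hwp, map_smul]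
  · have e : Lin.avg (c⁻¹ • k) = c⁻¹ • k.avg := map_smul (UqSl2.avg V.ρ V.ρ) c⁻¹ k
    rw [e, hav', smul_smul, inv_mul_cancel₀ hc0, one_smul]
  · rw [map_smul, smul_eq_mul, trace_eq_sum_repr h.basis, Finset.sum_eq_single 0]
    · have e : h.basis 0 = w := (h.basis_apply 0).trans descend_zero
      rw [e, hkw, h.repr_self]
      simp
    · intro n _ hn
      rw [basis_apply, hkd _ (Nat.pos_of_ne_zero fun h0 => hn (Fin.ext h0)), map_zero]
      rfl
    · exact fun hn => absurd (Finset.mem_univ _) hn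

include h in
lemma isProj : IsProj V := by
  obtain ⟨k, hk, hk1, -⟩ := h.exists_avg_eq_id
  exact ⟨k, hk, hk1⟩

/-- Typical modules of the same highest weight are isomorphic. -/
noncomputable def iso (h' : IsTypical W lam w') : V ≅ W :=
  mkIso (h.basis.equiv h'.basis (Equiv.refl _)) (by
    have key : ∀ n, h.basis.equiv h'.basis (Equiv.refl _) (descend V w n) = descend W w' n := by
      intro n
      rcases lt_or_ge n R.r with hr | hr
      · rw [← h.basis_mk hr, Module.Basis.equiv_apply, h'.basis_apply]
        rfl
      · rw [descend_eq_zero hr, descend_eq_zero hr, map_zero]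
    intro g x
    have e : (h.basis.equiv h'.basis (Equiv.refl _)).toLinearMap ∘ₗ V.ρ (gen R g) =
        W.ρ (gen R g) ∘ₗ (h.basis.equiv h'.basis (Equiv.refl _)).toLinearMap := by
      refine h.hom_ext_descend fun n _ => ?_
      rw [LinearMap.comp_apply, LinearMap.comp_apply, LinearEquiv.coe_coe, key]
      cases g
      · rw [h.E_descend, h'.E_descend, map_smul, key]
      · rw [F_descend, F_descend, key]
      · rw [h.K_descend, h'.K_descend, map_smul, key]
      · rw [h.Kinv_descend, h'.Kinv_descend, map_smul, key]
    exact LinearMap.congr_fun e x)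

/-- The last index of the basis `F^n w`. -/
def lastIndex (R : RootData) : Fin R.r := ⟨R.r - 1, by have := R.one_lt; omega⟩

/-- `K` acts on the dual through `K⁻¹`, so the lowest weight `lam q^(-2(r-1))` of `V` becomes,
inverted, the highest weight. The last coordinate is killed by `E` because `E` decreases the index.
-/
lemma dual_isHighestVector : IsHighestVector (WeightModule.dual V)
    (lam⁻¹ * R.q ^ (2 * (R.r - 1))) (h.basis.coord (lastIndex R)) where
  ne_zero h0 := by
    have e : h.basis.coord (lastIndex R) (h.basis (lastIndex R)) = 0 := LinearMap.congr_fun h0 _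
    simp at e
  K := by
    have e : (WeightModule.dual V).ρ (gen R .K) (h.basis.coord (lastIndex R)) =
      h.basis.coord (lastIndex R) ∘ₗ V.ρ (gen R .Kinv) :=
        congrArg (fun f => f (h.basis.coord (lastIndex R))) (dualRep_gen (ρ := V.ρ) .K)
    rw [e]
    refine h.basis.ext fun n => ?_
    rw [LinearMap.comp_apply, basis_apply, h.Kinv_descend, map_smul]
    by_cases hn : n = lastIndex R
    · subst hn; rfl
    · rw [← h.basis_apply]
      have h0 : h.basis.coord (lastIndex R) (h.basis n) = 0 := by
        rw [Module.Basis.coord_apply, Module.Basis.repr_self, Finsupp.single_eq_of_ne (Ne.symm hn)]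
      rw [h0, smul_zero]
      exact ((congrArg ((lam⁻¹ * R.q ^ (2 * (R.r - 1))) * ·) h0).trans (mul_zero _)).symm
  E := by
    have e : (WeightModule.dual V).ρ (gen R .E) (h.basis.coord (lastIndex R)) =
      h.basis.coord (lastIndex R) ∘ₗ V.ρ (-(gen R .E * gen R .Kinv)) :=
        congrArg (fun f => f (h.basis.coord (lastIndex R))) (dualRep_gen (ρ := V.ρ) .E)
    rw [e]
    refine h.basis.ext fun ⟨n, hn⟩ => ?_
    rw [LinearMap.comp_apply, basis_apply, map_neg, LinearMap.neg_apply, map_mul,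
      Module.End.mul_apply, h.Kinv_descend, map_smul, h.E_descend, map_neg, map_smul, map_smul]
    -- The index `n - 1` never equals `r - 1`; for `n = 0` truncation makes it `0`, which differs
    -- since `r > 1`.
    rw [Module.Basis.coord_apply, h.repr_descend (show n - 1 < R.r by omega),
      if_neg (by have := R.one_lt; simp only [lastIndex]; omega), smul_zero, smul_zero, neg_zero]
    rfl

end IsTypical

end UqSl2

/-! ### Weights -/

namespace UqSl2

open Ubar Pivotal WeightModule

section Weights

variable {R : RootData}

lemma RootData.qpow_add (x y : ℂ) : R.qpow (x + y) = R.qpow x * R.qpow y := by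
  rw [RootData.qpow, RootData.qpow, RootData.qpow, ← Complex.exp_add]
  congr 1
  ring

lemma RootData.qpow_natCast (n : ℕ) : R.qpow n = R.q ^ n := by
  rw [RootData.q, RootData.qpow, RootData.qpow, ← Complex.exp_nat_mul]
  congr 1
  ring

/-- `q^r = e^(kπi)` and `k` is odd. -/
lemma RootData.q_pow_r (R : RootData) : R.q ^ R.r = -1 := by
  obtain ⟨m, hm⟩ := R.odd_k
  have hr := R.r_ne
  have hk : (R.k : ℂ) = 2 * m + 1 := by exact_mod_cast congrArg (Int.cast : ℤ → ℂ) hm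
  rw [← RootData.qpow_natCast, RootData.qpow, show (R.r : ℂ) * R.k * Complex.I * Real.pi / R.r =
    m * (2 * Real.pi * Complex.I) + Real.pi * Complex.I by field_simp; rw [hk]; ring,
    Complex.exp_add, Complex.exp_int_mul_two_pi_mul_I, Complex.exp_pi_mul_I, one_mul]

lemma Weight.qpow_coe (x : ℂ) : Weight.qpow (x : Weight R) = R.qpow x := R.qpow_periodic.lift_coe x

lemma Weight.qpow_add (x y : Weight R) : (x + y).qpow = x.qpow * y.qpow := by
  induction x using QuotientAddGroup.induction_on with | H x =>
  induction y using QuotientAddGroup.induction_on with | H y =>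
  rw [← QuotientAddGroup.mk_add, Weight.qpow_coe, Weight.qpow_coe, Weight.qpow_coe,
    RootData.qpow_add]

lemma Weight.qpow_ne_zero (x : Weight R) : x.qpow ≠ 0 := by
  induction x using QuotientAddGroup.induction_on with | H x =>
  rw [Weight.qpow_coe]
  exact Complex.exp_ne_zero _

lemma Weight.qpow_zero : (0 : Weight R).qpow = 1 := by
  have h := Weight.qpow_add (0 : Weight R) 0
  rw [add_zero] at h
  exact (mul_eq_left₀ (Weight.qpow_ne_zero _)).1 h.symm

lemma Weight.qpow_neg (x : Weight R) : (-x).qpow = x.qpow⁻¹ := by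
  refine eq_inv_of_mul_eq_one_left ?_
  rw [← Weight.qpow_add, neg_add_cancel, Weight.qpow_zero]

lemma Weight.qpow_natCast (n : ℕ) : Weight.qpow ((n : ℂ) : Weight R) = R.q ^ n := by
  rw [Weight.qpow_coe, RootData.qpow_natCast]

lemma Weight.qpow_eq_one_iff {x : ℂ} : R.qpow x = 1 ↔ ∃ m : ℤ, x = m * R.period := by
  have hr := R.r_ne
  have hk := R.k_ne
  have hpi : (2 * Real.pi * Complex.I : ℂ) ≠ 0 := Complex.two_pi_I_ne_zero
  rw [RootData.qpow, Complex.exp_eq_one_iff]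
  refine exists_congr fun m => ?_
  rw [RootData.period]
  have e : x * R.k * Complex.I * Real.pi / R.r = x * (R.k / (2 * R.r)) *
    (2 * Real.pi * Complex.I) := by field_simp
  rw [e, mul_left_inj' hpi]
  constructor
  · intro h
    rw [← h]
    field_simp
  · rintro rfl
    field_simp

lemma Weight.qpow_injective : Function.Injective (Weight.qpow : Weight R → ℂ) := by
  intro x y h
  induction x using QuotientAddGroup.induction_on with | H x =>
  induction y using QuotientAddGroup.induction_on with | H y =>
  rw [Weight.qpow_coe, Weight.qpow_coe] at h
  have h1 : R.qpow (-x + y) = 1 := by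
    rw [← Weight.qpow_coe, QuotientAddGroup.mk_add, Weight.qpow_add, QuotientAddGroup.mk_neg,
      Weight.qpow_neg, Weight.qpow_coe, Weight.qpow_coe, h,
      inv_mul_cancel₀ (by rw [← Weight.qpow_coe]; exact Weight.qpow_ne_zero _)]
  obtain ⟨m, hm⟩ := Weight.qpow_eq_one_iff.1 h1
  refine QuotientAddGroup.eq.2 ⟨m, ?_⟩
  simp only [zsmul_eq_mul]
  exact hm.symm

/-- The square of `q^(i-n)` is not one for an index `i`. -/
lemma Index.qpow_sq_ne (i : Index R) (n : ℕ) : i.1.qpow ^ 2 ≠ R.q ^ (2 * n) := by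
  obtain ⟨x, hx⟩ := QuotientAddGroup.mk_surjective i.1
  intro h
  rw [← hx, Weight.qpow_coe] at h
  have hk := R.k_ne
  have h1 : R.qpow (2 * (x - n)) = 1 := by
    have e : R.qpow (2 * (x - n)) * R.q ^ (2 * n) = R.qpow x ^ 2 := by
      rw [← RootData.qpow_natCast, ← RootData.qpow_add, pow_two, ← RootData.qpow_add]
      congr 1
      push_cast
      ring
    rw [h] at e
    exact (mul_eq_right₀ (pow_ne_zero _ R.q_ne)).1 e
  obtain ⟨m, hm⟩ := Weight.qpow_eq_one_iff.1 h1
  -- From `2(x - n) = m · 2r/k` one gets `x = (m r + n k)/k`, an excluded weight.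
  refine i.2 (m * R.r + n * R.k) ?_
  rw [← hx]
  congr 1
  rw [RootData.period] at hm
  push_cast
  field_simp at hm ⊢
  linear_combination hm

lemma Index.star_star (i : Index R) : i.star.star = i := Subtype.ext (neg_neg _)

/-- If `-i = i` then `q^(2i) = 1`, excluded for an index. So no index is its own dual, and the
isomorphisms `w_i` can be chosen freely on one element of each pair. -/
lemma Index.star_ne (i : Index R) : i.star ≠ i := by
  intro h
  have h1 : -i.1 = i.1 := congrArg Subtype.val h
  have h2 := Weight.qpow_neg i.1
  rw [h1] at h2
  refine i.qpow_sq_ne 0 ?_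
  rw [mul_zero, pow_zero, pow_two]
  nth_rewrite 1 [h2]
  exact inv_mul_cancel₀ (Weight.qpow_ne_zero _)

/-- The highest weight `q^(i+r-1)`. -/
noncomputable def Index.lam (i : Index R) : ℂ := -(i.1.qpow * R.q⁻¹)

/-- Since `q^r = -1`, the shift by `r - 1` is multiplication by `-q⁻¹`. -/
lemma Index.qpow_eq_lam (i : Index R) :
    (i.1 + (((R.r : ℂ) - 1 : ℂ) : Weight R)).qpow = i.lam := by
  have e : (R.r : ℂ) - 1 = ((R.r - 1 : ℕ) : ℂ) := by
    have := R.one_lt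
    push_cast [Nat.cast_sub this.le]
    rfl
  have h : R.q ^ (R.r - 1) = -R.q⁻¹ := by
    have h1 := R.q_pow_r
    rw [← Nat.sub_add_cancel R.one_lt.le, pow_succ] at h1
    rw [eq_neg_iff_add_eq_zero, ← mul_left_inj' R.q_ne, add_mul, h1, inv_mul_cancel₀ R.q_ne]
    simp
  rw [Weight.qpow_add, e, Weight.qpow_natCast, h, Index.lam, mul_neg]

lemma Index.lam_injective : Function.Injective (Index.lam : Index R → ℂ) := by
  intro i j h
  refine Subtype.ext (Weight.qpow_injective ?_)
  exact mul_right_cancel₀ (inv_ne_zero R.q_ne) (neg_inj.1 h)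

/-- By `dual_isHighestVector` the left side is the highest weight of the dual of `V_(-i)`; that dual
thus has the highest weight of `V_i`. -/
lemma Index.lam_star (i : Index R) : i.star.lam⁻¹ * R.q ^ (2 * (R.r - 1)) = i.lam := by
  have hq := R.q_ne
  have hμ := Weight.qpow_ne_zero i.1
  have h := q_sq_pow_pred R
  rw [Index.lam, Index.lam, pow_mul, h, show i.star.1 = -i.1 from rfl, Weight.qpow_neg]
  field_simp

/-- The number `{i - n}`. -/
noncomputable def Index.shiftBrace (i : Index R) (n : ℕ) : ℂ :=
  i.1.qpow * R.q⁻¹ ^ n - i.1.qpow⁻¹ * R.q ^ n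

lemma Index.shiftBrace_ne_zero (i : Index R) (n : ℕ) : i.shiftBrace n ≠ 0 := by
  have hq := R.q_ne
  have hμ := Weight.qpow_ne_zero i.1
  intro h
  refine i.qpow_sq_ne n ?_
  rw [Index.shiftBrace, inv_pow] at h
  field_simp at h
  linear_combination h

/-- The sum closes up to `c_n = -{n}{i-n}/{1}²`; the sign is that of `i.lam = -q^(i-1)`. -/
lemma vermaCoeff_eq (i : Index R) (n : ℕ) : (R.q - R.q⁻¹) ^ 2 * vermaCoeff R i.lam n =
    -((R.q ^ n - R.q⁻¹ ^ n) * i.shiftBrace n) := by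
  have hq := R.q_ne
  have hμ := Weight.qpow_ne_zero i.1
  have h0 := R.q_sub_inv_ne
  induction n with
  | zero => simp [vermaCoeff_zero]
  | succ n ih =>
    have e : (R.q - R.q⁻¹) ^ 2 * ((R.q - R.q⁻¹)⁻¹ * (i.lam * R.q⁻¹ ^ (2 * n) - i.lam⁻¹ *
        R.q ^ (2 * n))) = (R.q - R.q⁻¹) * (i.lam * R.q⁻¹ ^ (2 * n) - i.lam⁻¹ * R.q ^ (2 * n)) := by
      rw [← mul_assoc, pow_two, mul_assoc (R.q - R.q⁻¹), mul_inv_cancel₀ h0, mul_one]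
    rw [vermaCoeff_succ, mul_add, ih, e, Index.shiftBrace, Index.shiftBrace, Index.lam]
    have hn : R.q ^ n ≠ 0 := pow_ne_zero _ hq
    simp only [pow_succ, pow_mul', inv_pow]
    generalize R.q ^ n = t at hn ⊢
    field_simp
    ring

lemma Index.vermaCoeff_ne_zero (i : Index R) {n : ℕ} (hn : 0 < n) (hr : n < R.r) :
    vermaCoeff R i.lam n ≠ 0 := by
  intro h
  have h1 := vermaCoeff_eq i n
  rw [h, mul_zero, eq_comm, neg_eq_zero, mul_eq_zero] at h1
  have h2 := h1.resolve_right (i.shiftBrace_ne_zero n)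
  have hq := pow_ne_zero n R.q_ne
  have h3 : (R.q ^ 2) ^ n = 1 := by
    rw [inv_pow] at h2
    rw [← pow_mul, mul_comm, pow_mul]
    field_simp at h2
    linear_combination h2
  exact Nat.not_dvd_of_pos_of_lt hn hr ((R.q_sq_pow_eq_one_iff n).1 h3)

lemma Index.typical (i : Index R) : Typical R i.lam :=
  fun n hn => i.vermaCoeff_ne_zero n.succ_pos hn

lemma modifiedDim_eq (i : Index R) :
    modifiedDim i = (∏ j ∈ Finset.range (R.r - 1), i.shiftBrace (j + 1))⁻¹ := by
  rw [modifiedDim, one_div]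
  congr 1
  refine Finset.prod_congr rfl fun j _ => ?_
  have e : i.1 - ((1 : ℂ) : Weight R) - ((j : ℂ) : Weight R) =
      i.1 + -(((j + 1 : ℕ) : ℂ) : Weight R) := by
    push_cast
    rw [QuotientAddGroup.mk_add]
    abel
  rw [e, Weight.brace, Index.shiftBrace, Weight.qpow_neg, Weight.qpow_add, Weight.qpow_neg,
    Weight.qpow_natCast, mul_inv, inv_inv, inv_pow]

/-- The factor between the modified dimension and the trace. -/
noncomputable def dimFactor (R : RootData) : ℂ :=
  ∏ j ∈ Finset.range (R.r - 1), (-(R.q - R.q⁻¹) ^ 2 / (R.q ^ (j + 1) - R.q⁻¹ ^ (j + 1)))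

/-- The second factor is the trace of the map in `exists_avg_eq_id`. The first is the same for all
`i`, so it drops out when two cuts are compared. -/
lemma modifiedDim_eq_mul (i : Index R) : modifiedDim i =
    (dimFactor R)⁻¹ * (∏ n ∈ Finset.range (R.r - 1), vermaCoeff R i.lam (n + 1))⁻¹ := by
  have h0 := R.q_sub_inv_ne
  rw [modifiedDim_eq, dimFactor, ← mul_inv, ← Finset.prod_mul_distrib]
  congr 1
  refine Finset.prod_congr rfl fun j hj => ?_
  have hj' := Finset.mem_range.1 hj
  have h1 := vermaCoeff_eq i (j + 1)
  have h2 : R.q ^ (j + 1) - R.q⁻¹ ^ (j + 1) ≠ 0 := by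
    intro h
    rw [h, zero_mul, neg_zero] at h1
    exact (mul_ne_zero (pow_ne_zero 2 h0)
      (i.vermaCoeff_ne_zero j.succ_pos (by omega : j + 1 < R.r))) h1
  rw [eq_comm, neg_div, div_eq_mul_inv, ← neg_mul, mul_right_comm, neg_mul, h1, neg_neg,
    mul_right_comm, mul_inv_cancel₀ h2, one_mul]

/-- Since `q^r = -1`, one has `{-i-(r-n)} = {i-n}`; the factors are permuted by `n ↦ r - n`. -/
lemma modifiedDim_star (i : Index R) : modifiedDim i = modifiedDim i.star := by
  rw [modifiedDim_eq, modifiedDim_eq, ← Finset.prod_range_reflect]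
  congr 1
  refine Finset.prod_congr rfl fun j hj => ?_
  have hj' := Finset.mem_range.1 hj
  have hq := R.q_ne
  have hμ := Weight.qpow_ne_zero i.1
  have e : R.q ^ (R.r - 1 - 1 - j + 1) * R.q ^ (j + 1) = -1 := by
    rw [← pow_add, show R.r - 1 - 1 - j + 1 + (j + 1) = R.r by omega, R.q_pow_r]
  rw [Index.shiftBrace, Index.shiftBrace, show i.star.1 = -i.1 from rfl, Weight.qpow_neg, inv_pow,
    inv_pow, inv_inv]
  have e1 : R.q ^ (R.r - 1 - 1 - j + 1) = -(R.q ^ (j + 1))⁻¹ := by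
    rw [← neg_one_mul, eq_mul_inv_iff_mul_eq₀ (pow_ne_zero _ hq), e]
  rw [e1, inv_neg, inv_inv]
  ring

end Weights

end UqSl2

/-! ### Existence of highest weight modules -/

namespace UqSl2

open Ubar Pivotal WeightModule

section Verma

variable {R : RootData}

/-- The standard basis vectors, extended by zero. -/
def vermaVec (R : RootData) (m : ℕ) : Fin R.r → ℂ := fun n => if (n : ℕ) = m then 1 else 0

lemma vermaVec_eq_zero {m : ℕ} (hm : R.r ≤ m) : vermaVec R m = 0 :=
  funext fun n => if_neg (by omega)

lemma vermaVec_eq_basis (n : Fin R.r) : vermaVec R n = Pi.basisFun ℂ (Fin R.r) n := by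
  funext m
  rw [Pi.basisFun_apply, Pi.single_apply, vermaVec]
  simp only [Fin.ext_iff]

/-- The operator with prescribed values on the standard basis. -/
noncomputable def vermaOp (f : ℕ → Fin R.r → ℂ) : Module.End ℂ (Fin R.r → ℂ) :=
  (Pi.basisFun ℂ (Fin R.r)).constr ℂ fun n => f n

lemma vermaOp_vec {f : ℕ → Fin R.r → ℂ} (hf : ∀ m, R.r ≤ m → f m = 0) (m : ℕ) :
    vermaOp f (vermaVec R m) = f m := by
  rcases lt_or_ge m R.r with hm | hm
  · rw [show vermaVec R m = Pi.basisFun ℂ (Fin R.r) ⟨m, hm⟩ from vermaVec_eq_basis ⟨m, hm⟩,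
      vermaOp, Module.Basis.constr_basis]
  · rw [vermaVec_eq_zero hm, map_zero, hf m hm]

lemma end_ext_vermaVec {S T : Module.End ℂ (Fin R.r → ℂ)}
    (h : ∀ m < R.r, S (vermaVec R m) = T (vermaVec R m)) : S = T :=
  (Pi.basisFun ℂ (Fin R.r)).ext fun n => by rw [← vermaVec_eq_basis]; exact h n n.2

/-- The action of the generators on the highest weight module. -/
noncomputable def vermaGen (i : Index R) : Gen → Module.End ℂ (Fin R.r → ℂ)
  | .E => vermaOp fun m => vermaCoeff R i.lam m • vermaVec R (m - 1)
  | .F => vermaOp fun m => vermaVec R (m + 1)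
  | .K => vermaOp fun m => (i.lam * R.q⁻¹ ^ (2 * m)) • vermaVec R m
  | .Kinv => vermaOp fun m => (i.lam⁻¹ * R.q ^ (2 * m)) • vermaVec R m

variable (i : Index R)

/-- The only delicate index is `m = r`, where the vector is zero but the one of index `r - 1` is
not: there the coefficient vanishes because `q^r = q^(-r)`. -/
lemma vermaGen_E (m : ℕ) : vermaGen i .E (vermaVec R m) =
    vermaCoeff R i.lam m • vermaVec R (m - 1) := by
  refine vermaOp_vec (f := fun m => vermaCoeff R i.lam m • vermaVec R (m - 1)) (fun m hm => ?_) m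
  rcases hm.eq_or_lt with rfl | hm
  · have h := vermaCoeff_eq i R.r
    rw [inv_pow, R.q_pow_r, inv_neg, inv_one, sub_self, zero_mul, neg_zero] at h
    rw [(mul_eq_zero.1 h).resolve_left (pow_ne_zero _ R.q_sub_inv_ne), zero_smul]
  · rw [vermaVec_eq_zero (by omega), smul_zero]

lemma vermaGen_F (m : ℕ) : vermaGen i .F (vermaVec R m) = vermaVec R (m + 1) :=
  vermaOp_vec (f := fun m => vermaVec R (m + 1)) (fun m hm => vermaVec_eq_zero (by omega)) m

lemma vermaGen_K (m : ℕ) : vermaGen i .K (vermaVec R m) =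
    (i.lam * R.q⁻¹ ^ (2 * m)) • vermaVec R m :=
  vermaOp_vec (f := fun m => (i.lam * R.q⁻¹ ^ (2 * m)) • vermaVec R m)
    (fun m hm => by simp only [vermaVec_eq_zero hm, smul_zero]) m

lemma vermaGen_Kinv (m : ℕ) : vermaGen i .Kinv (vermaVec R m) =
    (i.lam⁻¹ * R.q ^ (2 * m)) • vermaVec R m :=
  vermaOp_vec (f := fun m => (i.lam⁻¹ * R.q ^ (2 * m)) • vermaVec R m)
    (fun m hm => by simp only [vermaVec_eq_zero hm, smul_zero]) m

lemma Index.lam_ne_zero : i.lam ≠ 0 :=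
  neg_ne_zero.2 (mul_ne_zero (Weight.qpow_ne_zero _) (inv_ne_zero R.q_ne))

lemma vermaGen_E_pow (n m : ℕ) (h : m < n) : (vermaGen i .E ^ n) (vermaVec R m) = 0 := by
  induction n generalizing m with
  | zero => omega
  | succ n ih =>
    rw [pow_succ, Module.End.mul_apply, vermaGen_E, map_smul]
    cases m with
    | zero => rw [vermaCoeff_zero, zero_smul]
    | succ m => rw [ih _ (by omega), smul_zero]

lemma vermaGen_F_pow (n m : ℕ) : (vermaGen i .F ^ n) (vermaVec R m) = vermaVec R (m + n) := by
  induction n generalizing m with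
  | zero => rfl
  | succ n ih =>
    rw [pow_succ, Module.End.mul_apply, vermaGen_F, ih]
    congr 1
    omega

lemma satisfies_vermaGen : Satisfies R (vermaGen i) where
  K_Kinv := end_ext_vermaVec fun m _ => by
    have hq : R.q ^ (2 * m) ≠ 0 := pow_ne_zero _ R.q_ne
    have hl := i.lam_ne_zero
    rw [Module.End.mul_apply, vermaGen_Kinv, map_smul, vermaGen_K, smul_smul, inv_pow,
      Module.End.one_apply, mul_mul_mul_comm, inv_mul_cancel₀ hl, mul_inv_cancel₀ hq, mul_one,
      one_smul]
  Kinv_K := end_ext_vermaVec fun m _ => by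
    have hq : R.q ^ (2 * m) ≠ 0 := pow_ne_zero _ R.q_ne
    have hl := i.lam_ne_zero
    rw [Module.End.mul_apply, vermaGen_K, map_smul, vermaGen_Kinv, smul_smul, inv_pow,
      Module.End.one_apply, mul_mul_mul_comm, mul_inv_cancel₀ hl, inv_mul_cancel₀ hq, mul_one,
      one_smul]
  K_E := end_ext_vermaVec fun m _ => by
    have hq := R.q_ne
    have hl := i.lam_ne_zero
    rw [Module.End.mul_apply, Module.End.mul_apply, vermaGen_Kinv, map_smul, map_smul, vermaGen_E,
      map_smul, vermaGen_K, LinearMap.smul_apply, vermaGen_E, smul_smul, smul_smul, smul_smul]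
    cases m with
    | zero => simp [vermaCoeff_zero]
    | succ m =>
      congr 1
      rw [Nat.add_sub_cancel, inv_pow]
      field_simp
      ring
  K_F := end_ext_vermaVec fun m _ => by
    have hq := R.q_ne
    have hl := i.lam_ne_zero
    rw [Module.End.mul_apply, Module.End.mul_apply, vermaGen_Kinv, map_smul, map_smul, vermaGen_F,
      vermaGen_K, LinearMap.smul_apply, vermaGen_F, smul_smul]
    congr 1
    rw [inv_pow, inv_pow]
    field_simp
    ring
  E_F := end_ext_vermaVec fun m _ => by
    rw [LinearMap.sub_apply, Module.End.mul_apply, Module.End.mul_apply, LinearMap.smul_apply,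
      LinearMap.sub_apply, vermaGen_F, vermaGen_E, vermaGen_E, vermaGen_K, vermaGen_Kinv, map_smul,
      vermaGen_F, vermaCoeff_succ, add_smul, Nat.add_sub_cancel, ← sub_smul, smul_smul]
    cases m with
    | zero => rw [vermaCoeff_zero, zero_smul, zero_smul, zero_add, sub_zero]
    | succ m => rw [Nat.add_sub_cancel, add_sub_cancel_left]
  E_pow := end_ext_vermaVec fun m hm => by rw [vermaGen_E_pow i _ _ hm]; rfl
  F_pow := end_ext_vermaVec fun m hm => by
    rw [vermaGen_F_pow, vermaVec_eq_zero (by omega)]; rfl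

/-- The highest weight module of an index. -/
noncomputable def vermaModule : WeightModule R where
  carrier := Fin R.r → ℂ
  ρ := Ubar.lift (vermaGen i) (satisfies_vermaGen i)
  diagonal := ⟨Fin R.r, Pi.basisFun ℂ _, fun n => ⟨i.lam * R.q⁻¹ ^ (2 * (n : ℕ)), by
    rw [lift_gen, ← vermaVec_eq_basis, vermaGen_K]⟩⟩

lemma isHighestWeight_vermaModule :
    IsHighestWeight (vermaModule i) (i.1 + (((R.r : ℂ) - 1 : ℂ) : Weight R)) := by
  have hρ : ∀ g, (vermaModule i).ρ (gen R g) = vermaGen i g := lift_gen _ (satisfies_vermaGen i)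
  refine ⟨vermaVec R 0, ?_, ?_, ?_, fun w => ?_⟩
  · intro h
    have := congrFun (show vermaVec R 0 = 0 from h) 0
    simp [vermaVec] at this
  · rw [hρ, i.qpow_eq_lam]
    refine (vermaGen_K i 0).trans ?_
    rw [mul_zero, pow_zero, mul_one]
    rfl
  · rw [hρ]
    refine (vermaGen_E i 0).trans ?_
    rw [vermaCoeff_zero, zero_smul]
    rfl
  · have h : ∀ w : Fin R.r → ℂ, ∃ a, Ubar.lift (vermaGen i) (satisfies_vermaGen i) a
        (vermaVec R 0) = w := by
      intro w
      refine ⟨∑ n : Fin R.r, w n • gen R .F ^ (n : ℕ), ?_⟩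
      rw [map_sum, LinearMap.sum_apply, ← (Pi.basisFun ℂ (Fin R.r)).sum_repr w]
      refine Finset.sum_congr rfl fun n _ => ?_
      rw [map_smul, map_pow, lift_gen, LinearMap.smul_apply, vermaGen_F_pow, zero_add,
        vermaVec_eq_basis, Module.Basis.sum_repr, Pi.basisFun_repr]
    exact h w

end Verma

end UqSl2

/-! ### Basic data and the modified dimension -/

namespace UqSl2

open Ubar Pivotal WeightModule
open scoped TensorProduct

/-! ### Twisting an isomorphism onto a dual. -/

section Twist

variable {R : RootData} {X Y : WeightModule R}

/-- The morphism with the same pairing up to the pivot. -/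
noncomputable def twistHom (u : X ⟶ Pivotal.dual Y) : Y ⟶ Pivotal.dual X :=
  (ρ_ Y).inv ≫ Y ◁ Pivotal.b X ≫ (α_ _ _ _).inv ≫ (Y ◁ u ≫ Pivotal.d' Y) ▷ Pivotal.dual X ≫
    (λ_ (Pivotal.dual X)).hom

/-- The pairing of a vector of the dual with a vector. -/
def dualApply (φ : (Pivotal.dual X).carrier) : X.carrier →ₗ[ℂ] ℂ := φ

lemma twistHom_apply (u : X ⟶ Pivotal.dual Y) (y : Y.carrier) (x : X.carrier) :
    dualApply ((twistHom u).toLin y) x = dualApply (u.toLin x) (Y.pivotInv y) := by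
  have h : (twistHom u).toLin y = (LinearMap.applyₗ (R := ℂ) (Y.pivotInv y) ∘ₗ
      (show X.carrier →ₗ[ℂ] Module.Dual ℂ Y.carrier from u.toLin) : X.carrier →ₗ[ℂ] ℂ) :=
    contract_coevL (V := X.carrier) (LinearMap.applyₗ (R := ℂ) (Y.pivotInv y) ∘ₗ
      (show X.carrier →ₗ[ℂ] Module.Dual ℂ Y.carrier from u.toLin))
      (UqSl2.evR Y.ρ ∘ₗ TensorProduct.map LinearMap.id
        (show X.carrier →ₗ[ℂ] Module.Dual ℂ Y.carrier from u.toLin)) y fun _ => rfl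
  rw [h]
  rfl

/-- It says that twisting twice returns the original pairing: applying `K^(1-r)` to both arguments
changes nothing. -/
lemma dualApply_pivotInv (u : X ⟶ Pivotal.dual Y) (x : X.carrier) (y : Y.carrier) :
    dualApply (u.toLin (X.pivotInv x)) (Y.pivotInv y) = dualApply (u.toLin x) y := by
  rw [hom_pivotInv]
  exact wordEvL_pivotInv (Word.strand Y true) (u.toLin x) y

/-- As `u` is onto, a vector `y` in the kernel has `K^(1-r) y` annihilated by every functional. -/
lemma twistHom_injective (u : X ≅ Pivotal.dual Y) : Function.Injective (twistHom u.hom).toLin := by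
  refine (injective_iff_map_eq_zero _).2 fun y hy => ?_
  have h : ∀ φ : Module.Dual ℂ Y.carrier, φ (Y.pivotInv y) = 0 := by
    intro φ
    have e : u.hom.toLin (u.inv.toLin φ) = φ := LinearMap.congr_fun (congrArg Hom.toLin u.inv_hom_id) φ
    have h1 := twistHom_apply u.hom y (u.inv.toLin φ)
    rw [e, hy] at h1
    exact h1.symm
  have h0 := (Module.forall_dual_apply_eq_zero_iff ℂ (Y.pivotInv y)).1 h
  rw [← pivot_pivotInv y, h0, map_zero]

/-- The twisted isomorphism. -/
noncomputable def twist (u : X ≅ Pivotal.dual Y)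
    (h : Module.finrank ℂ X.carrier = Module.finrank ℂ Y.carrier) : Y ≅ Pivotal.dual X :=
  mkIso (LinearMap.linearEquivOfInjective (V₂ := (Pivotal.dual X).carrier) (twistHom u.hom).toLin
    (twistHom_injective u) (h.symm.trans (Subspace.dual_finrank_eq (K := ℂ) (V := X.carrier)).symm))
    fun g y => (twistHom u.hom).comm (gen R g) y

lemma twist_apply (u : X ≅ Pivotal.dual Y)
    (h : Module.finrank ℂ X.carrier = Module.finrank ℂ Y.carrier) (y : Y.carrier) (x : X.carrier) :
    dualApply ((twist u h).hom.toLin y) x = dualApply (u.hom.toLin x) (Y.pivotInv y) :=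
  twistHom_apply u.hom y x

end Twist

section Involution

variable {R : RootData} {I : Type*} {star : I → I} {V : I → WeightModule R}

/-- A choice of one isomorphism for each pair of dual indices, extended by twisting. -/
noncomputable def dualIso (u : ∀ i j, j = star i → (V i ≅ Pivotal.dual (V j)))
    (hd : ∀ i j, Module.finrank ℂ (V i).carrier = Module.finrank ℂ (V j).carrier) (i j : I)
    (h : j = star i) (h' : i = star j) : V i ≅ Pivotal.dual (V j) := by
  -- A well-order on the indices selects which of the two dual indices carries the free choice.
  classical exact if WellOrderingRel i j then u i j h else twist (u j i h') (hd j i)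

variable (u : ∀ i j, j = star i → (V i ≅ Pivotal.dual (V j)))
  (hd : ∀ i j, Module.finrank ℂ (V i).carrier = Module.finrank ℂ (V j).carrier)

/-- One of the two isomorphisms is the twist of the other. In one order this is the definition, in
the other it uses that the double twist is trivial. -/
lemma dualIso_apply {i j : I} (hij : i ≠ j) (h : j = star i) (h' : i = star j)
    (x : (V i).carrier) (y : (V j).carrier) :
    dualApply ((dualIso u hd j i h' h).hom.toLin y) x =
      dualApply ((dualIso u hd i j h h').hom.toLin x) ((V j).pivotInv y) := by
  rcases trichotomous_of (WellOrderingRel (α := I)) i j with hlt | heq | hlt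
  · rw [dualIso, if_neg (asymm_of WellOrderingRel hlt), dualIso, if_pos hlt, twist_apply]
  · exact absurd heq hij
  · rw [dualIso, if_pos hlt, dualIso, if_neg (asymm_of WellOrderingRel hlt), twist_apply,
      dualApply_pivotInv]

lemma dualIso_comp_eqToHom {i j k : I} (e : j = k) (h : j = star i) (h' : i = star j)
    (h'' : k = star i) (h''' : i = star k) (p : Pivotal.dual (V j) = Pivotal.dual (V k)) :
    (dualIso u hd i j h h').hom ≫ eqToHom p = (dualIso u hd i k h'' h''').hom := by
  subst e
  rw [eqToHom_refl, Category.comp_id]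

end Involution

/-! ### Basic data and ambidexterity for highest weight modules. -/

section Main

variable {R : RootData}

lemma groundSMul_groundEquiv (c : ℂ) (V : WeightModule R) :
    (groundSMul (groundEquiv R c) (𝟙 V)).toLin = c • LinearMap.id := by
  refine LinearMap.ext fun v => ?_
  have h : (groundSMul (groundEquiv R c) (𝟙 V)).toLin v = (c • (1 : ℂ)) • v := rfl
  rw [h, smul_eq_mul, mul_one]
  rfl

lemma bracket_spec {V : WeightModule R} (hs : Pivotal.IsSimple V) (f : V ⟶ V) :
    ∃ a : ℂ, Pivotal.bracket hs f = groundEquiv R a ∧ f.toLin = a • LinearMap.id := by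
  obtain ⟨a, ha⟩ := (groundEquiv R).surjective (Pivotal.bracket hs f)
  refine ⟨a, ha.symm, ?_⟩
  have h1 : f = groundSMul (Pivotal.bracket hs f) (𝟙 V) := (hs f).choose_spec.1
  rw [← groundSMul_groundEquiv, ha]
  exact congrArg Hom.toLin h1

namespace IsTypical

variable {V : WeightModule R} {w : V.carrier} {lam : ℂ} (h : IsTypical V lam w)

include h

lemma isSimple : Pivotal.IsSimple V := by
  intro f
  obtain ⟨a, ha⟩ := h.end_eq_smul f
  refine ⟨groundEquiv R a, Hom.ext (ha.trans (groundSMul_groundEquiv a V).symm), fun k hk => ?_⟩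
  obtain ⟨c, rfl⟩ := (groundEquiv R).surjective k
  have h1 := LinearMap.congr_fun (ha.symm.trans
    ((congrArg Hom.toLin hk).trans (groundSMul_groundEquiv c V))) w
  exact congrArg _ (smul_left_injective ℂ h.ne_zero h1).symm

lemma dual {i : Index R} (hi : lam = i.star.lam) :
    IsTypical (Pivotal.dual V) i.lam (h.basis.coord (lastIndex R)) where
  toIsHighestVector := by
    have e : lam⁻¹ * R.q ^ (2 * (R.r - 1)) = i.lam := by rw [hi, i.lam_star]
    exact e ▸ h.dual_isHighestVector
  typical := i.typical
  finrank := (Subspace.dual_finrank_eq (K := ℂ) (V := V.carrier)).trans h.finrank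

end IsTypical

lemma IsHighestWeight.exists_isTypical {V : WeightModule R} {i : Index R}
    (h : IsHighestWeight V (i.1 + (((R.r : ℂ) - 1 : ℂ) : Weight R))) :
    ∃ w : V.carrier, IsTypical V i.lam w := by
  obtain ⟨w, hw, hK, hE, hg⟩ := h
  have hv : IsHighestVector V i.lam w := ⟨hw, by rw [hK, i.qpow_eq_lam], hE⟩
  exact ⟨w, hv, i.typical, hv.finrank_eq i.typical hg⟩

section Family

variable {V : Index R → WeightModule R} {w : ∀ i, (V i).carrier}
  (h : ∀ i, IsTypical (V i) i.lam (w i))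

/-- The isomorphisms `V i ≅ (V (-i))*`. -/
noncomputable def indexIso (i j : Index R) (hij : j = i.star) : V i ≅ Pivotal.dual (V j) :=
  (h i).iso ((h j).dual (by rw [hij]))

include h in
lemma indexFinrank (i j : Index R) :
    Module.finrank ℂ (V i).carrier = Module.finrank ℂ (V j).carrier :=
  (h i).finrank.trans (h j).finrank.symm

/-- Basic data for a family of highest weight modules. -/
noncomputable def basicData : Pivotal.BasicData V Index.star where
  star_star := Index.star_star
  simple i := (h i).isSimple
  hom_eq_zero hij f := (h _).hom_eq_zero (h _) (fun e => hij (Index.lam_injective e)) f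
  w i := dualIso (indexIso h) (indexFinrank h) i i.star rfl i.star_star.symm
  w_compat i := by
    rw [dualIso_comp_eqToHom (indexIso h) (indexFinrank h) i.star_star rfl _
      i.star_star.symm rfl]
    -- On pure tensors the compatibility of `d` and `d'` is the pairing identity between the two
    -- isomorphisms, with `K^(1-r)` coming from `d'`.
    exact Hom.ext (TensorProduct.ext' fun y x =>
      dualIso_apply (indexIso h) (indexFinrank h) i.star_ne.symm rfl i.star_star.symm x y)

include h

/-- Every `V_l` and its dual are relatively projective, so all colors may carry marks. The trace of
a marked cut depends only on the closed graph, and each side is that trace up to the common factor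
`(dimFactor R)⁻¹`. -/
lemma trace_cut_mul_eq {T : Diagram (.unit : Word (WeightModule R)) .unit} {i j : Index R}
    {A : Diagram (.strand (V i) true) (.strand (V i) true)}
    {B : Diagram (.strand (V j) true) (.strand (V j) true)}
    (hA : T.IsCuttingPresentation A) (hB : T.IsCuttingPresentation B) {a b : ℂ}
    (ha : A.eval.toLin = a • LinearMap.id) (hb : B.eval.toLin = b • LinearMap.id) :
    modifiedDim i * a = modifiedDim j * b := by
  have hP : ∀ W ∈ Set.range V, IsProj W ∧ IsProj (Pivotal.dual W) := by
    rintro _ ⟨l, rfl⟩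
    exact ⟨(h l).isProj, ((h l).dual (i := l.star) (by rw [l.star_star])).isProj⟩
  have mark : ∀ (l : Index R) (D : Diagram (.strand (V l) true) (.strand (V l) true)) (c : ℂ),
      D.eval.toLin = c • LinearMap.id → ∃ m : Lin (V l) (V l), Mark (Set.range V) D m ∧
        LinearMap.trace ℂ _ m =
          c * (∏ n ∈ Finset.range (R.r - 1), vermaCoeff R l.lam (n + 1))⁻¹ := by
    intro l D c hD
    obtain ⟨k, hk, hk1, hk2⟩ := (h l).exists_avg_eq_id
    -- The cut has value `c Id`, so `c k` is a mark at its open strand.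
    refine ⟨c • k, .base (Or.inl ⟨V l, ⟨l, rfl⟩, rfl⟩) (fun x => ?_) ?_, ?_⟩
    · refine (congrArg (c • ·) (hk x)).trans ?_
      exact (((V l).ρ (gen R .K)).map_smul c (k x)).symm
    · have e : Lin.avg (c • k) = c • k.avg := map_smul (UqSl2.avg (V l).ρ (V l).ρ) c k
      refine e.trans ?_
      rw [hk1]
      exact hD.symm
    · rw [map_smul, hk2, smul_eq_mul]
  obtain ⟨m, hm, hm'⟩ := mark i A a ha
  obtain ⟨n, hn, hn'⟩ := mark j B b hb
  have key := trace_mark_eq hP hA hB hm hn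
  rw [hm', hn'] at key
  rw [modifiedDim_eq_mul, modifiedDim_eq_mul, mul_assoc, mul_assoc, mul_comm _ a, mul_comm _ b, key]

lemma isTrivalentAmbidextrous (B : Pivotal.BasicData V Index.star) :
    B.IsTrivalentAmbidextrous Set.univ (fun i => groundEquiv R (modifiedDim i.1)) := by
  refine ⟨fun _ _ => trivial, fun i => congrArg _ (modifiedDim_star i.1), ?_⟩
  intro T _ i j A A' hA hA'
  obtain ⟨a, ha, ha'⟩ := bracket_spec (B.simple i) A.eval
  obtain ⟨b, hb, hb'⟩ := bracket_spec (B.simple j) A'.eval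
  rw [ha, hb, ← map_mul, ← map_mul, trace_cut_mul_eq h hA hA' ha' hb']

end Family

end Main

end UqSl2

theorem mainTheorem2 (R : UqSl2.RootData) :
    (∀ i : UqSl2.Index R, ∃ M : UqSl2.WeightModule R,
      UqSl2.IsHighestWeight M (i.1 + (((R.r : ℂ) - 1 : ℂ) : UqSl2.Weight R))) ∧
    ∀ V : UqSl2.Index R → UqSl2.WeightModule R,
      (∀ i, UqSl2.IsHighestWeight (V i) (i.1 + (((R.r : ℂ) - 1 : ℂ) : UqSl2.Weight R))) →
        Nonempty (Pivotal.BasicData V UqSl2.Index.star) ∧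
        ∀ B : Pivotal.BasicData V UqSl2.Index.star,
          B.IsTrivalentAmbidextrous Set.univ
            (fun i => UqSl2.groundEquiv R (UqSl2.modifiedDim i.1)) := by
  refine ⟨fun i => ⟨_, UqSl2.isHighestWeight_vermaModule i⟩, fun V hV => ?_⟩
  choose w hw using fun i => (hV i).exists_isTypical
  exact ⟨⟨UqSl2.basicData hw⟩, UqSl2.isTrivalentAmbidextrous hw⟩
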